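/- Let $k\ge 3$ and $n\ge 1$ be integers and let $a_1,\dots,a_k$ be integers with $0<a_i\le n/2$ and $2a_i\ne n$ for all $i$. Let $G=C_n(a_1,\dots,a_k)$ be the circulant graph, with vertex set $\mathbb{Z}/n\mathbb{Z}$ and $v$ adjacent to $v\pm a_i$ for $1\le i\le k$, and suppose that $G$ is connected. Suppose that $n=2^r l$ with $l$ odd, that $a_i=2^{r_i}l_i$ with $l_i$ odd and $0<r_i<r$ for $1\le i\le k-1$, that $r_{i+1}<r_i$ for $1\le i\le k-2$, that $a_k$ is odd, and that $a_i\not\equiv\pm 2a_{i+1}\pmod n$ for $1\le i\le k-1$. Then the genus of $G$, i.e. the least genus of a closed orientable surface in which $G$ embeds without crossings, is exactly $$\frac{nk-2n+4}{4}.$$ -/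

import Mathlib

/-- A closed connected oriented surface with a finite cell structure having at least one edge,
presented in the usual way by its darts (oriented edges): `rev` reverses a dart, and `rot` sends a
dart to the next dart, in the positive sense, around its initial vertex. Thus vertices are the
cycles of `rot`, edges are the cycles of `rev`, and the boundary walks of the (open disc) faces are
the cycles of `rot * rev`. Loops and multiple edges are allowed in the `1`-skeleton. -/
structure CellSurface where
  Dart : Type
  finite_dart : Finite Dart
  nonempty_dart : Nonempty Dart
  rot : Equiv.Perm Dart
  rev : Equiv.Perm Dart
  rev_rev : ∀ d, rev (rev d) = d
  rev_ne : ∀ d, rev d ≠ d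
  connected : ∀ d e, ∃ p ∈ Subgroup.closure ({rot, rev} : Set (Equiv.Perm Dart)), p d = e

namespace CellSurface

/-- The vertices of the cell structure. -/
def Vertex (M : CellSurface) : Type := Quotient (Equiv.Perm.SameCycle.setoid M.rot)

/-- The (unoriented) edges of the cell structure. -/
def Edge (M : CellSurface) : Type := Quotient (Equiv.Perm.SameCycle.setoid M.rev)

/-- The faces of the cell structure. -/
def Face (M : CellSurface) : Type := Quotient (Equiv.Perm.SameCycle.setoid (M.rot * M.rev))

/-- The initial vertex of a dart. -/
def source (M : CellSurface) (d : M.Dart) : M.Vertex :=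
  Quotient.mk (Equiv.Perm.SameCycle.setoid M.rot) d

/-- The Euler characteristic `V - E + F`. -/
noncomputable def eulerChar (M : CellSurface) : ℤ :=
  (Nat.card M.Vertex : ℤ) - Nat.card M.Edge + Nat.card M.Face

/-- The surface underlying `M` is the orientable closed surface of genus `g`. -/
def IsOfGenus (M : CellSurface) (g : ℕ) : Prop := M.eulerChar = 2 - 2 * (g : ℤ)

end CellSurface

/-- A crossing-free drawing of the graph `G` on the surface `M`, where the drawing is part of the
`1`-skeleton of the cell structure: distinct vertices go to distinct vertices and distinct edges to
distinct edges, compatibly with incidence. The `1`-skeleton may have further vertices and edges, so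
the regions into which the drawing of `G` divides the surface need not be discs. -/
structure GraphEmbedding {V : Type*} (G : SimpleGraph V) (M : CellSurface) where
  onVertex : V → M.Vertex
  onVertex_injective : Function.Injective onVertex
  onDart : G.Dart → M.Dart
  onDart_injective : Function.Injective onDart
  onDart_symm : ∀ d : G.Dart, onDart d.symm = M.rev (onDart d)
  source_onDart : ∀ d : G.Dart, M.source (onDart d) = onVertex d.fst

/-- `G` can be embedded without crossings in the closed orientable surface of genus `g`. -/
def EmbedsInGenus {V : Type*} (G : SimpleGraph V) (g : ℕ) : Prop :=
  ∃ M : CellSurface, M.IsOfGenus g ∧ Nonempty (GraphEmbedding G M)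

/-- The genus of `G` is `g`: the least genus of a closed orientable surface in which `G` embeds. -/
def HasGenus {V : Type*} (G : SimpleGraph V) (g : ℕ) : Prop :=
  IsLeast {h : ℕ | EmbedsInGenus G h} g

/-- The circulant graph `C_n(a_1, …, a_k)`: its vertices are the residues modulo `n`, and a vertex
`v` is adjacent to the vertices `v ± a_i`. The jump `a_i` is `a ⟨i - 1, _⟩`. -/
def circulant (n : ℕ) {k : ℕ} (a : Fin k → ℕ) : SimpleGraph (ZMod n) :=
  SimpleGraph.circulantGraph (Set.range fun i => (a i : ZMod n))

/-! Lower bound. The graph has no triangles. In a vanishing sum of three signed jumps the smallest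
2-adic valuation cannot occur once or three times, since every jump has smaller valuation than `n`.
If it occurs twice, the equation reads `a i = ± 2 * a j`, or else one jump is zero; the former is
excluded by hypothesis for neighbouring indices and by valuations for distant ones. Hence faces have
at least four sides, and Euler's formula for a `2k`-regular graph gives the bound
(`EmbedsInGenus.le_of_regular`). A drawing may be a proper part of the 1-skeleton, so the surplus
darts are removed one by one from the vertex and edge permutations. The quantity that survives this
is `eulerDefect`: it is minus twice the genus for a cell surface and never decreases
(`eulerDefect_le_swap_mul`).

Upper bound. Equality needs an embedding all of whose faces are quadrilaterals. It is given by a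
cyclic order of the signed jumps at every vertex, and all faces built here have the form `v, v+x,
v+x+y, v+y`. This makes the condition local (`IsQuad`): it can be stated for periodic systems on the
integers and depends on the jumps modulo the period only. The period used is a power of two dividing
`n`.

Such systems are built by strong induction on the number of generators (`HasQuad.of_strictAnti`).
Scaling by a power of two and pulling back along a 2-adic unit make the last generator `1`. Two
generators give a toroidal grid. Three are handled by an explicit rotation reading binary digits of
the vertex (`HexData.isQuad`). With five or more, the first, the last but one and the last generator
form a three-generator system, the others a smaller one, and at each vertex a square of one is
spliced with a square of the other (`HasQuad.merge`): tubes between faces carry the new squares. The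
splice consumes a family of squares meeting every vertex once, so the induction carries such a
family (`IsSquares`) and must leave a fresh one behind.

Four generators would leave a single one for the second system. Instead copies of a three-generator
system are stacked in layers, and the edges of the generator `1` run along tubes between consecutive
layers (`HasQuad.layer`, `HasQuad.four`). Going once through all layers shifts the system by an odd
`t`; `ladderSign` and `crossSign` define two systems that share a family of squares, mirrored, up to
this shift. -/

open Equiv

/-! ### Merging two classes of an equivalence relation -/

section Glue

variable {D : Type*}

/-- The equivalence relation identifying `x` with `y` and nothing else. -/
def pairSetoid (x y : D) : Setoid D where
  r a b := a = b ∨ ((a = x ∨ a = y) ∧ (b = x ∨ b = y))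
  iseqv := ⟨fun _ => Or.inl rfl, by rintro a b (h | h); exacts [Or.inl h.symm, Or.inr ⟨h.2, h.1⟩], by
    rintro a b c (rfl | h) (rfl | h')
    exacts [Or.inl rfl, Or.inr h', Or.inr h, Or.inr ⟨h.1, h'.2⟩]⟩

/-- The equivalence relation obtained from `r` by merging the classes of `x` and `y`. -/
def glueSetoid (r : Setoid D) (x y : D) : Setoid D where
  r a b := r a b ∨ ((r a x ∨ r a y) ∧ (r b x ∨ r b y))
  iseqv := ⟨fun a => Or.inl (r.refl a), by
      rintro a b (h | h); exacts [Or.inl (r.symm h), Or.inr ⟨h.2, h.1⟩], by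
    rintro a b c (h | h) (h' | h')
    · exact Or.inl (r.trans h h')
    · exact Or.inr ⟨h'.1.imp (r.trans h) (r.trans h), h'.2⟩
    · exact Or.inr ⟨h.1, h.2.imp (r.trans (r.symm h')) (r.trans (r.symm h'))⟩
    · exact Or.inr ⟨h.1, h'.2⟩⟩

theorem sup_pairSetoid (r : Setoid D) (x y : D) : r ⊔ pairSetoid x y = glueSetoid r x y := by
  apply le_antisymm
  · refine sup_le (fun {a b} h => Or.inl h) (fun {a b} h => ?_)
    rcases h with rfl | ⟨ha, hb⟩
    · exact Or.inl (r.refl a)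
    · refine Or.inr ⟨?_, ?_⟩
      · rcases ha with rfl | rfl
        exacts [Or.inl (r.refl _), Or.inr (r.refl _)]
      · rcases hb with rfl | rfl
        exacts [Or.inl (r.refl _), Or.inr (r.refl _)]
  · intro a b h
    set j := r ⊔ pairSetoid x y
    have hr : r ≤ j := le_sup_left
    have hp : j x y := (le_sup_right : pairSetoid x y ≤ j) (Or.inr ⟨Or.inl rfl, Or.inr rfl⟩)
    rcases h with h | ⟨ha, hb⟩
    · exact hr h
    · have h1 : j a x := ha.elim (fun h => hr h) (fun h => j.trans (hr h) (j.symm hp))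
      have h2 : j b x := hb.elim (fun h => hr h) (fun h => j.trans (hr h) (j.symm hp))
      exact j.trans h1 (j.symm h2)

theorem card_quotient_sup_of_rel (r : Setoid D) {x y : D} (h : r x y) :
    Nat.card (Quotient (r ⊔ pairSetoid x y)) = Nat.card (Quotient r) := by
  have : r ⊔ pairSetoid x y = r := by
    apply sup_eq_left.2
    rintro a b (rfl | ⟨rfl | rfl, rfl | rfl⟩)
    exacts [r.refl _, r.refl _, h, r.symm h, r.refl _]
  rw [this]

theorem card_quotient_sup_of_not_rel [Finite D] (r : Setoid D) {x y : D} (h : ¬ r x y) :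
    Nat.card (Quotient (r ⊔ pairSetoid x y)) + 1 = Nat.card (Quotient r) := by
  classical
  rw [sup_pairSetoid]
  have : Fintype (Quotient r) := Fintype.ofFinite _
  let f : {q : Quotient r // q ≠ Quotient.mk r y} → Quotient (glueSetoid r x y) :=
    fun q => Quotient.map' (s₁ := r) (s₂ := glueSetoid r x y) id (fun a b h => Or.inl h) q.1
  have hf : Function.Bijective f := by
    constructor
    · rintro ⟨p, hp⟩ ⟨q, hq⟩ hpq
      induction p using Quotient.inductionOn with | _ a
      induction q using Quotient.inductionOn with | _ b
      have ha : ¬ r a y := fun h => hp (Quotient.sound h)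
      have hb : ¬ r b y := fun h => hq (Quotient.sound h)
      have : (glueSetoid r x y) a b := Quotient.exact hpq
      apply Subtype.ext
      apply Quotient.sound
      rcases this with h | ⟨h1 | h1, h2 | h2⟩
      · exact h
      · exact r.trans h1 (r.symm h2)
      all_goals tauto
    · intro q
      induction q using Quotient.inductionOn with | _ a
      by_cases ha : r a y
      · refine ⟨⟨Quotient.mk r x, fun h' => h (Quotient.exact h')⟩, ?_⟩
        exact Quotient.sound (s := glueSetoid r x y) (Or.inr ⟨Or.inl (r.refl x), Or.inr ha⟩)
      · exact ⟨⟨Quotient.mk r a, fun h' => ha (Quotient.exact h')⟩, rfl⟩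
  have h1 := Nat.card_congr (Equiv.ofBijective f hf)
  rw [← h1, Nat.card_eq_fintype_card, Nat.card_eq_fintype_card,
    Fintype.card_subtype_compl, Fintype.card_subtype_eq]
  have : 0 < Fintype.card (Quotient r) := Fintype.card_pos_iff.2 ⟨Quotient.mk r y⟩
  omega

end Glue

/-! ### Cycles of a permutation multiplied by a transposition -/

section Cycles

variable {D : Type*}

theorem sameCycle_le {σ : Perm D} {r : Setoid D} (h : ∀ a, r a (σ a)) :
    Perm.SameCycle.setoid σ ≤ r := by
  rintro a b ⟨i, rfl⟩
  have key : ∀ (n : ℕ) (a : D), r a ((σ ^ n) a) := by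
    intro n
    induction n with
    | zero => intro a; exact r.refl a
    | succ n ih => intro a; rw [pow_succ', Perm.mul_apply]; exact r.trans (ih a) (h _)
  cases i with
  | ofNat n => exact key n a
  | negSucc n =>
    have := key (n + 1) ((σ ^ (Int.negSucc n)) a)
    rw [zpow_negSucc, ← Perm.mul_apply, mul_inv_cancel, Perm.one_apply] at this
    rw [zpow_negSucc]
    exact r.symm this

theorem sameCycle_self_apply (σ : Perm D) (a : D) : Perm.SameCycle.setoid σ a (σ a) :=
  ⟨1, by simp⟩

theorem sameCycle_mul_le (σ α : Perm D) : Perm.SameCycle.setoid (σ * α) ≤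
    Perm.SameCycle.setoid σ ⊔ Perm.SameCycle.setoid α := by
  apply sameCycle_le
  intro a
  set j := Perm.SameCycle.setoid σ ⊔ Perm.SameCycle.setoid α
  exact j.trans ((le_sup_right : Perm.SameCycle.setoid α ≤ j) (sameCycle_self_apply α a))
    ((le_sup_left : Perm.SameCycle.setoid σ ≤ j) (sameCycle_self_apply σ (α a)))

/-- The number of cycles of a permutation, fixed points included. -/
noncomputable def cycleCount (σ : Perm D) : ℕ := Nat.card (Quotient (Perm.SameCycle.setoid σ))

/-- The number of orbits of the group generated by two permutations. -/
noncomputable def componentCount (σ α : Perm D) : ℕ :=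
  Nat.card (Quotient (Perm.SameCycle.setoid σ ⊔ Perm.SameCycle.setoid α))

/-- Twice the number of components minus twice the total genus, for the permutation pair
`(σ, α)` on `D`. -/
noncomputable def eulerDefect (σ α : Perm D) : ℤ :=
  (cycleCount σ : ℤ) + cycleCount α + cycleCount (σ * α) - Nat.card D - 2 * componentCount σ α

variable [DecidableEq D]

theorem sup_pair_swap_mul_le (σ : Perm D) (x y : D) :
    Perm.SameCycle.setoid (swap x y * σ) ≤ Perm.SameCycle.setoid σ ⊔ pairSetoid x y := by
  apply sameCycle_le
  intro a
  set j := Perm.SameCycle.setoid σ ⊔ pairSetoid x y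
  have h1 : j a (σ a) := (le_sup_left : Perm.SameCycle.setoid σ ≤ j) (sameCycle_self_apply σ a)
  refine j.trans h1 ((le_sup_right : pairSetoid x y ≤ j) ?_)
  rw [Perm.mul_apply, swap_apply_def]
  split_ifs with h h'
  · exact Or.inr ⟨Or.inl h, Or.inr rfl⟩
  · exact Or.inr ⟨Or.inr h', Or.inl rfl⟩
  · exact Or.inl rfl

theorem sup_pair_swap_mul (σ : Perm D) (x y : D) :
    Perm.SameCycle.setoid (swap x y * σ) ⊔ pairSetoid x y =
      Perm.SameCycle.setoid σ ⊔ pairSetoid x y := by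
  apply le_antisymm
  · exact sup_le (sup_pair_swap_mul_le σ x y) le_sup_right
  · refine sup_le ?_ le_sup_right
    have := sup_pair_swap_mul_le (swap x y * σ) x y
    rwa [← mul_assoc, swap_mul_self, one_mul] at this

/-- The new permutation follows the `σ`-cycle of `x`, which avoids `y`, until `σ` would return to
`x`; there the transposition diverts it to `y`. -/
theorem sameCycle_swap_mul_of_not [Finite D] {σ : Perm D} {x y : D} (h : ¬ σ.SameCycle x y) :
    (swap x y * σ).SameCycle x y := by
  obtain ⟨n, hn, hx⟩ : ∃ n : ℕ, 0 < n ∧ (σ ^ n) x = x :=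
    ⟨orderOf σ, orderOf_pos σ, by simp [pow_orderOf_eq_one]⟩
  let N := Nat.find (⟨n, hn, hx⟩ : ∃ n : ℕ, 0 < n ∧ (σ ^ n) x = x)
  obtain ⟨hN, hNx⟩ : 0 < N ∧ (σ ^ N) x = x := Nat.find_spec (⟨n, hn, hx⟩ : ∃ n : ℕ, 0 < n ∧ (σ ^ n) x = x)
  have key : ∀ m, m < N → ((swap x y * σ) ^ m) x = (σ ^ m) x := by
    intro m
    induction m with
    | zero => intro _; rfl
    | succ m ih =>
      intro hm
      rw [pow_succ', Perm.mul_apply, ih (by omega), Perm.mul_apply, ← Perm.mul_apply σ, ← pow_succ']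
      apply swap_apply_of_ne_of_ne
      · intro h'
        exact Nat.find_min (⟨n, hn, hx⟩ : ∃ n : ℕ, 0 < n ∧ (σ ^ n) x = x) hm ⟨by omega, h'⟩
      · intro h'
        exact h ⟨(m + 1 : ℕ), by rw [zpow_natCast]; exact h'⟩
  refine ⟨(N : ℕ), ?_⟩
  rw [zpow_natCast]
  obtain ⟨m, hm⟩ : ∃ m, N = m + 1 := ⟨N - 1, by omega⟩
  rw [hm, pow_succ', Perm.mul_apply, key m (by omega), Perm.mul_apply, ← Perm.mul_apply σ,
    ← pow_succ', ← hm, hNx, swap_apply_left]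

/-- The arc of the `σ`-cycle from `x` up to just before `y` becomes closed: where `σ` would enter
`y`, the transposition returns to `x`. -/
theorem not_sameCycle_swap_mul [Finite D] {σ : Perm D} {x y : D} (hxy : x ≠ y)
    (h : σ.SameCycle x y) : ¬ (swap x y * σ).SameCycle x y := by
  obtain ⟨n, hn⟩ : ∃ n : ℕ, (σ ^ n) x = y := by
    exact h.exists_nat_pow_eq
  let N := Nat.find (⟨n, hn⟩ : ∃ n : ℕ, (σ ^ n) x = y)
  have hN : (σ ^ N) x = y := Nat.find_spec (⟨n, hn⟩ : ∃ n : ℕ, (σ ^ n) x = y)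
  have hmin : ∀ m, m < N → (σ ^ m) x ≠ y := fun m hm => Nat.find_min (⟨n, hn⟩ : ∃ n : ℕ, (σ ^ n) x = y) hm
  have hpos : 0 < N := by
    rcases Nat.eq_zero_or_pos N with h0 | h0
    · rw [h0] at hN; exact absurd hN hxy
    · exact h0
  intro h'
  obtain ⟨m, hm⟩ := h'.exists_nat_pow_eq
  have key : ∀ m, ∃ i, i < N ∧ ((swap x y * σ) ^ m) x = (σ ^ i) x := by
    intro m
    induction m with
    | zero => exact ⟨0, hpos, rfl⟩
    | succ m ih =>
      obtain ⟨i, hi, he⟩ := ih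
      rw [pow_succ', Perm.mul_apply, he, Perm.mul_apply, ← Perm.mul_apply σ, ← pow_succ']
      rcases Nat.lt_or_ge (i + 1) N with h1 | h1
      · by_cases h2 : (σ ^ (i + 1)) x = x
        · have : (σ ^ (N - (i + 1))) x = y := by
            rw [← hN]
            conv_rhs => rw [show N = (N - (i + 1)) + (i + 1) by omega, pow_add, Perm.mul_apply, h2]
          exact absurd this (hmin _ (by omega))
        · exact ⟨i + 1, h1, swap_apply_of_ne_of_ne h2 (hmin _ h1)⟩
      · have : i + 1 = N := by omega
        exact ⟨0, hpos, by rw [this, hN, swap_apply_right]; rfl⟩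
  obtain ⟨i, hi, he⟩ := key m
  exact hmin i hi (by rw [← he, hm])

theorem cycleCount_swap_mul_of_sameCycle [Finite D] {σ : Perm D} {x y : D} (hxy : x ≠ y)
    (h : σ.SameCycle x y) : cycleCount (swap x y * σ) = cycleCount σ + 1 := by
  have h1 := card_quotient_sup_of_rel (Perm.SameCycle.setoid σ) (x := x) (y := y) h
  have h2 := card_quotient_sup_of_not_rel (Perm.SameCycle.setoid (swap x y * σ)) (x := x) (y := y)
    (not_sameCycle_swap_mul hxy h)
  rw [sup_pair_swap_mul] at h2
  unfold cycleCount
  omega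

theorem cycleCount_swap_mul_of_not_sameCycle [Finite D] {σ : Perm D} {x y : D}
    (h : ¬ σ.SameCycle x y) : cycleCount (swap x y * σ) + 1 = cycleCount σ := by
  have h2 := card_quotient_sup_of_rel (Perm.SameCycle.setoid (swap x y * σ)) (x := x) (y := y)
    (sameCycle_swap_mul_of_not h)
  have h1 := card_quotient_sup_of_not_rel (Perm.SameCycle.setoid σ) (x := x) (y := y) h
  rw [sup_pair_swap_mul] at h2
  unfold cycleCount
  omega

/-- Splitting a cycle of `σ` does not decrease the Euler defect. -/
theorem eulerDefect_le_swap_mul [Finite D] (σ α : Perm D) {x y : D} (hxy : x ≠ y)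
    (h : σ.SameCycle x y) : eulerDefect σ α ≤ eulerDefect (swap x y * σ) α := by
  have hσ := cycleCount_swap_mul_of_sameCycle hxy h
  set j := Perm.SameCycle.setoid σ ⊔ Perm.SameCycle.setoid α with hj
  set j' := Perm.SameCycle.setoid (swap x y * σ) ⊔ Perm.SameCycle.setoid α with hj'
  have hjj : j' ⊔ pairSetoid x y = j ⊔ pairSetoid x y := by
    rw [hj, hj', sup_right_comm, sup_pair_swap_mul, sup_right_comm]
  have hjx : j x y := (le_sup_left : Perm.SameCycle.setoid σ ≤ j) h
  have hc := card_quotient_sup_of_rel j hjx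
  unfold eulerDefect componentCount
  rw [← hj, ← hj', hσ, mul_assoc]
  -- `σ` gains a cycle. If the product gains one too, this pays for at most one new component, which
  -- counts twice. Otherwise the product loses one, but its merged cycle still links `x` to `y`, so
  -- no component splits.
  by_cases hφ : (σ * α).SameCycle x y
  · have h1 := cycleCount_swap_mul_of_sameCycle hxy hφ
    by_cases hx' : j' x y
    · have h2 := card_quotient_sup_of_rel j' hx'
      rw [hjj] at h2
      rw [h1]; push_cast; omega
    · have h2 := card_quotient_sup_of_not_rel j' hx'
      rw [hjj] at h2
      rw [h1]; push_cast; omega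
  · have h1 := cycleCount_swap_mul_of_not_sameCycle hφ
    have hx' : j' x y := by
      have := sameCycle_swap_mul_of_not hφ
      rw [← mul_assoc] at this
      exact sameCycle_mul_le _ _ this
    have h2 := card_quotient_sup_of_rel j' hx'
    rw [hjj] at h2
    omega

end Cycles

/-! ### Deleting darts and counting cycles -/

section Deletion

variable {D : Type*}

theorem cycleCount_conj (g σ : Perm D) : cycleCount (g * σ * g⁻¹) = cycleCount σ := by
  symm
  apply Nat.card_congr
  refine Quotient.congr g ?_
  intro a b
  change σ.SameCycle a b ↔ (g * σ * g⁻¹).SameCycle (g a) (g b)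
  rw [Perm.sameCycle_conj]
  simp

theorem cycleCount_mul_comm (σ α : Perm D) : cycleCount (σ * α) = cycleCount (α * σ) := by
  rw [← cycleCount_conj σ (α * σ)]
  congr 1
  group

theorem eulerDefect_comm (σ α : Perm D) : eulerDefect σ α = eulerDefect α σ := by
  unfold eulerDefect componentCount
  rw [cycleCount_mul_comm, sup_comm]
  ring

/-- Multiplying by this transposition makes the cycle bypass `d`, which becomes a fixed point;
merging `d` back in recovers the cycles of `σ`. -/
theorem sameCycle_delete_iff [DecidableEq D] (σ : Perm D) {d a b : D} (ha : a ≠ d) (hb : b ≠ d) :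
    (swap d (σ d) * σ).SameCycle a b ↔ σ.SameCycle a b := by
  set τ := swap d (σ d) * σ with hτ
  have hfix : τ d = d := by rw [hτ, Perm.mul_apply, swap_apply_right]
  have hd : ∀ c, τ.SameCycle c d → c = d := by
    intro c h
    obtain ⟨i, hi⟩ := h.symm
    rw [← hi]
    exact Perm.zpow_apply_eq_self_of_apply_eq_self hfix i
  have h1 := sup_pair_swap_mul σ d (σ d)
  have h2 : Perm.SameCycle.setoid σ ⊔ pairSetoid d (σ d) = Perm.SameCycle.setoid σ := by
    apply sup_eq_left.2
    have h := sameCycle_self_apply σ d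
    rintro x y (rfl | ⟨rfl | rfl, rfl | rfl⟩)
    exacts [(Perm.SameCycle.setoid σ).refl _, (Perm.SameCycle.setoid σ).refl _, h,
      (Perm.SameCycle.setoid σ).symm h, (Perm.SameCycle.setoid σ).refl _]
  rw [h2, sup_pairSetoid] at h1
  change τ.SameCycle a b ↔ (Perm.SameCycle.setoid σ) a b
  rw [← h1]
  constructor
  · exact Or.inl
  · rintro (h | ⟨h | h, h' | h'⟩)
    · exact h
    · exact absurd (hd _ h) ha
    · exact absurd (hd _ h) ha
    · exact absurd (hd _ h') hb
    · exact h.trans h'.symm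

/-- Deleting a set of darts from one of the two permutations. -/
theorem exists_delete [Finite D] (σ α : Perm D) (B : Finset D) :
    ∃ τ : Perm D, (∀ d ∈ B, τ d = d) ∧
      (∀ a b, a ∉ B → b ∉ B → (τ.SameCycle a b ↔ σ.SameCycle a b)) ∧
      eulerDefect σ α ≤ eulerDefect τ α := by
  classical
  induction B using Finset.induction_on with
  | empty => exact ⟨σ, by simp, by simp, le_rfl⟩
  | insert d B hd ih =>
    obtain ⟨τ, h1, h2, h3⟩ := ih
    refine ⟨swap d (τ d) * τ, ?_, ?_, h3.trans ?_⟩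
    · intro b hb
      rcases Finset.mem_insert.1 hb with rfl | hb
      · rw [Perm.mul_apply, swap_apply_right]
      · rw [Perm.mul_apply, h1 b hb]
        have hbd : b ≠ d := fun h => hd (h ▸ hb)
        refine swap_apply_of_ne_of_ne hbd ?_
        intro h
        rw [← h1 b hb] at h
        exact hbd (τ.injective h)
    · intro a b ha hb
      rw [Finset.mem_insert, not_or] at ha hb
      rw [sameCycle_delete_iff τ ha.1 hb.1, h2 a b ha.2 hb.2]
    · by_cases h : τ d = d
      · rw [h, swap_self, show (Equiv.refl D : Perm D) = 1 from rfl, one_mul]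
      · exact eulerDefect_le_swap_mul τ α (Ne.symm h) (sameCycle_self_apply τ d)

/-- Each element of `B` is a cycle by itself, and every other cycle takes at least `m` elements of
the complement. -/
theorem mul_cycleCount_le [Finite D] (σ : Perm D) (B : Finset D) (m : ℕ)
    (h : ∀ a, a ∉ B → m ≤ Nat.card {x // σ.SameCycle a x})
    (hB : ∀ d ∈ B, σ d = d) :
    m * cycleCount σ + B.card ≤ m * B.card + Nat.card D := by
  classical
  have : Fintype D := Fintype.ofFinite _
  have : Fintype (Quotient (Perm.SameCycle.setoid σ)) := Fintype.ofFinite _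
  let mk : D → Quotient (Perm.SameCycle.setoid σ) := Quotient.mk _
  have hcls : ∀ d ∈ B, ∀ c, σ.SameCycle d c → c = d := by
    rintro d hd c ⟨i, rfl⟩
    exact Perm.zpow_apply_eq_self_of_apply_eq_self (hB d hd) i
  have h1 : (Bᶜ).card = ∑ q ∈ (B.image mk)ᶜ, (Bᶜ.filter (fun a => mk a = q)).card := by
    refine Finset.card_eq_sum_card_fiberwise (f := mk) ?_
    intro a ha
    simp only [Finset.coe_compl, Set.mem_compl_iff, Finset.mem_coe, Finset.mem_image] at ha ⊢
    rintro ⟨d, hd, he⟩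
    exact ha ((hcls d hd a (Quotient.exact he)) ▸ hd)
  have h2 : ∀ q ∈ (B.image mk)ᶜ, m ≤ (Bᶜ.filter (fun a => mk a = q)).card := by
    intro q hq
    induction q using Quotient.inductionOn with | _ a
    have ha : a ∉ B := fun ha => (Finset.mem_compl.1 hq) (Finset.mem_image_of_mem mk ha)
    refine (h a ha).trans ?_
    rw [Nat.card_eq_fintype_card, Fintype.card_subtype]
    apply Finset.card_le_card
    intro x hx
    have hx : σ.SameCycle a x := by simpa using hx
    rw [Finset.mem_filter, Finset.mem_compl]
    refine ⟨fun hxB => ha ?_, Quotient.sound hx.symm⟩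
    rw [hcls x hxB a hx.symm]; exact hxB
  have h3 := Finset.card_nsmul_le_sum _ _ m h2
  rw [← h1, smul_eq_mul, Finset.card_compl, Finset.card_compl] at h3
  have h4 : (B.image mk).card ≤ B.card := Finset.card_image_le
  have h5 : B.card ≤ Fintype.card D := Finset.card_le_univ B
  have h6 : (B.image mk).card ≤ Fintype.card (Quotient (Perm.SameCycle.setoid σ)) :=
    Finset.card_le_univ _
  unfold cycleCount
  rw [Nat.card_eq_fintype_card, Nat.card_eq_fintype_card]
  obtain ⟨x, hx⟩ := Nat.exists_eq_add_of_le h6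
  rw [hx, Nat.add_sub_cancel_left, mul_comm] at h3
  rw [hx, mul_add]
  have := Nat.mul_le_mul_left m h4
  omega

/-- A deleted dart is fixed by both permutations and so is a component. With its vertex, edge and
face it contributes `1 + 1 + 1 - 1 - 2 = 0` to the defect, which is why deletions cancel from the
final count. -/
theorem card_le_componentCount [Finite D] (σ α : Perm D) (B : Finset D)
    (h1 : ∀ d ∈ B, σ d = d) (h2 : ∀ d ∈ B, α d = d) {a : D} (ha : a ∉ B) :
    B.card + 1 ≤ componentCount σ α := by
  classical
  let r : Setoid D :=
    { r := fun x y => x = y ∨ (x ∉ B ∧ y ∉ B)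
      iseqv := ⟨fun _ => Or.inl rfl, fun h => h.elim (fun h => Or.inl h.symm) (fun h => Or.inr h.symm),
        by rintro x y z (rfl | h) (rfl | h')
           exacts [Or.inl rfl, Or.inr h', Or.inr h, Or.inr ⟨h.1, h'.2⟩]⟩ }
  have key : ∀ τ : Perm D, (∀ d ∈ B, τ d = d) → Perm.SameCycle.setoid τ ≤ r := by
    intro τ h
    apply sameCycle_le
    intro x
    by_cases hx : x ∈ B
    · exact Or.inl (h x hx).symm
    · refine Or.inr ⟨hx, fun hx' => hx ?_⟩
      have := τ.injective (h _ hx')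
      rw [← this]; exact hx'
  have hle := sup_le (key σ h1) (key α h2)
  let f : Option B → Quotient (Perm.SameCycle.setoid σ ⊔ Perm.SameCycle.setoid α) :=
    fun o => Quotient.mk _ (o.elim a (fun b => b.1))
  have hf : Function.Injective f := by
    intro o o' h
    have := hle (Quotient.exact h)
    rcases o with _ | b <;> rcases o' with _ | b'
    · rfl
    · rcases this with h | h
      · exact absurd b'.2 (by rw [show b'.1 = a from h.symm]; exact ha)
      · exact absurd b'.2 h.2
    · rcases this with h | h
      · exact absurd b.2 (by rw [show b.1 = a from h]; exact ha)
      · exact absurd b.2 h.1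
    · rcases this with h | h
      · rw [Subtype.ext h]
      · exact absurd b.2 h.1
  have := Nat.card_le_card_of_injective f hf
  simpa [componentCount] using this

end Deletion

/-! ### Euler's inequality for drawings of triangle-free regular graphs -/

section LowerBound

theorem CellSurface.neg_two_mul_le_eulerDefect (M : CellSurface) {h : ℕ} (hM : M.IsOfGenus h) :
    -2 * (h : ℤ) ≤ eulerDefect M.rot M.rev := by
  classical
  have := M.finite_dart
  have : Fintype M.Dart := Fintype.ofFinite _
  have hc : componentCount M.rot M.rev ≤ 1 := by
    unfold componentCount
    rw [Finite.card_le_one_iff_subsingleton]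
    constructor
    intro p q
    induction p using Quotient.inductionOn with | _ a
    induction q using Quotient.inductionOn with | _ b
    apply Quotient.sound
    obtain ⟨g, hg, hgb⟩ := M.connected a b
    set j := Perm.SameCycle.setoid M.rot ⊔ Perm.SameCycle.setoid M.rev
    have key : ∀ x, j x (g x) := by
      clear hgb
      induction hg using Subgroup.closure_induction with
      | mem g hg =>
        intro x
        rcases hg with rfl | rfl
        · exact (le_sup_left : Perm.SameCycle.setoid M.rot ≤ j) (sameCycle_self_apply _ x)
        · exact (le_sup_right : Perm.SameCycle.setoid M.rev ≤ j) (sameCycle_self_apply _ x)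
      | one => intro x; exact j.refl x
      | mul g g' _ _ hg hg' => intro x; exact j.trans (hg' x) (hg (g' x))
      | inv g _ hg =>
        intro x
        have := hg (g⁻¹ x)
        rw [← Perm.mul_apply, mul_inv_cancel, Perm.one_apply] at this
        exact j.symm this
    rw [← hgb]; exact key a
  -- The defect counts edges as `E - D`, which is at least `-E` once each edge has at most two
  -- darts.
  have he : Nat.card M.Dart ≤ 2 * cycleCount M.rev := by
    have : Fintype (Quotient (Perm.SameCycle.setoid M.rev)) := Fintype.ofFinite _
    let mk : M.Dart → Quotient (Perm.SameCycle.setoid M.rev) := Quotient.mk _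
    have h1 : (Finset.univ : Finset M.Dart).card ≤ 2 * (Finset.univ.image mk).card := by
      refine Finset.card_le_mul_card_image _ 2 ?_
      intro q _
      induction q using Quotient.inductionOn with | _ a
      refine (Finset.card_le_card (t := {a, M.rev a}) ?_).trans Finset.card_le_two
      intro x hx
      have hx : M.rev.SameCycle x a := Quotient.exact (Finset.mem_filter.1 hx).2
      obtain ⟨i, hi⟩ := hx.symm
      have hsq : M.rev ^ (2 : ℤ) = 1 := by
        ext d; rw [zpow_two, Perm.mul_apply, M.rev_rev]; rfl
      rcases Int.even_or_odd' i with ⟨c, rfl | rfl⟩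
      · rw [zpow_mul, hsq, one_zpow] at hi; simp at hi; simp [hi]
      · rw [zpow_add, zpow_mul, hsq, one_zpow] at hi; simp at hi; simp [hi]
    have h2 := Finset.card_le_univ (Finset.univ.image mk)
    unfold cycleCount
    rw [Nat.card_eq_fintype_card, Nat.card_eq_fintype_card]
    rw [Finset.card_univ] at h1
    omega
  have hM' : ((cycleCount M.rot : ℤ) - cycleCount M.rev + cycleCount (M.rot * M.rev)) = 2 - 2 * h := hM
  unfold eulerDefect
  omega

/-- Euler's inequality for a triangle-free `d`-regular graph drawn on a surface of genus `h`. -/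
theorem EmbedsInGenus.le_of_regular {V : Type*} [Fintype V] [DecidableEq V] [Nonempty V]
    {G : SimpleGraph V} [DecidableRel G.Adj] {d h : ℕ} (hd : 2 ≤ d) (hreg : G.IsRegularOfDegree d)
    (htri : ∀ u v w, G.Adj u v → G.Adj v w → ¬ G.Adj w u) (hG : EmbedsInGenus G h) :
    d * Fintype.card V + 8 ≤ 8 * h + 4 * Fintype.card V := by
  classical
  obtain ⟨M, hM, ⟨e⟩⟩ := hG
  have := M.finite_dart
  have : Fintype M.Dart := Fintype.ofFinite _
  let A : Finset M.Dart := Finset.univ.image e.onDart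
  have hAmem : ∀ x, x ∈ A ↔ ∃ δ, e.onDart δ = x := by simp [A]
  have hBmem : ∀ x, x ∉ Aᶜ ↔ ∃ δ, e.onDart δ = x := by simp [A]
  have hdeg : ∀ u, ∃ f : Fin d → V, Function.Injective f ∧ ∀ i, G.Adj u (f i) := by
    intro u
    have hu : Fintype.card (G.neighborSet u) = d := by rw [G.card_neighborSet_eq_degree]; exact hreg u
    let f := (Fintype.equivFinOfCardEq hu).symm
    exact ⟨fun i => (f i).1, fun i j hij => f.injective (Subtype.ext hij), fun i => (f i).2⟩
  have hA : A.card = d * Fintype.card V := by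
    rw [Finset.card_image_of_injective _ e.onDart_injective, Finset.card_univ,
      G.dart_card_eq_sum_degrees, Finset.sum_congr rfl (fun v _ => hreg v)]
    simp [mul_comm]
  obtain ⟨σ, hσ1, hσ2, hσ3⟩ := exists_delete M.rot M.rev Aᶜ
  -- The defect is symmetric in its two permutations, so the deletion lemma also applies to the
  -- edges.
  obtain ⟨α, hα1, hα2, hα3⟩ := exists_delete M.rev σ Aᶜ
  rw [eulerDefect_comm M.rev, eulerDefect_comm α] at hα3
  have hstay : ∀ τ : Perm M.Dart, (∀ x ∈ Aᶜ, τ x = x) → ∀ δ, ∃ δ', e.onDart δ' = τ (e.onDart δ) := by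
    intro τ hτ δ
    rw [← hBmem]
    intro hx
    have := τ.injective (hτ _ hx)
    rw [this] at hx
    exact (hBmem _).2 ⟨δ, rfl⟩ hx
  have hsrc : ∀ δ δ', M.rot.SameCycle (e.onDart δ) (e.onDart δ') ↔ δ.fst = δ'.fst := by
    intro δ δ'
    constructor
    · intro h
      apply e.onVertex_injective
      rw [← e.source_onDart, ← e.source_onDart]
      exact Quotient.sound h
    · intro h
      have : M.source (e.onDart δ) = M.source (e.onDart δ') := by
        rw [e.source_onDart, e.source_onDart, h]
      exact Quotient.exact this
  have hσs : ∀ δ δ', σ.SameCycle (e.onDart δ) (e.onDart δ') ↔ δ.fst = δ'.fst := by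
    intro δ δ'
    rw [hσ2 _ _ ((hBmem _).2 ⟨δ, rfl⟩) ((hBmem _).2 ⟨δ', rfl⟩), hsrc]
  have hαs : ∀ δ : G.Dart, α (e.onDart δ) = e.onDart δ.symm := by
    intro δ
    have hsc : ∀ δ', α.SameCycle (e.onDart δ) (e.onDart δ') ↔ M.rev.SameCycle (e.onDart δ) (e.onDart δ') :=
      fun δ' => hα2 _ _ ((hBmem _).2 ⟨δ, rfl⟩) ((hBmem _).2 ⟨δ', rfl⟩)
    have hsymm : M.rev.SameCycle (e.onDart δ) (e.onDart δ.symm) := ⟨1, by simp [e.onDart_symm]⟩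
    obtain ⟨δ', hδ'⟩ := hstay α hα1 δ
    have h1 : α.SameCycle (e.onDart δ) (e.onDart δ') := ⟨1, by simp [hδ']⟩
    obtain ⟨i, hi⟩ := (hsc δ').1 h1
    have hsq : M.rev ^ (2 : ℤ) = 1 := by
      ext d; rw [zpow_two, Perm.mul_apply, M.rev_rev]; rfl
    rcases Int.even_or_odd' i with ⟨c, rfl | rfl⟩
    · rw [zpow_mul, hsq, one_zpow] at hi
      -- A fixed dart could not share its cycle with its reverse, yet deletion preserves the edge
      -- cycles among drawn darts.
      have hfix : α (e.onDart δ) = e.onDart δ := by rw [← hδ', ← hi]; rfl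
      obtain ⟨i, hi⟩ := (hsc δ.symm).2 hsymm
      rw [Perm.zpow_apply_eq_self_of_apply_eq_self hfix, e.onDart_symm] at hi
      exact absurd hi.symm (M.rev_ne _)
    · rw [zpow_add, zpow_mul, hsq, one_zpow] at hi
      rw [← hδ', ← hi, e.onDart_symm]; simp
  -- Face walks never backtrack: that would make `σ` fix a dart, while every vertex has at least
  -- two.
  have hnext : ∀ δ : G.Dart, ∃ δ' : G.Dart, (σ * α) (e.onDart δ) = e.onDart δ' ∧
      δ'.fst = δ.snd ∧ δ' ≠ δ.symm := by
    intro δ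
    obtain ⟨δ', hδ'⟩ := hstay σ hσ1 δ.symm
    have hfst : δ'.fst = δ.snd := by
      have : σ.SameCycle (e.onDart δ.symm) (e.onDart δ') := ⟨1, by simp [hδ']⟩
      exact ((hσs _ _).1 this).symm
    refine ⟨δ', by rw [Perm.mul_apply, hαs, hδ'], hfst, ?_⟩
    rintro rfl
    obtain ⟨f, hf, hadj⟩ := hdeg δ.snd
    have hall : ∀ i, (⟨(δ.snd, f i), hadj i⟩ : G.Dart) = δ.symm := by
      intro i
      obtain ⟨j, hj⟩ := (hσs δ.symm ⟨(δ.snd, f i), hadj i⟩).2 rfl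
      rw [Perm.zpow_apply_eq_self_of_apply_eq_self hδ'.symm] at hj
      exact (e.onDart_injective hj).symm
    have h0 := (hall ⟨0, by omega⟩).trans (hall ⟨1, by omega⟩).symm
    have := hf (congrArg (fun δ : G.Dart => δ.snd) h0)
    simp at this
  have c1 := mul_cycleCount_le σ Aᶜ d (by
    intro a ha
    obtain ⟨δ, rfl⟩ := (hBmem a).1 ha
    obtain ⟨f, hf, hadj⟩ := hdeg δ.fst
    have := Nat.card_le_card_of_injective (α := Fin d)
      (fun i => (⟨e.onDart ⟨(δ.fst, f i), hadj i⟩, (hσs _ _).2 rfl⟩ : {x // σ.SameCycle (e.onDart δ) x}))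
      (fun i j hij => by
        have h1 := e.onDart_injective (Subtype.ext_iff.1 hij)
        exact hf (congrArg (fun δ : G.Dart => δ.snd) h1))
    simpa using this) hσ1
  have c2 := mul_cycleCount_le α Aᶜ 2 (by
    intro a ha
    obtain ⟨δ, rfl⟩ := (hBmem a).1 ha
    have := Nat.card_le_card_of_injective (α := Bool)
      (fun i => (⟨e.onDart (if i then δ else δ.symm), by
        split_ifs
        · exact Perm.SameCycle.refl _ _
        · exact ⟨1, by simp [hαs]⟩⟩ : {x // α.SameCycle (e.onDart δ) x}))
      (by
        intro i j hij
        have h1 := e.onDart_injective (Subtype.ext_iff.1 hij)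
        have h2 := δ.symm_ne
        cases i <;> cases j
        exacts [rfl, absurd h1 h2, absurd h1.symm h2, rfl])
    simpa using this) hα1
  have c3 := mul_cycleCount_le (σ * α) Aᶜ 4 (by
    intro a ha
    obtain ⟨δ0, rfl⟩ := (hBmem a).1 ha
    obtain ⟨δ1, h1, f1, n1⟩ := hnext δ0
    obtain ⟨δ2, h2, f2, n2⟩ := hnext δ1
    obtain ⟨δ3, h3, f3, n3⟩ := hnext δ2
    have ne1 : ∀ δ δ' : G.Dart, δ'.fst = δ.snd → δ ≠ δ' := by
      rintro δ _ h rfl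
      exact δ.adj.ne h
    have ne2 : ∀ δ δ' δ'' : G.Dart, δ'.fst = δ.snd → δ' ≠ δ.symm → δ''.fst = δ'.snd → δ ≠ δ'' := by
      rintro δ δ' _ h hn h' rfl
      exact hn (SimpleGraph.Dart.ext _ _ (Prod.ext h h'.symm))
    -- A face closing after three darts would be a triangle of the graph.
    have ne3 : δ0 ≠ δ3 := by
      intro h
      have a1 := δ1.adj
      have a2 := δ2.adj
      rw [f1] at a1
      rw [f2, ← f3, ← h] at a2
      exact htri _ _ _ δ0.adj a1 a2
    have s1 : (σ * α).SameCycle (e.onDart δ0) (e.onDart δ1) := ⟨1, by rw [zpow_one, h1]⟩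
    have s2 : (σ * α).SameCycle (e.onDart δ0) (e.onDart δ2) := s1.trans ⟨1, by rw [zpow_one, h2]⟩
    have s3 : (σ * α).SameCycle (e.onDart δ0) (e.onDart δ3) := s2.trans ⟨1, by rw [zpow_one, h3]⟩
    have h01 := ne1 _ _ f1
    have h12 := ne1 _ _ f2
    have h23 := ne1 _ _ f3
    have h02 := ne2 _ _ _ f1 n1 f2
    have h13 := ne2 _ _ _ f2 n2 f3
    have hcard : ({δ0, δ1, δ2, δ3} : Finset G.Dart).card = 4 := by
      rw [Finset.card_insert_of_notMem, Finset.card_insert_of_notMem, Finset.card_pair h23]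
      · simp [h12, h13]
      · simp [h01, h02, ne3]
    have := Nat.card_le_card_of_injective (α := ({δ0, δ1, δ2, δ3} : Finset G.Dart))
      (fun δ => (⟨e.onDart δ.1, by
        have := δ.2
        simp only [Finset.mem_insert, Finset.mem_singleton] at this
        rcases this with h | h | h | h <;> rw [h]
        exacts [s1, s2, s3]⟩ : {x // (σ * α).SameCycle (e.onDart δ0) x}))
      (fun δ δ' hij => Subtype.ext (e.onDart_injective (Subtype.ext_iff.1 hij)))
    rwa [Nat.card_eq_fintype_card, Fintype.card_coe, hcard] at this) (by
    intro x hx; rw [Perm.mul_apply, hα1 x hx, hσ1 x hx])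
  obtain ⟨v⟩ := (inferInstance : Nonempty V)
  obtain ⟨f, -, hadj⟩ := hdeg v
  have c4 := card_le_componentCount σ α Aᶜ hσ1 hα1
    (a := e.onDart ⟨(v, f ⟨0, by omega⟩), hadj _⟩) ((hBmem _).2 ⟨_, rfl⟩)
  have c0 := M.neg_two_mul_le_eulerDefect hM
  have hcardD : Nat.card M.Dart = A.card + (Aᶜ).card := by
    rw [Finset.card_add_card_compl, Nat.card_eq_fintype_card]
  have c5 : -2 * (h : ℤ) ≤ eulerDefect σ α := c0.trans (hσ3.trans hα3)
  unfold eulerDefect at c5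
  have c1' : cycleCount σ ≤ (Aᶜ).card + Fintype.card V := by
    have : d * cycleCount σ ≤ d * ((Aᶜ).card + Fintype.card V) := by rw [mul_add]; omega
    exact Nat.le_of_mul_le_mul_left this (by omega)
  rw [hA] at hcardD
  -- Each deleted dart cancels, leaving `-2h ≤ V - dV/4 - 2`.
  omega

end LowerBound

/-! ### Periodic quadrangular rotation systems on the integers -/

section Quad

variable {ι : Type*}

/-- The displacement of a signed jump; `true` marks the negative direction. -/
def jumpStep (g : ι → ℤ) (x : ι × Bool) : ℤ := if x.2 then -g x.1 else g x.1

/-- The opposite of a signed jump. -/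
def jumpNeg (x : ι × Bool) : ι × Bool := (x.1, !x.2)

@[simp] theorem jumpNeg_jumpNeg (x : ι × Bool) : jumpNeg (jumpNeg x) = x := by
  simp [jumpNeg]

theorem jumpNeg_ne (x : ι × Bool) : jumpNeg x ≠ x := by
  intro h
  have := congrArg Prod.snd h
  simp [jumpNeg] at this

@[simp] theorem jumpStep_jumpNeg (g : ι → ℤ) (x : ι × Bool) :
    jumpStep g (jumpNeg x) = -jumpStep g x := by
  rcases x with ⟨i, _ | _⟩ <;> simp [jumpStep, jumpNeg]

/-- An `N`-periodic rotation system on the integers, with jumps `g`, all of whose faces are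
commutator squares. -/
structure IsQuad (N : ℤ) (g : ι → ℤ) (ρ : ℤ → ι × Bool → ι × Bool) : Prop where
  periodic : ∀ v, ρ (v + N) = ρ v
  trans : ∀ v x y, ∃ n, (ρ v)^[n] x = y
  square : ∀ v y, ρ (v + jumpStep g (ρ v y)) (jumpNeg (ρ v y)) = y

/-- A set of squares of a rotation system covering every vertex once; `X v` and `Y v` are the two
jumps at `v` along the square through `v`. -/
structure IsSquares (N : ℤ) (g : ι → ℤ) (ρ : ℤ → ι × Bool → ι × Bool) (X Y : ℤ → ι × Bool) :
    Prop where
  perX : ∀ v, X (v + N) = X v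
  perY : ∀ v, Y (v + N) = Y v
  ne : ∀ v, (X v).1 ≠ (Y v).1
  XX : ∀ v, X (v + jumpStep g (X v)) = jumpNeg (X v)
  YX : ∀ v, Y (v + jumpStep g (X v)) = Y v
  XY : ∀ v, X (v + jumpStep g (Y v)) = X v
  YY : ∀ v, Y (v + jumpStep g (Y v)) = jumpNeg (Y v)
  adj : ∀ v, ρ v (X v) = Y v ∨ ρ v (Y v) = X v

namespace IsQuad

variable {N : ℤ} {g : ι → ℤ} {ρ : ℤ → ι × Bool → ι × Bool}

theorem injective (h : IsQuad N g ρ) (v : ℤ) : Function.Injective (ρ v) := by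
  intro x y hxy
  rw [← h.square v x, ← h.square v y, hxy]

theorem periodic_mul (h : IsQuad N g ρ) (v c : ℤ) : ρ (v + N * c) = ρ v := by
  induction c using Int.induction_on with
  | zero => simp
  | succ i ih => rw [show v + N * (i + 1) = (v + N * i) + N by ring, h.periodic, ih]
  | pred i ih => rw [← ih, show v + N * (-i) = (v + N * (-i - 1)) + N by ring, h.periodic]

theorem eq_of_dvd (h : IsQuad N g ρ) {v w : ℤ} (hvw : N ∣ v - w) : ρ v = ρ w := by
  obtain ⟨c, hc⟩ := hvw
  rw [show v = w + N * c by linarith, h.periodic_mul]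

/-- The rotation is one cycle, which also passes through the opposite of `x`, so two jumps cannot
exhaust it. -/
theorem not_swap (h : IsQuad N g ρ) {v : ℤ} {x y : ι × Bool} (hxy : x.1 ≠ y.1)
    (h1 : ρ v x = y) (h2 : ρ v y = x) : False := by
  obtain ⟨n, hn⟩ := h.trans v x (jumpNeg x)
  have : ∀ n, (ρ v)^[n] x = x ∨ (ρ v)^[n] x = y := by
    intro n
    induction n with
    | zero => exact Or.inl rfl
    | succ n ih =>
      rw [Function.iterate_succ_apply']
      rcases ih with ih | ih <;> rw [ih]
      exacts [Or.inr h1, Or.inl h2]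
  rcases this n with h' | h' <;> rw [hn] at h'
  · exact jumpNeg_ne x h'
  · exact hxy (by rw [← h']; rfl)

end IsQuad

theorem periodic_fun_mul {α : Type*} {N : ℤ} {f : ℤ → α} (h : ∀ v, f (v + N) = f v) (v c : ℤ) :
    f (v + N * c) = f v := by
  induction c using Int.induction_on with
  | zero => simp
  | succ i ih => rw [show v + N * (i + 1) = (v + N * i) + N by ring, h, ih]
  | pred i ih => rw [← ih, show v + N * (-i) = (v + N * (-i - 1)) + N by ring, h]

theorem periodic_fun_eq {α : Type*} {N : ℤ} {f : ℤ → α} (h : ∀ v, f (v + N) = f v) {v w : ℤ}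
    (hvw : N ∣ v - w) : f v = f w := by
  obtain ⟨c, hc⟩ := hvw
  rw [show v = w + N * c by linarith, periodic_fun_mul h]

/-- Being a quadrangular system with a perfect set of squares using two fixed jumps. -/
def HasQuad (N : ℤ) (g : ι → ℤ) : Prop :=
  ∃ ρ X Y, IsQuad N g ρ ∧ IsSquares N g ρ X Y ∧ ∃ i j, ∀ v, (X v).1 = i ∧ (Y v).1 = j

/-- Pulling back along multiplication by a unit. -/
theorem HasQuad.of_mul {N : ℤ} {g g' : ι → ℤ} (c : ℤ) (hc : ∀ i, N ∣ c * g' i - g i)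
    (h : HasQuad N g) : HasQuad N g' := by
  obtain ⟨ρ, X, Y, hρ, hS, i, j, hij⟩ := h
  have hstep : ∀ x, N ∣ c * jumpStep g' x - jumpStep g x := by
    rintro ⟨i, _ | _⟩
    · exact hc i
    · change N ∣ c * (-g' i) - -g i
      rw [show c * (-g' i) - -g i = -(c * g' i - g i) by ring]
      exact (hc i).neg_right
  have key : ∀ {α : Type _} {f : ℤ → α}, (∀ v, f (v + N) = f v) →
      ∀ v x, f (c * (v + jumpStep g' x)) = f (c * v + jumpStep g x) := by
    intro α f hf v x
    apply periodic_fun_eq hf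
    convert hstep x using 1; ring
  have hper : ∀ {α : Type _} {f : ℤ → α}, (∀ v, f (v + N) = f v) → ∀ v, f (c * (v + N)) = f (c * v) := by
    intro α f hf v
    apply periodic_fun_eq hf
    exact ⟨c, by ring⟩
  refine ⟨fun v => ρ (c * v), fun v => X (c * v), fun v => Y (c * v), ⟨hper hρ.periodic,
    fun v => hρ.trans _, fun v y => ?_⟩, ⟨hper hS.perX, hper hS.perY, fun v => hS.ne _, fun v => ?_,
      fun v => ?_, fun v => ?_, fun v => ?_, fun v => hS.adj _⟩, i, j, fun v => hij _⟩
  · rw [key hρ.periodic]; exact hρ.square _ _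
  · rw [key hS.perX]; exact hS.XX _
  · rw [key hS.perY]; exact hS.YX _
  · rw [key hS.perX]; exact hS.XY _
  · rw [key hS.perY]; exact hS.YY _

/-- Scaling all jumps. -/
theorem HasQuad.scale {N : ℤ} {g : ι → ℤ} {K : ℤ} (hK : 0 < K) (h : HasQuad N g) :
    HasQuad (K * N) (fun i => K * g i) := by
  obtain ⟨ρ, X, Y, hρ, hS, i, j, hij⟩ := h
  -- Scaled jumps preserve the residue of a vertex modulo `K`, and `v / K` is a coordinate along its
  -- residue class; each class carries a copy of the system.
  have key : ∀ v x, (v + jumpStep (fun i => K * g i) x) / K = v / K + jumpStep g x := by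
    rintro v ⟨i, _ | _⟩
    · simp only [jumpStep, Bool.false_eq_true, if_false]
      rw [Int.add_mul_ediv_left _ _ hK.ne']
    · simp only [jumpStep, if_true]
      rw [← mul_neg, Int.add_mul_ediv_left _ _ hK.ne']
  have hper : ∀ v : ℤ, (v + K * N) / K = v / K + N := fun v => Int.add_mul_ediv_left _ _ hK.ne'
  refine ⟨fun v => ρ (v / K), fun v => X (v / K), fun v => Y (v / K), ⟨fun v => ?_,
    fun v => hρ.trans _, fun v y => ?_⟩, ⟨fun v => ?_, fun v => ?_, fun v => hS.ne _, fun v => ?_,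
      fun v => ?_, fun v => ?_, fun v => ?_, fun v => hS.adj _⟩, i, j, fun v => hij _⟩
  · rw [hper, hρ.periodic]
  · rw [key]; exact hρ.square _ _
  · rw [hper, hS.perX]
  · rw [hper, hS.perY]
  · rw [key]; exact hS.XX _
  · rw [key]; exact hS.YX _
  · rw [key]; exact hS.XY _
  · rw [key]; exact hS.YY _

theorem HasQuad.reindex {κ : Type*} {N : ℤ} {g : ι → ℤ} (φ : κ ≃ ι)
    (h : HasQuad N (fun i => g (φ i))) : HasQuad N g := by
  obtain ⟨ρ, X, Y, hρ, hS, i, j, hij⟩ := h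
  let f : κ × Bool ≃ ι × Bool := φ.prodCongr (Equiv.refl Bool)
  have hstep : ∀ x, jumpStep g (f x) = jumpStep (fun i => g (φ i)) x := fun x => rfl
  have hneg : ∀ x, jumpNeg (f x) = f (jumpNeg x) := fun x => rfl
  refine ⟨fun v x => f (ρ v (f.symm x)), fun v => f (X v), fun v => f (Y v),
    ⟨fun v => ?_, fun v x y => ?_, fun v y => ?_⟩,
    ⟨fun v => ?_, fun v => ?_, fun v h => hS.ne v (φ.injective h), fun v => ?_,
      fun v => ?_, fun v => ?_, fun v => ?_, fun v => ?_⟩, φ i, φ j, fun v => ?_⟩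
  · rw [hρ.periodic]
  · obtain ⟨n, hn⟩ := hρ.trans v (f.symm x) (f.symm y)
    refine ⟨n, ?_⟩
    have : ∀ n, (fun x => f (ρ v (f.symm x)))^[n] x = f ((ρ v)^[n] (f.symm x)) := by
      intro n
      induction n with
      | zero => simp
      | succ n ih => rw [Function.iterate_succ_apply', ih, Function.iterate_succ_apply']; simp
    rw [this, hn, Equiv.apply_symm_apply]
  · rw [hstep, hneg, Equiv.symm_apply_apply, hρ.square, Equiv.apply_symm_apply]
  · rw [hS.perX]
  · rw [hS.perY]
  · rw [hstep, hS.XX, hneg]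
  · rw [hstep, hS.YX]
  · rw [hstep, hS.XY]
  · rw [hstep, hS.YY, hneg]
  · rw [Equiv.symm_apply_apply, Equiv.symm_apply_apply]
    exact (hS.adj v).imp (fun h => by rw [h]) (fun h => by rw [h])
  · exact ⟨congrArg φ (hij v).1, congrArg φ (hij v).2⟩

/-- The orientation of a square at a vertex. -/
def cornerBit [DecidableEq ι] (ρ : ℤ → ι × Bool → ι × Bool) (X Y : ℤ → ι × Bool) (v : ℤ) : Bool :=
  decide (ρ v (X v) = Y v)

section Orientation

variable [DecidableEq ι] {N : ℤ} {g : ι → ℤ} {ρ : ℤ → ι × Bool → ι × Bool} {X Y : ℤ → ι × Bool}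

theorem IsSquares.apply_of_bit (hS : IsSquares N g ρ X Y) (v : ℤ) :
    (cornerBit ρ X Y v = true ∧ ρ v (X v) = Y v) ∨ (cornerBit ρ X Y v = false ∧ ρ v (Y v) = X v) := by
  by_cases h : ρ v (X v) = Y v
  · exact Or.inl ⟨by simp [cornerBit, h], h⟩
  · exact Or.inr ⟨by simp [cornerBit, h], (hS.adj v).resolve_left h⟩

theorem IsSquares.bit_of_apply (hρ : IsQuad N g ρ) (hS : IsSquares N g ρ X Y) {v : ℤ}
    (h : ρ v (Y v) = X v) : cornerBit ρ X Y v = false := by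
  rw [cornerBit, decide_eq_false_iff_not]
  exact fun h' => hρ.not_swap (hS.ne v) h' h

/-- Along a side of a face the jump by which one leaves becomes, reversed, the one by which one
arrives. The fixed names `X` and `Y` of the two directions therefore exchange roles at consecutive
corners. -/
theorem IsSquares.bit_X (hρ : IsQuad N g ρ) (hS : IsSquares N g ρ X Y) (v : ℤ) :
    cornerBit ρ X Y (v + jumpStep g (X v)) = !cornerBit ρ X Y v := by
  rcases hS.apply_of_bit v with ⟨hb, h⟩ | ⟨hb, h⟩
  · rw [hb]
    apply hS.bit_of_apply hρ
    rw [hS.XX, hS.YX]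
    have h2 := hρ.square v (X v)
    rw [h] at h2
    have h3 := hρ.square (v + jumpStep g (Y v)) (jumpNeg (Y v))
    rw [h2] at h3
    have h4 := hρ.square (v + jumpStep g (Y v) + jumpStep g (X v)) (jumpNeg (X v))
    rw [h3, jumpNeg_jumpNeg, jumpStep_jumpNeg] at h4
    rwa [show v + jumpStep g (Y v) + jumpStep g (X v) + -jumpStep g (Y v) =
      v + jumpStep g (X v) by ring] at h4
  · rw [hb]
    have h2 := hρ.square v (Y v)
    rw [h] at h2
    simp only [cornerBit, Bool.not_false, decide_eq_true_eq]
    rw [hS.XX, hS.YX, h2]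

theorem IsSquares.bit_Y (hρ : IsQuad N g ρ) (hS : IsSquares N g ρ X Y) (v : ℤ) :
    cornerBit ρ X Y (v + jumpStep g (Y v)) = !cornerBit ρ X Y v := by
  rcases hS.apply_of_bit v with ⟨hb, h⟩ | ⟨hb, h⟩
  · rw [hb]
    apply hS.bit_of_apply hρ
    have h2 := hρ.square v (X v)
    rw [h] at h2
    rw [hS.YY, hS.XY, h2]
  · rw [hb]
    have h2 := hρ.square v (Y v)
    rw [h] at h2
    have h3 := hρ.square (v + jumpStep g (X v)) (jumpNeg (X v))
    rw [h2] at h3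
    have h4 := hρ.square (v + jumpStep g (X v) + jumpStep g (Y v)) (jumpNeg (Y v))
    rw [h3, jumpNeg_jumpNeg, jumpStep_jumpNeg] at h4
    rw [show v + jumpStep g (X v) + jumpStep g (Y v) + -jumpStep g (X v) =
      v + jumpStep g (Y v) by ring] at h4
    simp only [cornerBit, Bool.not_false, decide_eq_true_eq]
    rw [hS.XY, hS.YY, h4]

end Orientation

end Quad

/-! ### The local rotation of six jumps: finite verifications -/

section Sigma

/-- The successor in one of the three cyclic orders of six relative jumps. The jump `(0, false)` is
the positive end of the first generator, `(1, false)` and `(2, false)` are the inner jumps. -/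
def hexStep (L E : Bool) : Fin 3 × Bool → Fin 3 × Bool
  | (2, false) => (1, false)
  | (1, false) => if L then (2, true) else (0, true)
  | (0, true) => if L || E then (1, true) else (2, true)
  | (2, true) => if L then (0, true) else if E then (0, false) else (1, true)
  | (1, true) => if L || !E then (0, false) else (2, true)
  | (0, false) => (2, false)

/-- The predecessor in the cyclic orders of `hexStep`. -/
def hexBack (L E : Bool) : Fin 3 × Bool → Fin 3 × Bool
  | (1, false) => (2, false)
  | (0, true) => if L then (2, true) else (1, false)
  | (2, true) => if L then (1, false) else if E then (1, true) else (0, true)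
  | (1, true) => if L || E then (0, true) else (2, true)
  | (0, false) => if L || !E then (1, true) else (2, true)
  | (2, false) => (0, false)

/-- The sign that makes a jump positive relative to the local data. -/
def hexSign (b0 b1 S : Bool) : Fin 3 → Bool := ![S, b1, b0]

/-- The local rotation with three generators. -/
def hexRot (b0 b1 S L Λ : Bool) (y : Fin 3 × Bool) : Fin 3 × Bool :=
  let r : Fin 3 × Bool := (y.1, y.2 ^^ hexSign b0 b1 S y.1)
  let t := if S ^^ b0 ^^ b1 then hexBack L (Λ ^^ S) r else hexStep L (Λ ^^ S) r
  (t.1, t.2 ^^ hexSign b0 b1 S t.1)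

theorem hexRot_trans : ∀ b0 b1 S L Λ x y, ∃ n, (hexRot b0 b1 S L Λ)^[n] x = y := by
  have : ∀ b0 b1 S L Λ x y, ∃ n ∈ List.range 6, (hexRot b0 b1 S L Λ)^[n] x = y := by
    decide +kernel
  intro b0 b1 S L Λ x y
  obtain ⟨n, -, h⟩ := this b0 b1 S L Λ x y
  exact ⟨n, h⟩

/-- This and the following checks are the square condition across one edge, by type of edge. An
argument that is unrelated at the two ends is local data the edge does not constrain; one that is
shared or negated becomes a condition in `HexData`. -/
theorem hexRot_first : ∀ b0 b1 S L Λ σ y, hexRot b0 b1 S L Λ y = (0, σ) →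
    hexRot b0 b1 (!S) L (!Λ) (0, !σ) = y := by decide +kernel

theorem hexRot_second_inner : ∀ b0 b1 S L Λ Λ' y, hexRot b0 b1 S L Λ y = (1, b1) →
    hexRot b0 (!b1) S L Λ' (1, !b1) = y := by decide +kernel

theorem hexRot_second_outer : ∀ b0 b1 S S' L Λ y, hexRot b0 b1 S L Λ y = (1, !b1) →
    hexRot b0 (!b1) S' L Λ (1, b1) = y := by decide +kernel

theorem hexRot_third_inner : ∀ b0 b1 S L L' Λ Λ' y, hexRot b0 b1 S L Λ y = (2, b0) →
    hexRot (!b0) b1 S L' Λ' (2, !b0) = y := by decide +kernel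

theorem hexRot_third_outer : ∀ b0 b1 S S' Λ y, hexRot b0 b1 S false Λ y = (2, !b0) →
    hexRot (!b0) b1 S' false Λ (2, b0) = y := by decide +kernel

/-- At a block boundary the unit step also flips the digit of weight `M`, and the ordinary outer
check fails. The modified order used at last vertices repairs it, provided the outer sign beyond the
boundary equals the inner sign before it. -/
theorem hexRot_fault : ∀ b1 S S' Λ y, hexRot true b1 S true Λ y = (2, false) →
    hexRot false (!b1) S' false S (2, true) = y := by decide +kernel

theorem hexRot_fault' : ∀ b1 S S' Λ y, hexRot false b1 S false S' y = (2, true) →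
    hexRot true (!b1) S' true Λ (2, false) = y := by decide +kernel

end Sigma

/-! ### The three-generator system governed by binary digits -/

section HexSystem

/-- The parity of an integer. -/
def oddBit (v : ℤ) : Bool := decide (v % 2 = 1)

/-- The parity of the quotient by `M`; for `M` a power of two, a binary digit. -/
def digitBit (M v : ℤ) : Bool := oddBit (v / M)

/-- Whether `v` is the last element of its block of length `M`. -/
def lastBit (M v : ℤ) : Bool := decide (M ∣ v + 1)

theorem oddBit_add (v x : ℤ) : oddBit (v + x) = (oddBit v ^^ oddBit x) := by
  unfold oddBit
  rcases Int.emod_two_eq_zero_or_one v with h | h <;>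
    rcases Int.emod_two_eq_zero_or_one x with h' | h' <;> simp [Int.add_emod, h, h']

theorem oddBit_of_dvd {x : ℤ} (h : 2 ∣ x) : oddBit x = false := by
  simp [oddBit]; omega

@[simp] theorem oddBit_one : oddBit 1 = true := rfl

@[simp] theorem oddBit_neg (x : ℤ) : oddBit (-x) = oddBit x := by
  unfold oddBit; congr 1; apply propext; omega

theorem oddBit_eq_true {x : ℤ} : oddBit x = true ↔ x % 2 = 1 := by simp [oddBit]

theorem oddBit_eq_false {x : ℤ} : oddBit x = false ↔ x % 2 = 0 := by simp [oddBit]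

theorem oddBit_add_of_dvd (v : ℤ) {x : ℤ} (h : 2 ∣ x) : oddBit (v + x) = oddBit v := by
  simp [oddBit_add, oddBit_of_dvd h]

section Digit

variable {M : ℤ} (hM : 0 < M)
include hM

theorem digitBit_add_mul (v x : ℤ) : digitBit M (v + M * x) = (digitBit M v ^^ oddBit x) := by
  rw [digitBit, Int.add_mul_ediv_left _ _ hM.ne', oddBit_add]; rfl

theorem digitBit_add_of_dvd (v : ℤ) {x : ℤ} (h : 2 * M ∣ x) : digitBit M (v + x) = digitBit M v := by
  obtain ⟨c, rfl⟩ := h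
  rw [show 2 * M * c = M * (2 * c) by ring, digitBit_add_mul hM, oddBit_of_dvd ⟨c, rfl⟩]; simp

theorem ediv_add_one_of_not_dvd {v : ℤ} (h : ¬ M ∣ v + 1) : (v + 1) / M = v / M := by
  have h1 := Int.emod_add_mul_ediv v M
  have h2 := Int.emod_nonneg v hM.ne'
  have h3 := Int.emod_lt_of_pos v hM
  have h4 : v % M ≠ M - 1 := by
    intro h4
    exact h ⟨v / M + 1, by rw [h4] at h1; linarith⟩
  have h5 : v % M + 1 < M := by omega
  rw [show v + 1 = (v % M + 1) + M * (v / M) by linarith, Int.add_mul_ediv_left _ _ hM.ne',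
    Int.ediv_eq_zero_of_lt (by omega) h5, zero_add]

theorem ediv_add_one_of_dvd {v : ℤ} (h : M ∣ v + 1) : (v + 1) / M = v / M + 1 := by
  obtain ⟨c, hc⟩ := h
  have : v = (M - 1) + M * (c - 1) := by linarith
  rw [hc, Int.mul_ediv_cancel_left _ hM.ne', this, Int.add_mul_ediv_left _ _ hM.ne',
    Int.ediv_eq_zero_of_lt (by omega) (by omega)]
  ring

theorem digitBit_add_one_of_not_dvd {v : ℤ} (h : ¬ M ∣ v + 1) :
    digitBit M (v + 1) = digitBit M v := by
  rw [digitBit, ediv_add_one_of_not_dvd hM h, digitBit]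

theorem digitBit_add_one_of_dvd {v : ℤ} (h : M ∣ v + 1) :
    digitBit M (v + 1) = !digitBit M v := by
  rw [digitBit, ediv_add_one_of_dvd hM h, oddBit_add, digitBit]; simp

end Digit

theorem lastBit_add_of_dvd {M : ℤ} (v : ℤ) {x : ℤ} (h : M ∣ x) :
    lastBit M (v + x) = lastBit M v := by
  unfold lastBit
  congr 1
  rw [show v + x + 1 = (v + 1) + x by ring]
  exact propext (Int.dvd_add_left h)

/-- Compatibility of the two sign functions of a system with three generators. -/
structure HexData (M p a N : ℤ) (s lam : ℤ → Bool) : Prop where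
  pos : 0 < M
  even : 2 ∣ M
  dvd_p : ∃ u, p = M * u ∧ u % 2 = 1
  dvd_a : 2 * M ∣ a
  dvd_N : 2 * M ∣ N
  s_N : ∀ v, s (v + N) = s v
  s_one : ∀ v, v % 2 = 0 → s (v + 1) = s v
  s_p : ∀ v, digitBit M v = false → s (v + p) = s v
  s_a : ∀ v, s (v + a) = !s v
  lam_N : ∀ v, lam (v + N) = lam v
  lam_one : ∀ v, v % 2 = 1 → ¬ M ∣ v + 1 → lam (v + 1) = lam v
  lam_fault : ∀ v, M ∣ v → lam v = s (v - 1)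
  lam_p : ∀ v, digitBit M v = true → lam (v + p) = lam v
  lam_a : ∀ v, lam (v + a) = !lam v

/-- The system with three generators. -/
def hexSystem (M : ℤ) (s lam : ℤ → Bool) (v : ℤ) : Fin 3 × Bool → Fin 3 × Bool :=
  hexRot (oddBit v) (digitBit M v) (s v) (lastBit M v) (lam v)

/-- The generators of the system with three generators. -/
def hexGen (p a : ℤ) : Fin 3 → ℤ := ![a, p, 1]

namespace HexData

variable {M p a N : ℤ} {s lam : ℤ → Bool} (h : HexData M p a N s lam)
include h

theorem two_dvd_a : 2 ∣ a := (Dvd.intro _ rfl).trans h.dvd_a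

theorem two_dvd_p : 2 ∣ p := by
  obtain ⟨u, rfl, -⟩ := h.dvd_p
  exact h.even.mul_right _

theorem M_dvd_a : M ∣ a := (Dvd.intro_left _ rfl).trans h.dvd_a

theorem M_dvd_p : M ∣ p := by
  obtain ⟨u, rfl, -⟩ := h.dvd_p
  exact Dvd.intro _ rfl

theorem digitBit_add_p (v : ℤ) : digitBit M (v + p) = !digitBit M v := by
  obtain ⟨u, rfl, hu⟩ := h.dvd_p
  rw [digitBit_add_mul h.pos, oddBit_eq_true.2 hu]; simp

theorem digitBit_sub_p (v : ℤ) : digitBit M (v - p) = !digitBit M v := by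
  have := h.digitBit_add_p (v - p)
  rw [sub_add_cancel] at this
  rw [this]; simp

theorem s_sub_one {v : ℤ} (hv : v % 2 = 1) : s (v - 1) = s v := by
  rw [← h.s_one (v - 1) (by omega), sub_add_cancel]

theorem s_sub_p {v : ℤ} (hv : digitBit M v = true) : s (v - p) = s v := by
  rw [← h.s_p (v - p) (by rw [h.digitBit_sub_p, hv]; rfl), sub_add_cancel]

theorem s_sub_a (v : ℤ) : s (v - a) = !s v := by
  have := h.s_a (v - a)
  rw [sub_add_cancel] at this
  rw [this]; simp

theorem lam_sub_p {v : ℤ} (hv : digitBit M v = false) : lam (v - p) = lam v := by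
  rw [← h.lam_p (v - p) (by rw [h.digitBit_sub_p, hv]; rfl), sub_add_cancel]

theorem lam_sub_a (v : ℤ) : lam (v - a) = !lam v := by
  have := h.lam_a (v - a)
  rw [sub_add_cancel] at this
  rw [this]; simp

theorem square_first (v y σ) (hy : hexSystem M s lam v y = (0, σ)) :
    hexSystem M s lam (v + jumpStep (hexGen p a) (0, σ)) (0, !σ) = y := by
  have key : ∀ x, 2 * M ∣ x → s (v + x) = (!s v) → lam (v + x) = (!lam v) →
      hexSystem M s lam (v + x) (0, !σ) = y := by
    intro x hx h1 h2
    rw [hexSystem, oddBit_add_of_dvd v ((Dvd.intro _ rfl).trans hx), digitBit_add_of_dvd h.pos v hx,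
      lastBit_add_of_dvd v ((Dvd.intro_left _ rfl).trans hx), h1, h2]
    exact hexRot_first _ _ _ _ _ _ _ hy
  cases σ
  · exact key a h.dvd_a (h.s_a v) (h.lam_a v)
  · exact key (-a) h.dvd_a.neg_right (h.s_sub_a v) (h.lam_sub_a v)

/-- A step along `p` in the direction given by the digit is a side of an inner square, where only
`s` has to match at the two ends; in the other direction only `lam` has to. -/
theorem square_second (v y σ) (hy : hexSystem M s lam v y = (1, σ)) :
    hexSystem M s lam (v + jumpStep (hexGen p a) (1, σ)) (1, !σ) = y := by
  have key : ∀ x, M ∣ x → 2 ∣ x → digitBit M (v + x) = (!digitBit M v) →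
      (digitBit M v = σ → s (v + x) = s v) → (digitBit M v = (!σ) → lam (v + x) = lam v) →
      hexSystem M s lam (v + x) (1, !σ) = y := by
    intro x hx hx2 hd h1 h2
    rw [hexSystem, oddBit_add_of_dvd v hx2, hd, lastBit_add_of_dvd v hx]
    by_cases hσ : digitBit M v = σ
    · rw [h1 hσ, ← hσ]
      rw [← hσ] at hy
      exact hexRot_second_inner _ _ _ _ _ _ _ hy
    · have hσ : digitBit M v = !σ := by revert hσ; cases digitBit M v <;> cases σ <;> simp
      have hσ' : σ = !digitBit M v := by rw [hσ]; simp
      rw [h2 hσ, ← hσ]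
      rw [hσ'] at hy
      exact hexRot_second_outer _ _ _ _ _ _ _ hy
  cases σ
  · exact key p h.M_dvd_p h.two_dvd_p (h.digitBit_add_p v) (h.s_p v) (h.lam_p v)
  · exact key (-p) h.M_dvd_p.neg_right h.two_dvd_p.neg_right (h.digitBit_sub_p v) h.s_sub_p h.lam_sub_p

theorem not_dvd_of_odd {v : ℤ} (hv : v % 2 = 1) : ¬ M ∣ v := fun hM => by
  have := h.even.trans hM
  omega

/-- From an even to an odd vertex the unit edge is inner and stays within its block, because `M` is
even. From odd to even it is outer, and it crosses a block boundary exactly at a last vertex. -/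
theorem square_third (v y σ) (hy : hexSystem M s lam v y = (2, σ)) :
    hexSystem M s lam (v + jumpStep (hexGen p a) (2, σ)) (2, !σ) = y := by
  cases σ
  · change hexSystem M s lam (v + 1) (2, true) = y
    rw [hexSystem] at hy ⊢
    rcases Int.emod_two_eq_zero_or_one v with hv | hv
    · have hM : ¬ M ∣ v + 1 := h.not_dvd_of_odd (by omega)
      rw [digitBit_add_one_of_not_dvd h.pos hM, h.s_one v hv, oddBit_eq_true.2 (by omega)]
      rw [oddBit_eq_false.2 hv] at hy
      exact hexRot_third_inner _ _ _ _ _ _ _ _ hy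
    · have h2 : lastBit M (v + 1) = false := by
        rw [lastBit, decide_eq_false_iff_not]
        exact h.not_dvd_of_odd (by omega)
      rw [oddBit_eq_true.2 hv] at hy
      rw [oddBit_eq_false.2 (by omega), h2]
      by_cases hM : M ∣ v + 1
      · rw [digitBit_add_one_of_dvd h.pos hM, h.lam_fault _ hM, add_sub_cancel_right]
        rw [show lastBit M v = true by simp [lastBit, hM]] at hy
        exact hexRot_fault _ _ _ _ _ hy
      · rw [digitBit_add_one_of_not_dvd h.pos hM, h.lam_one v hv hM]
        rw [show lastBit M v = false by simp [lastBit, hM]] at hy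
        exact hexRot_third_outer _ _ _ _ _ _ hy
  · change hexSystem M s lam (v - 1) (2, false) = y
    rw [hexSystem] at hy ⊢
    obtain ⟨w, rfl⟩ : ∃ w, v = w + 1 := ⟨v - 1, by ring⟩
    rw [add_sub_cancel_right]
    rcases Int.emod_two_eq_zero_or_one w with hv | hv
    · have hM : ¬ M ∣ w + 1 := h.not_dvd_of_odd (by omega)
      rw [digitBit_add_one_of_not_dvd h.pos hM, h.s_one w hv, oddBit_eq_true.2 (by omega)] at hy
      rw [oddBit_eq_false.2 hv]
      exact hexRot_third_inner _ _ _ _ _ _ _ _ hy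
    · have h2 : lastBit M (w + 1) = false := by
        rw [lastBit, decide_eq_false_iff_not]
        exact h.not_dvd_of_odd (by omega)
      rw [oddBit_eq_false.2 (by omega), h2] at hy
      rw [oddBit_eq_true.2 hv]
      by_cases hM : M ∣ w + 1
      · rw [digitBit_add_one_of_dvd h.pos hM, h.lam_fault _ hM, add_sub_cancel_right] at hy
        rw [show lastBit M w = true by simp [lastBit, hM]]
        have := hexRot_fault' _ _ _ (lam w) _ hy
        rwa [Bool.not_not] at this
      · rw [digitBit_add_one_of_not_dvd h.pos hM, h.lam_one w hv hM] at hy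
        rw [show lastBit M w = false by simp [lastBit, hM]]
        exact hexRot_third_outer _ _ _ _ _ _ hy

theorem isQuad : IsQuad N (hexGen p a) (hexSystem M s lam) where
  periodic v := by
    unfold hexSystem
    rw [h.s_N, h.lam_N, digitBit_add_of_dvd h.pos v h.dvd_N,
      oddBit_add_of_dvd v ((Dvd.intro _ rfl).trans h.dvd_N),
      lastBit_add_of_dvd v ((Dvd.intro_left _ rfl).trans h.dvd_N)]
  trans v := hexRot_trans _ _ _ _ _
  square v y := by
    rcases hx : hexSystem M s lam v y with ⟨i, σ⟩
    fin_cases i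
    · exact h.square_first v y σ hx
    · exact h.square_second v y σ hx
    · exact h.square_third v y σ hx

end HexData

/-- The inner jump along the second generator. -/
def innerSecond (M v : ℤ) : Fin 3 × Bool := (1, digitBit M v)

/-- The inner jump along the third generator. -/
def innerThird (v : ℤ) : Fin 3 × Bool := (2, oddBit v)

/-- The jump along the second generator in the outer squares. -/
def outerSecond (M v : ℤ) : Fin 3 × Bool := (1, !digitBit M (v + 1))

/-- The outer jump along the third generator. -/
def outerThird (v : ℤ) : Fin 3 × Bool := (2, !oddBit v)

theorem hexRot_inner : ∀ b0 b1 S L Λ, if S ^^ b0 ^^ b1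
    then hexRot b0 b1 S L Λ (1, b1) = (2, b0) else hexRot b0 b1 S L Λ (2, b0) = (1, b1) := by
  decide +kernel

theorem hexRot_outer : ∀ b0 b1 S L Λ, hexRot b0 b1 S L Λ (1, L ^^ !b1) = (2, !b0) ∨
    hexRot b0 b1 S L Λ (2, !b0) = (1, L ^^ !b1) := by
  decide +kernel

namespace HexData

variable {M p a N : ℤ} {s lam : ℤ → Bool} (h : HexData M p a N s lam)
include h

theorem digitBit_step_second (v w σ) :
    digitBit M (w + jumpStep (hexGen p a) (1, σ) + v) = !digitBit M (w + v) := by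
  cases σ
  · change digitBit M (w + p + v) = _
    rw [show w + p + v = w + v + p by ring, h.digitBit_add_p]
  · change digitBit M (w - p + v) = _
    rw [show w - p + v = w + v - p by ring, h.digitBit_sub_p]

theorem oddBit_step_second (w σ) :
    oddBit (w + jumpStep (hexGen p a) (1, σ)) = oddBit w := by
  apply oddBit_add_of_dvd
  cases σ
  · exact h.two_dvd_p
  · exact h.two_dvd_p.neg_right

omit h in
theorem oddBit_step_third (w σ) :
    oddBit (w + jumpStep (hexGen p a) (2, σ)) = !oddBit w := by
  rw [oddBit_add]
  cases σ <;> simp [jumpStep, hexGen]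

theorem isSquares_inner : IsSquares N (hexGen p a) (hexSystem M s lam) (innerSecond M) innerThird where
  perX v := by simp only [innerSecond]; rw [digitBit_add_of_dvd h.pos v h.dvd_N]
  perY v := by simp only [innerThird]; rw [oddBit_add_of_dvd v ((Dvd.intro _ rfl).trans h.dvd_N)]
  ne v := by simp [innerSecond, innerThird]
  XX v := by
    have := h.digitBit_step_second 0 v (digitBit M v)
    simp only [add_zero] at this
    simp only [innerSecond, jumpNeg]; rw [this]
  YX v := by simp only [innerSecond, innerThird, h.oddBit_step_second]
  XY v := by
    simp only [innerSecond, innerThird]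
    have : digitBit M (v + jumpStep (hexGen p a) (2, oddBit v)) = digitBit M v := by
      rcases Int.emod_two_eq_zero_or_one v with hv | hv
      · rw [oddBit_eq_false.2 hv]
        exact digitBit_add_one_of_not_dvd h.pos (h.not_dvd_of_odd (by omega))
      · rw [oddBit_eq_true.2 hv]
        change digitBit M (v - 1) = _
        rw [← digitBit_add_one_of_not_dvd h.pos (v := v - 1)
          (h.not_dvd_of_odd (by omega)), sub_add_cancel]
    rw [this]
  YY v := by simp only [innerThird, oddBit_step_third, jumpNeg]
  adj v := by
    have := hexRot_inner (oddBit v) (digitBit M v) (s v) (lastBit M v) (lam v)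
    split_ifs at this
    · exact Or.inl this
    · exact Or.inr this

/-- Reading the digit at `v + 1` makes both ends of a boundary-crossing outer edge agree on the
direction along `p`. At a last vertex this direction is the inner one, but the outer third jump
always keeps these squares apart from the inner squares. -/
theorem isSquares_outer : IsSquares N (hexGen p a) (hexSystem M s lam) (outerSecond M) outerThird where
  perX v := by
    simp only [outerSecond]
    rw [show v + N + 1 = v + 1 + N by ring, digitBit_add_of_dvd h.pos _ h.dvd_N]
  perY v := by simp only [outerThird]; rw [oddBit_add_of_dvd v ((Dvd.intro _ rfl).trans h.dvd_N)]
  ne v := by simp [outerSecond, outerThird]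
  XX v := by simp only [outerSecond, jumpNeg, h.digitBit_step_second]
  YX v := by simp only [outerSecond, outerThird, h.oddBit_step_second]
  XY v := by
    simp only [outerSecond, outerThird]
    have : digitBit M (v + jumpStep (hexGen p a) (2, !oddBit v) + 1) = digitBit M (v + 1) := by
      rcases Int.emod_two_eq_zero_or_one v with hv | hv
      · rw [oddBit_eq_false.2 hv]
        change digitBit M (v - 1 + 1) = _
        rw [digitBit_add_one_of_not_dvd h.pos (v := v) (h.not_dvd_of_odd (by omega)), sub_add_cancel]
      · rw [oddBit_eq_true.2 hv]
        exact digitBit_add_one_of_not_dvd h.pos (v := v + 1) (h.not_dvd_of_odd (by omega))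
    rw [this]
  YY v := by simp only [outerThird, oddBit_step_third, jumpNeg]
  adj v := by
    have := hexRot_outer (oddBit v) (digitBit M v) (s v) (lastBit M v) (lam v)
    have h2 : (lastBit M v ^^ !digitBit M v) = !digitBit M (v + 1) := by
      by_cases hM : M ∣ v + 1
      · rw [digitBit_add_one_of_dvd h.pos hM, show lastBit M v = true by simp [lastBit, hM]]; simp
      · rw [digitBit_add_one_of_not_dvd h.pos hM, show lastBit M v = false by simp [lastBit, hM]]
        simp
    rw [h2] at this
    exact this

/-- Up to the two alternating digits, the orientation of the inner squares is the free parameter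
`s`; the later constructions prescribe it. -/
theorem cornerBit_inner (v : ℤ) : cornerBit (hexSystem M s lam) (innerSecond M) innerThird v =
    (s v ^^ oddBit v ^^ digitBit M v) := by
  have := hexRot_inner (oddBit v) (digitBit M v) (s v) (lastBit M v) (lam v)
  split_ifs at this with hb
  · rw [hb, cornerBit, decide_eq_true_eq]; exact this
  · rw [Bool.not_eq_true] at hb
    rw [hb]
    exact h.isSquares_inner.bit_of_apply h.isQuad this

end HexData

end HexSystem

/-! ### Opening a cyclic order at one place -/

section Reach

variable {α β : Type*}

theorem iterate_reach_trans {f : α → α} {x y z : α} (h : ∃ n, f^[n] x = y) (h' : ∃ n, f^[n] y = z) :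
    ∃ n, f^[n] x = z := by
  obtain ⟨n, rfl⟩ := h
  obtain ⟨m, rfl⟩ := h'
  exact ⟨m + n, Function.iterate_add_apply f m n x⟩

/-- A single cycle cut open after `C` survives under an embedding which is compatible with the
successor functions except at `C`. -/
theorem reach_of_cut {f : α → α} {F : β → β} {e : α → β} (hf : ∀ x y, ∃ n, f^[n] x = y) {C : α}
    (he : ∀ z, z ≠ C → F (e z) = e (f z)) (x : α) : ∃ n, F^[n] (e x) = e C := by
  classical
  have hC := hf x C
  refine ⟨Nat.find hC, ?_⟩
  have key : ∀ m ≤ Nat.find hC, F^[m] (e x) = e (f^[m] x) := by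
    intro m
    induction m with
    | zero => intro _; rfl
    | succ m ih =>
      intro hm
      rw [Function.iterate_succ_apply', ih (by omega), Function.iterate_succ_apply',
        he _ (Nat.find_min hC (by omega))]
  rw [key _ le_rfl, Nat.find_spec hC]

theorem reach_from_cut {f : α → α} {F : β → β} {e : α → β} (hf : ∀ x y, ∃ n, f^[n] x = y) {C : α}
    (he : ∀ z, z ≠ C → F (e z) = e (f z)) (y : α) : ∃ n, F^[n] (e (f C)) = e y := by
  classical
  have hC := hf (f C) y
  refine ⟨Nat.find hC, ?_⟩
  have key : ∀ m ≤ Nat.find hC, F^[m] (e (f C)) = e (f^[m] (f C)) := by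
    intro m
    induction m with
    | zero => intro _; rfl
    | succ m ih =>
      intro hm
      rw [Function.iterate_succ_apply', ih (by omega), Function.iterate_succ_apply', he]
      -- If the path met `C` before `y`, it would start again at `f C` and reach `y` sooner.
      intro h
      refine Nat.find_min hC (m := Nat.find hC - (m + 1)) (by omega) ?_
      have h2 := Nat.find_spec hC
      rw [show Nat.find hC = (Nat.find hC - (m + 1)) + (m + 1) by omega,
        Function.iterate_add_apply, Function.iterate_succ_apply', h] at h2
      exact h2
  rw [key _ le_rfl, Nat.find_spec hC]

theorem iterate_reach_symm {f g : α → α} (hg : Function.LeftInverse g f) {x y : α}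
    (h : ∃ n, f^[n] x = y) : ∃ n, g^[n] y = x := by
  obtain ⟨n, rfl⟩ := h
  exact ⟨n, hg.iterate n x⟩

end Reach

/-! ### Transporting and reversing a system -/

section Twist

variable {ι : Type*} {N : ℤ} {g : ι → ℤ} {ρ : ℤ → ι × Bool → ι × Bool}

theorem IsQuad.surjective (h : IsQuad N g ρ) (v : ℤ) : Function.Surjective (ρ v) := by
  intro y
  obtain ⟨n, hn⟩ := h.trans v (jumpNeg y) y
  cases n with
  | zero => exact absurd hn (jumpNeg_ne y)
  | succ n =>
    rw [Function.iterate_succ_apply'] at hn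
    exact ⟨_, hn⟩

/-- Applying a system or its reversal, at vertices moved by `π`. -/
noncomputable def twistSystem (ρ : ℤ → ι × Bool → ι × Bool) (π : ℤ → ℤ) (ε : ℤ → Bool) (v : ℤ)
    (y : ι × Bool) : ι × Bool :=
  haveI : Nonempty (ι × Bool) := ⟨y⟩
  if ε v then Function.invFun (ρ (π v)) y else ρ (π v) y

theorem twistSystem_of_true {π : ℤ → ℤ} {ε : ℤ → Bool} {v : ℤ} (h : IsQuad N g ρ) (hv : ε v = true)
    {x y : ι × Bool} : twistSystem ρ π ε v y = x ↔ ρ (π v) x = y := by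
  have : Nonempty (ι × Bool) := ⟨y⟩
  rw [twistSystem, hv, if_pos rfl]
  constructor
  · rintro rfl
    exact Function.rightInverse_invFun (h.surjective _) y
  · rintro rfl
    exact Function.leftInverse_invFun (h.injective _) x

theorem twistSystem_of_false {π : ℤ → ℤ} {ε : ℤ → Bool} {v : ℤ} (hv : ε v = false)
    (y : ι × Bool) : twistSystem ρ π ε v y = ρ (π v) y := by
  rw [twistSystem, hv, if_neg (by simp)]

/-- `π` respects jumps up to the period, and `ε` is constant along jumps, so each component is
either copied or mirrored; a mirrored square face is a square face traversed backwards. -/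
theorem IsQuad.twist {N' : ℤ} {g' : ι → ℤ} (h : IsQuad N g ρ) {π : ℤ → ℤ} {ε : ℤ → Bool}
    (hN : ∀ v, N ∣ π (v + N') - π v) (hεN : ∀ v, ε (v + N') = ε v)
    (hπ : ∀ v x, N ∣ π (v + jumpStep g' x) - (π v + jumpStep g x))
    (hε : ∀ v x, ε (v + jumpStep g' x) = ε v) : IsQuad N' g' (twistSystem ρ π ε) where
  periodic v := by
    funext y
    rw [twistSystem, twistSystem, hεN, h.eq_of_dvd (hN v)]
  trans v x y := by
    cases hv : ε v
    · rw [show twistSystem ρ π ε v = ρ (π v) from funext (twistSystem_of_false hv)]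
      exact h.trans _ _ _
    · refine iterate_reach_symm (f := ρ (π v)) (fun z => ?_) (h.trans _ y x)
      exact (twistSystem_of_true h hv).2 rfl
  square v y := by
    cases hv : ε v
    · rw [twistSystem_of_false hv, twistSystem_of_false (by rw [hε, hv]), h.eq_of_dvd (hπ _ _)]
      exact h.square _ _
    · obtain ⟨x, rfl⟩ := h.surjective (π v) y
      rw [(twistSystem_of_true h hv).2 rfl, twistSystem_of_true h (by rw [hε, hv]),
        h.eq_of_dvd (hπ _ _)]
      obtain ⟨z, hz⟩ := h.surjective (π v + jumpStep g x) (jumpNeg x)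
      have h1 := h.square (π v + jumpStep g x) z
      rw [hz, jumpStep_jumpNeg, add_neg_cancel_right, jumpNeg_jumpNeg] at h1
      rw [h1, hz]

theorem IsSquares.twist {X Y : ℤ → ι × Bool} {N' : ℤ} {g' : ι → ℤ} (h : IsQuad N g ρ)
    (hS : IsSquares N g ρ X Y) {π : ℤ → ℤ} {ε : ℤ → Bool} (hN : ∀ v, N ∣ π (v + N') - π v)
    (hπ : ∀ v x, N ∣ π (v + jumpStep g' x) - (π v + jumpStep g x)) :
    IsSquares N' g' (twistSystem ρ π ε) (fun v => X (π v)) (fun v => Y (π v)) where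
  perX v := periodic_fun_eq hS.perX (hN v)
  perY v := periodic_fun_eq hS.perY (hN v)
  ne v := hS.ne _
  XX v := by rw [periodic_fun_eq hS.perX (hπ _ _), hS.XX]
  XY v := by rw [periodic_fun_eq hS.perX (hπ _ _), hS.XY]
  YX v := by rw [periodic_fun_eq hS.perY (hπ _ _), hS.YX]
  YY v := by rw [periodic_fun_eq hS.perY (hπ _ _), hS.YY]
  adj v := by
    cases hv : ε v
    · rw [twistSystem_of_false hv, twistSystem_of_false hv]
      exact hS.adj _
    · rw [twistSystem_of_true h hv, twistSystem_of_true h hv]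
      exact (hS.adj _).symm

theorem cornerBit_twist [DecidableEq ι] {X Y : ℤ → ι × Bool} (h : IsQuad N g ρ)
    (hS : IsSquares N g ρ X Y) (π : ℤ → ℤ) (ε : ℤ → Bool) (v : ℤ) :
    cornerBit (twistSystem ρ π ε) (fun v => X (π v)) (fun v => Y (π v)) v =
      (cornerBit ρ X Y (π v) ^^ ε v) := by
  cases hv : ε v
  · rw [Bool.xor_false]
    simp only [cornerBit, twistSystem_of_false hv]
  · rw [Bool.xor_true]
    simp only [cornerBit, twistSystem_of_true h hv]
    rcases hS.apply_of_bit (π v) with ⟨hb, h'⟩ | ⟨hb, h'⟩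
    · rw [cornerBit] at hb
      rw [hb, Bool.not_true, decide_eq_false_iff_not]
      exact fun h'' => h.not_swap (hS.ne _) h' h''
    · rw [cornerBit] at hb
      rw [hb, h']; simp

end Twist

/-! ### Splicing two systems along squares -/

section Merge

variable {ι κ : Type*} {N : ℤ}

/-- A family of square faces covering every vertex once: the face through `v` arrives along the
jump `A v` and continues along the jump `B v`. -/
structure IsSquareCorner (g : ι → ℤ) (ρ : ℤ → ι × Bool → ι × Bool) (A B : ℤ → ι × Bool) : Prop where
  adj : ∀ v, ρ v (A v) = B v
  AA : ∀ v, A (v + jumpStep g (A v)) = B v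
  AB : ∀ v, A (v + jumpStep g (B v)) = jumpNeg (B v)

theorem IsSquares.isSquareCorner [DecidableEq ι] {g : ι → ℤ} {ρ : ℤ → ι × Bool → ι × Bool}
    {X Y : ℤ → ι × Bool} (h : IsQuad N g ρ) (hS : IsSquares N g ρ X Y) :
    IsSquareCorner g ρ (fun v => if cornerBit ρ X Y v then X v else Y v)
      (fun v => if cornerBit ρ X Y v then Y v else X v) := by
  constructor <;> intro v <;> rcases hS.apply_of_bit v with ⟨hb, h'⟩ | ⟨hb, h'⟩ <;>
    simp [hb, h', hS.bit_X h, hS.bit_Y h, hS.XX, hS.XY, hS.YX, hS.YY]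

/-- Darts of the first summand. -/
def dartInl (x : ι × Bool) : (ι ⊕ κ) × Bool := (Sum.inl x.1, x.2)

/-- Darts of the second summand. -/
def dartInr (x : κ × Bool) : (ι ⊕ κ) × Bool := (Sum.inr x.1, x.2)

theorem dart_cases (x : (ι ⊕ κ) × Bool) : (∃ y, x = dartInl y) ∨ (∃ y, x = dartInr y) := by
  rcases x with ⟨i | i, b⟩
  · exact Or.inl ⟨(i, b), rfl⟩
  · exact Or.inr ⟨(i, b), rfl⟩

variable {g : ι → ℤ} {g' : κ → ℤ} {ρ : ℤ → ι × Bool → ι × Bool} {τ : ℤ → κ × Bool → κ × Bool}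
  {A B : ℤ → ι × Bool} {C D : ℤ → κ × Bool}

theorem jumpStep_inl (x : ι × Bool) : jumpStep (Sum.elim g g') (dartInl x) = jumpStep g x := rfl

theorem jumpStep_inr (x : κ × Bool) : jumpStep (Sum.elim g g') (dartInr x) = jumpStep g' x := rfl

theorem jumpNeg_inl (x : ι × Bool) : jumpNeg (dartInl x : (ι ⊕ κ) × Bool) = dartInl (jumpNeg x) := rfl

theorem jumpNeg_inr (x : κ × Bool) : jumpNeg (dartInr x : (ι ⊕ κ) × Bool) = dartInr (jumpNeg x) := rfl

variable [DecidableEq ι] [DecidableEq κ]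

/-- The union of two systems, spliced at the corners after `A` and `C`. -/
def mergeSystem (ρ : ℤ → ι × Bool → ι × Bool) (τ : ℤ → κ × Bool → κ × Bool) (A B : ℤ → ι × Bool)
    (C D : ℤ → κ × Bool) (v : ℤ) : (ι ⊕ κ) × Bool → (ι ⊕ κ) × Bool
  | (Sum.inl i, b) => if (i, b) = A v then dartInr (D v) else dartInl (ρ v (i, b))
  | (Sum.inr i, b) => if (i, b) = C v then dartInl (B v) else dartInr (τ v (i, b))

theorem mergeSystem_inl (v : ℤ) (x : ι × Bool) : mergeSystem ρ τ A B C D v (dartInl x) =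
    if x = A v then dartInr (D v) else dartInl (ρ v x) := rfl

theorem mergeSystem_inr (v : ℤ) (x : κ × Bool) : mergeSystem ρ τ A B C D v (dartInr x) =
    if x = C v then dartInl (B v) else dartInr (τ v x) := rfl

/-- The corners from `A` to `B` and from `C` to `D` are cut and rejoined crosswise. A new face
alternates between a direction of each system, and it closes up after four steps because moving
along `D` exchanges `A` with `B`, and moving along `B` exchanges `C` with `D`. -/
theorem IsQuad.merge (h : IsQuad N g ρ) (h' : IsQuad N g' τ) (hA : IsSquareCorner g ρ A B)
    (hC : IsSquareCorner g' τ C D)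
    (hAN : ∀ v, A (v + N) = A v ∧ B (v + N) = B v) (hCN : ∀ v, C (v + N) = C v ∧ D (v + N) = D v)
    (hAD : ∀ v, A (v + jumpStep g' (D v)) = B v ∧ B (v + jumpStep g' (D v)) = A v)
    (hCB : ∀ v, C (v + jumpStep g (B v)) = D v ∧ D (v + jumpStep g (B v)) = C v) :
    IsQuad N (Sum.elim g g') (mergeSystem ρ τ A B C D) where
  periodic v := by
    funext y
    rcases dart_cases y with ⟨y, rfl⟩ | ⟨y, rfl⟩
    · rw [mergeSystem_inl, mergeSystem_inl, (hAN v).1, (hCN v).2, h.periodic]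
    · rw [mergeSystem_inr, mergeSystem_inr, (hAN v).2, (hCN v).1, h'.periodic]
  trans v x y := by
    have e1 : ∀ z, z ≠ A v → mergeSystem ρ τ A B C D v (dartInl z) = dartInl (ρ v z) := by
      intro z hz; rw [mergeSystem_inl, if_neg hz]
    have e2 : ∀ z, z ≠ C v → mergeSystem ρ τ A B C D v (dartInr z) = dartInr (τ v z) := by
      intro z hz; rw [mergeSystem_inr, if_neg hz]
    have s1 : ∃ n, (mergeSystem ρ τ A B C D v)^[n] (dartInl (A v)) = dartInr (D v) :=
      ⟨1, by rw [Function.iterate_one, mergeSystem_inl, if_pos rfl]⟩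
    have s2 : ∃ n, (mergeSystem ρ τ A B C D v)^[n] (dartInr (C v)) = dartInl (B v) :=
      ⟨1, by rw [Function.iterate_one, mergeSystem_inr, if_pos rfl]⟩
    have t1 := fun z => reach_of_cut (h.trans v) e1 z
    have t2 := fun z => reach_of_cut (h'.trans v) e2 z
    have f1 := fun z => reach_from_cut (h.trans v) e1 z
    have f2 := fun z => reach_from_cut (h'.trans v) e2 z
    rw [hA.adj] at f1
    rw [hC.adj] at f2
    -- The opened cycles are paths from `B` to `A` and from `D` to `C`; the two crosswise links join
    -- them into one cycle.
    have toD : ∃ n, (mergeSystem ρ τ A B C D v)^[n] x = dartInr (D v) := by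
      rcases dart_cases x with ⟨x, rfl⟩ | ⟨x, rfl⟩
      · exact iterate_reach_trans (t1 x) s1
      · exact iterate_reach_trans (t2 x) (iterate_reach_trans s2 (iterate_reach_trans (t1 _) s1))
    refine iterate_reach_trans toD ?_
    rcases dart_cases y with ⟨y, rfl⟩ | ⟨y, rfl⟩
    · exact iterate_reach_trans (t2 _) (iterate_reach_trans s2 (f1 y))
    · exact f2 y
  square v y := by
    rcases dart_cases y with ⟨y, rfl⟩ | ⟨y, rfl⟩
    · rw [mergeSystem_inl]
      split_ifs with hy
      · rw [jumpStep_inr, jumpNeg_inr, mergeSystem_inr, hC.AB, if_pos rfl, (hAD v).2, hy]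
      · rw [jumpStep_inl, jumpNeg_inl, mergeSystem_inl, h.square, if_neg]
        intro heq
        apply hy
        have h1 := hA.AA (v + jumpStep g (ρ v y))
        rw [← heq, jumpStep_jumpNeg, add_neg_cancel_right] at h1
        rw [h1, ← hA.adj, ← heq, h.square]
    · rw [mergeSystem_inr]
      split_ifs with hy
      · rw [jumpStep_inl, jumpNeg_inl, mergeSystem_inl, hA.AB, if_pos rfl, (hCB v).2, hy]
      · rw [jumpStep_inr, jumpNeg_inr, mergeSystem_inr, h'.square, if_neg]
        intro heq
        apply hy
        have h1 := hC.AA (v + jumpStep g' (τ v y))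
        rw [← heq, jumpStep_jumpNeg, add_neg_cancel_right] at h1
        rw [h1, ← hC.adj, ← heq, h'.square]

/-- Only the corner between `A` and `B` is destroyed. It suffices that one direction of the square,
`Y`, avoids both; `X` may coincide with either. -/
theorem IsSquares.merge {X Y : ℤ → ι × Bool} (hS : IsSquares N g ρ X Y)
    (hA : IsSquareCorner g ρ A B) (hYA : ∀ v, Y v ≠ A v) (hYB : ∀ v, Y v ≠ B v) :
    IsSquares N (Sum.elim g g') (mergeSystem ρ τ A B C D) (fun v => dartInl (X v))
      (fun v => dartInl (Y v)) where
  perX v := by rw [hS.perX]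
  perY v := by rw [hS.perY]
  ne v hv := hS.ne v (Sum.inl_injective hv)
  XX v := by rw [jumpStep_inl, hS.XX, jumpNeg_inl]
  YX v := by rw [jumpStep_inl, hS.YX]
  XY v := by rw [jumpStep_inl, hS.XY]
  YY v := by rw [jumpStep_inl, hS.YY, jumpNeg_inl]
  adj v := by
    rw [mergeSystem_inl, mergeSystem_inl, if_neg (hYA v)]
    rcases hS.adj v with h | h
    · left
      rw [if_neg, h]
      intro h2
      exact hYB v (by rw [← h, h2, hA.adj])
    · exact Or.inr (by rw [h])

end Merge

/-! ### Base points of inner squares and compatible signs -/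

section Retract

/-- Moving `v` to the base point of its inner square. -/
def retract (M p v : ℤ) : ℤ := v - (if oddBit v then 1 else 0) - (if digitBit M v then p else 0)

variable {M p : ℤ} (hM : 0 < M) (h2 : 2 ∣ M) (hp : ∃ u, p = M * u ∧ u % 2 = 1)
include hM

theorem retract_add_of_dvd {x : ℤ} (hx : 2 * M ∣ x) (v : ℤ) :
    retract M p (v + x) = retract M p v + x := by
  rw [retract, oddBit_add_of_dvd v ((Dvd.intro _ rfl).trans hx), digitBit_add_of_dvd hM v hx, retract]
  ring

include h2

theorem retract_add_one {v : ℤ} (hv : v % 2 = 0) : retract M p (v + 1) = retract M p v := by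
  have hd : ¬ M ∣ v + 1 := fun hd => by have := h2.trans hd; omega
  rw [retract, retract, digitBit_add_one_of_not_dvd hM hd, oddBit_eq_true.2 (by omega),
    oddBit_eq_false.2 hv]
  simp

include hp

theorem retract_add_p {v : ℤ} (hv : digitBit M v = false) :
    retract M p (v + p) = retract M p v := by
  obtain ⟨u, rfl, hu⟩ := hp
  rw [retract, retract, digitBit_add_mul hM, hv, oddBit_add_of_dvd v (h2.mul_right _),
    oddBit_eq_true.2 hu]
  simp
  ring

theorem retract_innerThird (a v : ℤ) :
    retract M p (v + jumpStep (hexGen p a) (innerThird v)) = retract M p v := by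
  rcases Int.emod_two_eq_zero_or_one v with hv | hv
  · rw [innerThird, oddBit_eq_false.2 hv]
    exact retract_add_one hM h2 hv
  · rw [innerThird, oddBit_eq_true.2 hv]
    change retract M p (v - 1) = _
    rw [← retract_add_one hM h2 (v := v - 1) (by omega), sub_add_cancel]

theorem retract_innerSecond (a v : ℤ) :
    retract M p (v + jumpStep (hexGen p a) (innerSecond M v)) = retract M p v := by
  rw [innerSecond]
  cases hv : digitBit M v
  · exact retract_add_p hM h2 hp hv
  · change retract M p (v - p) = _
    rw [← retract_add_p hM h2 hp (v := v - p), sub_add_cancel]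
    obtain ⟨u, rfl, hu⟩ := hp
    have := digitBit_add_mul hM (v - M * u) u
    rw [sub_add_cancel, hv, oddBit_eq_true.2 hu] at this
    simpa using this.symm

/-- Compatible sign functions from a sign function on base points. -/
theorem HexData.of_retract {a N : ℤ} {χ : ℤ → Bool} (ha : 2 * M ∣ a) (hN : 2 * M ∣ N)
    (hχN : ∀ v, χ (v + N) = χ v) (hχa : ∀ v, χ (v + a) = !χ v) :
    HexData M p a N (fun v => χ (retract M p v)) (fun v => χ (retract M p (v - v % M - 1))) := by
  -- `v - v % M - 1` is the last vertex of the block before that of `v`, so the outer sign is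
  -- constant on blocks and meets the boundary condition by construction.
  have hadd : ∀ v x, M ∣ x → v + x - (v + x) % M - 1 = v - v % M - 1 + x := by
    rintro v x ⟨c, rfl⟩
    rw [Int.add_mul_emod_self_left]; ring
  have hMa : M ∣ a := (Dvd.intro_left _ rfl).trans ha
  have hMN : M ∣ N := (Dvd.intro_left _ rfl).trans hN
  refine ⟨hM, h2, hp, ha, hN, fun v => ?_, fun v hv => ?_, fun v hv => ?_, fun v => ?_, fun v => ?_,
    fun v hv hd => ?_, fun v hv => ?_, fun v hv => ?_, fun v => ?_⟩
  · rw [retract_add_of_dvd hM hN, hχN]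
  · rw [retract_add_one hM h2 hv]
  · rw [retract_add_p hM h2 hp hv]
  · rw [retract_add_of_dvd hM ha, hχa]
  · rw [hadd v N hMN, retract_add_of_dvd hM hN, hχN]
  · have h1 := ediv_add_one_of_not_dvd hM hd
    have h3 := Int.emod_add_mul_ediv v M
    have h4 := Int.emod_add_mul_ediv (v + 1) M
    rw [h1] at h4
    congr 2
    linarith
  · rw [Int.emod_eq_zero_of_dvd hv, sub_zero]
  -- The preceding block has the opposite digit, so the outer `p`-step at `v` is an inner one there.
  · obtain ⟨u, rfl, hu⟩ := hp
    rw [hadd v _ (Dvd.intro _ rfl), retract_add_p hM h2 ⟨u, rfl, hu⟩]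
    have h1 := Int.emod_add_mul_ediv v M
    have h3 := digitBit_add_one_of_dvd hM (v := v - v % M - 1) ⟨v / M, by linarith⟩
    have h4 : digitBit M (v - v % M) = digitBit M v := by
      rw [show v - v % M = 0 + M * (v / M) by linarith, digitBit_add_mul hM, digitBit, oddBit]
      simp [digitBit]
    rw [sub_add_cancel, h4, hv] at h3
    simpa using h3.symm
  · rw [hadd v a hMa, retract_add_of_dvd hM ha, hχa]

end Retract

/-! ### Systems with two and three generators, and the merging step -/

section Assembly

variable {M K p a : ℤ}

/-- All that is missing is a periodic sign that `a` flips; `a` is an odd multiple of `K`, so the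
digit of weight `K` serves. -/
theorem HasQuad.three (hM : 0 < M) (h2 : 2 ∣ M) (hp : ∃ u, p = M * u ∧ u % 2 = 1)
    (hK : 0 < K) (hMK : 2 * M ∣ K) (ha : ∃ u, a = K * u ∧ u % 2 = 1) :
    HasQuad (2 * K) (hexGen p a) := by
  have h : HexData M p a (2 * K) _ _ := HexData.of_retract hM h2 hp (χ := digitBit K)
    (by obtain ⟨u, rfl, -⟩ := ha; exact hMK.mul_right _) (hMK.mul_left _)
    (fun v => digitBit_add_of_dvd hK v dvd_rfl)
    (fun v => by
      obtain ⟨u, rfl, hu⟩ := ha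
      rw [digitBit_add_mul hK, oddBit_eq_true.2 hu, Bool.xor_true])
  exact ⟨_, _, _, h.isQuad, h.isSquares_inner, 1, 2, fun v => ⟨rfl, rfl⟩⟩

/-- Each side of the splice must have its squares reversed along the squares of the other. On the
three-generator side this is arranged by the sign `χ`, on the other side by reversing copies with
`ε`. -/
theorem HasQuad.merge {κ : Type*} {g : κ → ℤ} {N : ℤ} (hM : 0 < M) (h2 : 2 ∣ M)
    (hp : ∃ u, p = M * u ∧ u % 2 = 1) (hK : 0 < K) (hMK : 2 * M ∣ K)
    (ha : ∃ u, a = K * u ∧ u % 2 = 1) (hN : N ∣ K) (hg : ∀ j, 2 * M ∣ g j) (hQ : HasQuad N g) :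
    HasQuad (2 * K) (Sum.elim (hexGen p a) g) := by
  classical
  obtain ⟨τ, Z, W, hτ, hS, i, j, hij⟩ := hQ
  have hMa : 2 * M ∣ a := by obtain ⟨u, rfl, -⟩ := ha; exact hMK.mul_right _
  have hNa : N ∣ a := by obtain ⟨u, rfl, -⟩ := ha; exact hN.mul_right _
  have hMN : 2 * M ∣ 2 * K := hMK.mul_left _
  let base : ℤ → ℤ := fun w => w - (if (Z w).2 then g i else 0) - (if (W w).2 then g j else 0)
  -- A side of a square of `τ` fixes `base` and changes one of the first two bits. The jump `a`, a
  -- multiple of the period `N`, fixes these bits and changes the digit. So `χ` flips in all cases.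
  let χ : ℤ → Bool := fun w => (Z w).2 ^^ (W w).2 ^^ digitBit K (base w)
  have hper : ∀ {x}, N ∣ x → ∀ v, χ (v + x) = ((Z v).2 ^^ (W v).2 ^^ digitBit K (base v + x)) := by
    intro x hx v
    have hZ : Z (v + x) = Z v := periodic_fun_eq hS.perX (by simpa using hx)
    have hW : W (v + x) = W v := periodic_fun_eq hS.perY (by simpa using hx)
    simp only [χ, base, hZ, hW]
    rw [show v + x - (if (Z v).2 then g i else 0) - (if (W v).2 then g j else 0) =
      v - (if (Z v).2 then g i else 0) - (if (W v).2 then g j else 0) + x by ring]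
  have hχN : ∀ v, χ (v + 2 * K) = χ v := by
    intro v
    rw [hper (hN.mul_left _), digitBit_add_of_dvd hK _ dvd_rfl]
  have hχa : ∀ v, χ (v + a) = !χ v := by
    intro v
    rw [hper hNa]
    obtain ⟨u, rfl, hu⟩ := ha
    rw [digitBit_add_mul hK, oddBit_eq_true.2 hu]
    simp [χ]
  have hZeq : ∀ v, Z v = (i, (Z v).2) := fun v => Prod.ext (hij v).1 rfl
  have hWeq : ∀ v, W v = (j, (W v).2) := fun v => Prod.ext (hij v).2 rfl
  have hχZ : ∀ v, χ (v + jumpStep g (Z v)) = !χ v := by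
    intro v
    have hb : base (v + jumpStep g (Z v)) = base v := by
      simp only [base, hS.XX, hS.YX]
      rw [hZeq v]
      cases (Z v).2 <;> simp [jumpNeg, jumpStep, sub_eq_add_neg]
    simp only [χ, hb, hS.XX, hS.YX]
    simp [jumpNeg]
  have hχW : ∀ v, χ (v + jumpStep g (W v)) = !χ v := by
    intro v
    have hb : base (v + jumpStep g (W v)) = base v := by
      simp only [base, hS.XY, hS.YY]
      rw [hWeq v]
      cases (W v).2 <;> simp [jumpNeg, jumpStep] <;> ring
    simp only [χ, hb, hS.XY, hS.YY]
    simp [jumpNeg]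
  have hH : HexData M p a (2 * K) _ _ := HexData.of_retract hM h2 hp hMa hMN hχN hχa
  have hgx : ∀ x, 2 * M ∣ jumpStep g x := by
    rintro ⟨i, _ | _⟩
    · exact hg i
    · exact (hg i).neg_right
  -- The second system is read at the base point of the inner square, so its four vertices see the
  -- same rotation; `ε` reverses it at alternate corners.
  let π : ℤ → ℤ := retract M p
  let ε : ℤ → Bool := fun v => oddBit v ^^ digitBit M v
  have hπ : ∀ v x, π (v + jumpStep g x) = π v + jumpStep g x := fun v x =>
    retract_add_of_dvd hM (hgx x) v
  have hπ' : ∀ v x, N ∣ π (v + jumpStep g x) - (π v + jumpStep g x) := fun v x => by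
    rw [hπ, sub_self]; exact dvd_zero _
  have hπN : ∀ v, N ∣ π (v + 2 * K) - π v := by
    intro v
    simp only [π]
    rw [retract_add_of_dvd hM hMN, add_sub_cancel_left]
    exact hN.mul_left _
  have hodd : ∀ v {x}, 2 * M ∣ x → oddBit (v + x) = oddBit v := fun v x hx =>
    oddBit_add_of_dvd v ((Dvd.intro _ rfl).trans hx)
  have hdig : ∀ v {x}, 2 * M ∣ x → digitBit M (v + x) = digitBit M v := fun v x hx =>
    digitBit_add_of_dvd hM v hx
  have hT : IsQuad (2 * K) g (twistSystem τ π ε) := hτ.twist hπN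
    (fun v => by simp only [ε, hodd v hMN, hdig v hMN])
    hπ' (fun v x => by simp only [ε, hodd v (hgx x), hdig v (hgx x)])
  have hTS : IsSquares (2 * K) g (twistSystem τ π ε) (fun v => Z (π v)) (fun v => W (π v)) :=
    hS.twist hτ hπN hπ'
  have hbit := cornerBit_twist hτ hS π ε
  have hε2 : ∀ v, ε (v + jumpStep (hexGen p a) (innerSecond M v)) = !ε v := by
    intro v
    simp only [ε, innerSecond]
    rw [hH.oddBit_step_second]
    have := hH.digitBit_step_second 0 v (digitBit M v)
    simp only [add_zero] at this
    rw [this]; simp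
  have hε3 : ∀ v, ε (v + jumpStep (hexGen p a) (innerThird v)) = !ε v := by
    intro v
    simp only [ε]
    have := congrArg Prod.snd (hH.isSquares_inner.XY v)
    simp only [innerSecond] at this
    rw [this, innerThird, HexData.oddBit_step_third]; simp
  have hπ2 : ∀ v, π (v + jumpStep (hexGen p a) (innerSecond M v)) = π v :=
    retract_innerSecond hM h2 hp a
  have hπ3 : ∀ v, π (v + jumpStep (hexGen p a) (innerThird v)) = π v :=
    retract_innerThird hM h2 hp a
  have hPZ : ∀ v {x}, 2 * M ∣ x → innerSecond M (v + x) = innerSecond M v := fun v x hx => by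
    simp only [innerSecond, hdig v hx]
  have hPZ' : ∀ v {x}, 2 * M ∣ x → innerThird (v + x) = innerThird v := fun v x hx => by
    simp only [innerThird, hodd v hx]
  refine ⟨_, _, _, hH.isQuad.merge hT (hH.isSquares_inner.isSquareCorner hH.isQuad)
    (hTS.isSquareCorner hT) ?_ ?_ ?_ ?_, hH.isSquares_outer.merge
      (hH.isSquares_inner.isSquareCorner hH.isQuad) ?_ ?_, Sum.inl 1, Sum.inl 2,
      fun v => ⟨rfl, rfl⟩⟩
  · intro v
    simp only [hH.cornerBit_inner, hPZ v hMN, hPZ' v hMN, hodd v hMN, hdig v hMN]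
    rw [retract_add_of_dvd hM hMN, hχN]
    exact ⟨rfl, rfl⟩
  · intro v
    have h1 : Z (π (v + 2 * K)) = Z (π v) := periodic_fun_eq hS.perX (hπN v)
    have h2 : W (π (v + 2 * K)) = W (π v) := periodic_fun_eq hS.perY (hπN v)
    have h3 : cornerBit τ Z W (π (v + 2 * K)) = cornerBit τ Z W (π v) := by
      rw [cornerBit, cornerBit, h1, h2, hτ.eq_of_dvd (hπN v)]
    simp only [hbit, h1, h2, h3, ε, hodd v hMN, hdig v hMN]
    constructor <;> trivial
  · intro v
    have key : ∀ x, χ (π v + jumpStep g x) = (!χ (π v)) →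
        (cornerBit (hexSystem M (fun v => χ (π v)) (fun v => χ (π (v - v % M - 1))))
          (innerSecond M) innerThird (v + jumpStep g x)) =
        !(cornerBit (hexSystem M (fun v => χ (π v)) (fun v => χ (π (v - v % M - 1))))
          (innerSecond M) innerThird v) := by
      intro x hx
      rw [hH.cornerBit_inner, hH.cornerBit_inner, hodd v (hgx x), hdig v (hgx x)]
      change (χ (π (v + _)) ^^ _ ^^ _) = !(χ (π v) ^^ _ ^^ _)
      rw [hπ, hx]; simp
    have k1 := key _ (hχZ (π v))
    have k2 := key _ (hχW (π v))
    simp only [hPZ v (hgx _), hPZ' v (hgx _)]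
    cases cornerBit (twistSystem τ π ε) (fun v => Z (π v)) (fun v => W (π v)) v
    · simp only [Bool.false_eq_true, if_false]
      rw [k1]
      cases cornerBit (hexSystem M (fun v => χ (π v)) (fun v => χ (π (v - v % M - 1))))
          (innerSecond M) innerThird v <;> exact ⟨rfl, rfl⟩
    · simp only [if_true]
      rw [k2]
      cases cornerBit (hexSystem M (fun v => χ (π v)) (fun v => χ (π (v - v % M - 1))))
          (innerSecond M) innerThird v <;> exact ⟨rfl, rfl⟩
  · intro v
    have key : ∀ x, π (v + x) = π v → ε (v + x) = (!ε v) →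
        (cornerBit (twistSystem τ π ε) (fun v => Z (π v)) (fun v => W (π v)) (v + x)) =
        !(cornerBit (twistSystem τ π ε) (fun v => Z (π v)) (fun v => W (π v)) v) := by
      intro x hx hx'
      rw [hbit, hbit, hx, hx']; simp
    have k2 := key _ (hπ2 v) (hε2 v)
    have k3 := key _ (hπ3 v) (hε3 v)
    cases cornerBit (hexSystem M (fun v => χ (retract M p v))
        (fun v => χ (retract M p (v - v % M - 1)))) (innerSecond M) innerThird v
    · simp only [Bool.false_eq_true, if_false, hπ2]
      rw [k2]
      cases cornerBit (twistSystem τ π ε) (fun v => Z (π v)) (fun v => W (π v)) v <;>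
        exact ⟨rfl, rfl⟩
    · simp only [if_true, hπ3]
      rw [k3]
      cases cornerBit (twistSystem τ π ε) (fun v => Z (π v)) (fun v => W (π v)) v <;>
        exact ⟨rfl, rfl⟩
  -- The outer squares stay intact: their third jump is opposite to that of the inner squares.
  · intro v
    split_ifs
    · simp [outerThird, innerSecond]
    · simp [outerThird, innerThird]
  · intro v
    split_ifs
    · simp [outerThird, innerThird]
    · simp [outerThird, innerSecond]

/-- The constant rotation with two generators. -/
def crossRot : Fin 2 × Bool → Fin 2 × Bool
  | (0, b) => (1, b)
  | (1, b) => (0, !b)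

/-- The order `a, 1, -a, -1` at every vertex has only commutator squares as faces. A perfect family
is selected by the parity and the digit of weight `K`, the latter read at an even base point so that
unit sides do not affect it. -/
theorem HasQuad.two (hK : 0 < K) (h2 : 2 ∣ K) (ha : ∃ u, a = K * u ∧ u % 2 = 1) :
    HasQuad (2 * K) ![a, 1] := by
  obtain ⟨u, rfl, hu⟩ := ha
  let c : ℤ → ℤ := fun v => v - (if oddBit v then 1 else 0)
  have hodd : ∀ v, oddBit (v + jumpStep ![K * u, 1] (1, oddBit v)) = !oddBit v := by
    intro v
    rw [oddBit_add]
    cases oddBit v <;> simp [jumpStep]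
  have hc : ∀ v x, 2 ∣ x → c (v + x) = c v + x := by
    intro v x hx
    simp only [c, oddBit_add_of_dvd v hx]; ring
  have hc1 : ∀ v, c (v + jumpStep ![K * u, 1] (1, oddBit v)) = c v := by
    intro v
    simp only [c, hodd]
    cases oddBit v <;> simp [jumpStep, sub_eq_add_neg]
  have ha2 : ∀ σ, 2 ∣ jumpStep ![K * u, 1] (0, σ) := by
    rintro (_ | _)
    · exact h2.mul_right _
    · exact (h2.mul_right _).neg_right
  have hd : ∀ v σ, digitBit K (c (v + jumpStep ![K * u, 1] (0, σ))) = !digitBit K (c v) := by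
    intro v σ
    rw [hc _ _ (ha2 σ)]
    cases σ
    · change digitBit K (c v + K * u) = _
      rw [digitBit_add_mul hK, oddBit_eq_true.2 hu, Bool.xor_true]
    · change digitBit K (c v + -(K * u)) = _
      rw [← mul_neg, digitBit_add_mul hK, oddBit_neg, oddBit_eq_true.2 hu, Bool.xor_true]
  refine ⟨fun _ => crossRot, fun v => (0, digitBit K (c v)), fun v => (1, oddBit v),
    ⟨fun _ => rfl, fun _ => ?_, fun _ => ?_⟩, ⟨fun v => ?_, fun v => ?_, fun v => ?_,
      fun v => ?_, fun v => ?_, fun v => ?_, fun v => ?_, fun v => ?_⟩, 0, 1, fun v => ⟨rfl, rfl⟩⟩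
  · have : ∀ x y, ∃ n ∈ List.range 4, crossRot^[n] x = y := by decide
    intro x y
    obtain ⟨n, -, h⟩ := this x y
    exact ⟨n, h⟩
  · decide
  · rw [hc _ _ (Dvd.intro _ rfl), digitBit_add_of_dvd hK _ dvd_rfl]
  · rw [oddBit_add_of_dvd _ (Dvd.intro _ rfl)]
  · simp
  · simp only [hd, jumpNeg]
  · simp only [oddBit_add_of_dvd v (ha2 _)]
  · simp only [hc1]
  · simp only [hodd, jumpNeg]
  · generalize digitBit K (c v) = x
    generalize oddBit v = y
    revert x y
    decide

end Assembly

/-! ### Inserting one generator along tubes between faces -/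

section Insert

variable {ι : Type*} {N : ℤ} {g g' : ι → ℤ} {ρ σ : ℤ → ι × Bool → ι × Bool}

theorem IsQuad.piecewise (h : IsQuad N g ρ) (h' : IsQuad N g σ) {c : ℤ → Bool}
    (hcN : ∀ v, c (v + N) = c v) (hc : ∀ v x, c (v + jumpStep g x) = c v) :
    IsQuad N g (fun v => if c v then ρ v else σ v) where
  periodic v := by rw [hcN, h.periodic, h'.periodic]
  trans v := by
    split_ifs
    · exact h.trans v
    · exact h'.trans v
  square v y := by
    rw [hc]
    split_ifs
    · exact h.square v y
    · exact h'.square v y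

theorem IsSquares.piecewise {X Y X' Y' : ℤ → ι × Bool} (h : IsSquares N g ρ X Y)
    (h' : IsSquares N g σ X' Y') {c : ℤ → Bool}
    (hcN : ∀ v, c (v + N) = c v) (hc : ∀ v x, c (v + jumpStep g x) = c v) :
    IsSquares N g (fun v => if c v then ρ v else σ v) (fun v => if c v then X v else X' v)
      (fun v => if c v then Y v else Y' v) := by
  constructor <;> intro v <;> cases hv : c v <;>
    simp only [hc, hcN, hv, if_true, Bool.false_eq_true, if_false]
  exacts [h'.perX v, h.perX v, h'.perY v, h.perY v, h'.ne v, h.ne v, h'.XX v, h.XX v, h'.YX v,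
    h.YX v, h'.XY v, h.XY v, h'.YY v, h.YY v, h'.adj v, h.adj v]

/-- Darts of the old generators. -/
def dartSome (x : ι × Bool) : Option ι × Bool := (some x.1, x.2)

theorem jumpStep_some {d : ℤ} (x : ι × Bool) :
    jumpStep (fun o : Option ι => o.elim d g) (dartSome x) = jumpStep g x := rfl

theorem jumpNeg_some (x : ι × Bool) : jumpNeg (dartSome x) = dartSome (jumpNeg x) := rfl

/-- A family of faces met at a corner of each vertex is determined by the corner before a jump. -/
theorem IsQuad.eq_of_corner {U : ℤ → ι × Bool} (h : IsQuad N g ρ)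
    (hU : ∀ v, U (v + jumpStep g (ρ v (U v))) = jumpNeg (ρ v (U v))) {v : ℤ} {y : ι × Bool}
    (hy : jumpNeg (ρ v y) = U (v + jumpStep g (ρ v y))) : y = U v := by
  have h1 := h.square v y
  have h2 := hU (v + jumpStep g (ρ v y))
  rw [← hy, h1] at h2
  have h3 := h.square (v + jumpStep g (ρ v y)) (jumpNeg (ρ v y))
  rw [h1] at h3
  have h4 := hU (v + jumpStep g (ρ v y) + jumpStep g y)
  rw [h2, h3, jumpNeg_jumpNeg, jumpStep_jumpNeg] at h4
  have h5 := h.square (v + jumpStep g (ρ v y) + jumpStep g y) (jumpNeg y)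
  rw [h3, jumpNeg_jumpNeg, jumpStep_jumpNeg] at h5
  have h6 := hU (v + jumpStep g (ρ v y) + jumpStep g y + -jumpStep g (ρ v y))
  rw [h4, h5, jumpNeg_jumpNeg, jumpStep_jumpNeg] at h6
  rw [← h6]
  congr 1
  ring

variable [DecidableEq ι]

/-- Inserting a new generator, its positive end after `U` and its negative end after `W`. -/
def insertSystem (ρ : ℤ → ι × Bool → ι × Bool) (U W : ℤ → ι × Bool) (v : ℤ) :
    Option ι × Bool → Option ι × Bool
  | (some i, b) => if (i, b) = U v then (none, false) else if (i, b) = W v then (none, true)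
      else dartSome (ρ v (i, b))
  | (none, false) => dartSome (ρ v (U v))
  | (none, true) => dartSome (ρ v (W v))

variable {U W : ℤ → ι × Bool}

theorem insertSystem_some (v : ℤ) (x : ι × Bool) : insertSystem ρ U W v (dartSome x) =
    if x = U v then (none, false) else if x = W v then (none, true) else dartSome (ρ v x) := rfl

/-- The corner `W` at `v + d` is the corner `U` at `v` with its two jumps exchanged, so the two
faces are mirror translates. A tube joins them, and the new edges cut it into squares with sides `d`
and a side of the old face. -/
theorem IsQuad.insert {d : ℤ} (h : IsQuad N g ρ)
    (hN : ∀ v, U (v + N) = U v ∧ W (v + N) = W v) (hne : ∀ v, W v ≠ U v)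
    (hU : ∀ v, U (v + jumpStep g (ρ v (U v))) = jumpNeg (ρ v (U v)))
    (hW : ∀ v, W (v + jumpStep g (ρ v (W v))) = jumpNeg (ρ v (W v)))
    (hUW : ∀ v, W (v + d) = ρ v (U v)) (hWU : ∀ v, ρ (v + d) (W (v + d)) = U v) :
    IsQuad N (fun o : Option ι => o.elim d g) (insertSystem ρ U W) where
  periodic v := by
    funext ⟨o, b⟩
    cases o <;> cases b <;> simp [insertSystem, h.periodic, (hN v).1, (hN v).2]
  trans v x y := by
    have hU1 : insertSystem ρ U W v (dartSome (U v)) = (none, false) := by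
      rw [insertSystem_some, if_pos rfl]
    have hW1 : insertSystem ρ U W v (dartSome (W v)) = (none, true) := by
      rw [insertSystem_some, if_neg (hne v), if_pos rfl]
    have step : ∀ z, ∃ n, (insertSystem ρ U W v)^[n] (dartSome z) = dartSome (ρ v z) := by
      intro z
      by_cases h1 : z = U v
      · exact ⟨2, by rw [h1, Function.iterate_succ_apply, hU1]; rfl⟩
      by_cases h2 : z = W v
      · exact ⟨2, by rw [h2, Function.iterate_succ_apply, hW1]; rfl⟩
      · exact ⟨1, by rw [Function.iterate_one, insertSystem_some, if_neg h1, if_neg h2]⟩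
    have old : ∀ z z', ∃ n, (insertSystem ρ U W v)^[n] (dartSome z) = dartSome z' := by
      intro z z'
      obtain ⟨n, rfl⟩ := h.trans v z z'
      induction n with
      | zero => exact ⟨0, rfl⟩
      | succ n ih =>
        rw [Function.iterate_succ_apply']
        exact iterate_reach_trans ih (step _)
    have out : ∃ z, ∃ n, (insertSystem ρ U W v)^[n] x = dartSome z := by
      rcases x with ⟨_ | i, _ | _⟩
      exacts [⟨_, 1, rfl⟩, ⟨_, 1, rfl⟩, ⟨(i, false), 0, rfl⟩, ⟨(i, true), 0, rfl⟩]
    obtain ⟨z, hz⟩ := out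
    refine iterate_reach_trans hz ?_
    rcases y with ⟨_ | i, _ | _⟩
    · exact iterate_reach_trans (old _ (U v)) ⟨1, hU1⟩
    · exact iterate_reach_trans (old _ (W v)) ⟨1, hW1⟩
    · exact old _ (i, false)
    · exact old _ (i, true)
  square v y := by
    rcases y with ⟨_ | i, b⟩
    · cases b
      · change insertSystem ρ U W (v + jumpStep g (ρ v (U v))) (dartSome (jumpNeg (ρ v (U v)))) = _
        rw [insertSystem_some, hU, if_pos rfl]
      · change insertSystem ρ U W (v + jumpStep g (ρ v (W v))) (dartSome (jumpNeg (ρ v (W v)))) = _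
        rw [insertSystem_some, ← hW, if_neg (hne _), if_pos rfl]
    · change insertSystem ρ U W (v + jumpStep _ (insertSystem ρ U W v (dartSome (i, b)))) _ =
        dartSome (i, b)
      change insertSystem ρ U W _ (jumpNeg (insertSystem ρ U W v (dartSome (i, b)))) = _
      rw [insertSystem_some]
      split_ifs with h1 h2
      · change dartSome (ρ (v + d) (W (v + d))) = _
        rw [hWU, h1]
      · change dartSome (ρ (v + -d) (U (v + -d))) = _
        rw [← hUW, neg_add_cancel_right, h2]
      · rw [jumpStep_some, jumpNeg_some, insertSystem_some, if_neg, if_neg, h.square]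
        · exact fun h' => h2 (h.eq_of_corner hW h')
        · exact fun h' => h1 (h.eq_of_corner hU h')

theorem IsSquares.insert {d : ℤ} {X Y : ℤ → ι × Bool} (hS : IsSquares N g ρ X Y)
    (hYU : ∀ v, Y v ≠ U v ∧ Y v ≠ ρ v (U v)) (hYW : ∀ v, Y v ≠ W v ∧ Y v ≠ ρ v (W v)) :
    IsSquares N (fun o : Option ι => o.elim d g) (insertSystem ρ U W) (fun v => dartSome (X v))
      (fun v => dartSome (Y v)) where
  perX v := by rw [hS.perX]
  perY v := by rw [hS.perY]
  ne v hv := hS.ne v (Option.some_injective _ hv)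
  XX v := by rw [jumpStep_some, hS.XX, jumpNeg_some]
  YX v := by rw [jumpStep_some, hS.YX]
  XY v := by rw [jumpStep_some, hS.XY]
  YY v := by rw [jumpStep_some, hS.YY, jumpNeg_some]
  adj v := by
    rw [insertSystem_some, insertSystem_some, if_neg (hYU v).1, if_neg (hYW v).1]
    rcases hS.adj v with h | h
    · left
      rw [if_neg, if_neg, h]
      · intro h2
        exact (hYW v).2 (by rw [← h, h2])
      · intro h2
        exact (hYU v).2 (by rw [← h, h2])
    · exact Or.inr (by rw [h])

/-- The first jump of a square in the rotation at a vertex. -/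
def firstJump (ρ : ℤ → ι × Bool → ι × Bool) (X Y : ℤ → ι × Bool) (v : ℤ) : ι × Bool :=
  if cornerBit ρ X Y v then X v else Y v

/-- The second jump of a square in the rotation at a vertex. -/
def secondJump (ρ : ℤ → ι × Bool → ι × Bool) (X Y : ℤ → ι × Bool) (v : ℤ) : ι × Bool :=
  if cornerBit ρ X Y v then Y v else X v

theorem IsSquares.corner (h : IsQuad N g ρ) {X Y : ℤ → ι × Bool} (hS : IsSquares N g ρ X Y) :
    IsSquareCorner g ρ (firstJump ρ X Y) (secondJump ρ X Y) := hS.isSquareCorner h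

theorem jump_periodic (h : IsQuad N g ρ) {X Y : ℤ → ι × Bool} (hS : IsSquares N g ρ X Y) (v : ℤ) :
    firstJump ρ X Y (v + N) = firstJump ρ X Y v := by
  rw [firstJump, firstJump, cornerBit, cornerBit, hS.perX, hS.perY, h.periodic]

theorem jump_flip {X Y : ℤ → ι × Bool} {v w : ℤ} (hX : X w = X v) (hY : Y w = Y v)
    (hb : cornerBit ρ X Y w = !cornerBit ρ X Y v) : firstJump ρ X Y w = secondJump ρ X Y v ∧
      secondJump ρ X Y w = firstJump ρ X Y v := by
  rw [firstJump, secondJump, firstJump, secondJump, hb, hX, hY]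
  cases cornerBit ρ X Y v <;> exact ⟨rfl, rfl⟩

/-- Inserting the generator `1` into a system with even generators, using one perfect set of squares
at the even vertices and another one at the odd vertices. -/
theorem HasQuad.insert_one {X Y X' Y' E F : ℤ → ι × Bool} (h : IsQuad N g ρ) (h2 : 2 ∣ N)
    (hg : ∀ i, 2 ∣ g i) (hS : IsSquares N g ρ X Y) (hS' : IsSquares N g ρ X' Y')
    (hE : IsSquares N g ρ E F) {i j k : ι} (hjk : j ≠ k)
    (hX : ∀ v, (X v).1 = i) (hY : ∀ v, (Y v).1 = j) (hX' : ∀ v, (X' v).1 = i)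
    (hY' : ∀ v, (Y' v).1 = k) (hEi : ∀ v, (E v).1 = i) (hF : ∀ v, F v = jumpNeg (Y' v))
    (hflip : ∀ v, oddBit v = false → X (v + 1) = X v ∧ Y (v + 1) = Y v ∧
      cornerBit ρ X Y (v + 1) = !cornerBit ρ X Y v)
    (hflip' : ∀ v, oddBit v = true → X' (v + 1) = X' v ∧ Y' (v + 1) = Y' v ∧
      cornerBit ρ X' Y' (v + 1) = !cornerBit ρ X' Y' v) :
    HasQuad N (fun o : Option ι => o.elim 1 g) := by
  have hik : i ≠ k := by rw [← hX' 0, ← hY' 0]; exact hS'.ne 0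
  have hgx : ∀ x, 2 ∣ jumpStep g x := by
    rintro ⟨i, _ | _⟩
    · exact hg i
    · exact (hg i).neg_right
  -- Edges from an even vertex to the next run through the squares `X, Y`, those from an odd vertex
  -- through `X', Y'`. Every vertex thus uses one family upwards and the other downwards.
  let U : ℤ → ι × Bool := fun v => if oddBit v then firstJump ρ X' Y' v else firstJump ρ X Y v
  let W : ℤ → ι × Bool := fun v => if oddBit v then firstJump ρ X Y v else firstJump ρ X' Y' v
  have hρ1 : ∀ v, ρ v (firstJump ρ X Y v) = secondJump ρ X Y v := (hS.corner h).adj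
  have hρ2 : ∀ v, ρ v (firstJump ρ X' Y' v) = secondJump ρ X' Y' v := (hS'.corner h).adj
  have hne : ∀ v, firstJump ρ X Y v ≠ firstJump ρ X' Y' v := by
    intro v hv
    have h3 : secondJump ρ X Y v = secondJump ρ X' Y' v := by rw [← hρ1, ← hρ2, hv]
    have h4 := congrArg Prod.fst hv
    have h5 := congrArg Prod.fst h3
    have h6 := hX v
    have h7 := hY v
    have h8 := hX' v
    have h9 := hY' v
    rw [firstJump, firstJump] at h4
    rw [secondJump, secondJump] at h5
    split_ifs at h4 h5 <;> simp_all
  -- `F` differs from `X`, `Y`, `X'` in its generator and from `Y'` in its sign.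
  have hFne : ∀ v, (F v ≠ firstJump ρ X Y v ∧ F v ≠ secondJump ρ X Y v) ∧
      (F v ≠ firstJump ρ X' Y' v ∧ F v ≠ secondJump ρ X' Y' v) := by
    intro v
    have h1 : F v ≠ X v := fun h => hik (by rw [← hX v, ← h, hF]; exact hY' v)
    have h2 : F v ≠ Y v := fun h => hjk (by rw [← hY v, ← h, hF]; exact hY' v)
    have h3 : F v ≠ X' v := fun h => hik (by rw [← hX' v, ← h, hF]; exact hY' v)
    have h4 : F v ≠ Y' v := fun h => jumpNeg_ne (Y' v) (by rw [← hF]; exact h)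
    simp only [firstJump, secondJump]
    split_ifs <;> exact ⟨⟨by assumption, by assumption⟩, by assumption, by assumption⟩
  have hodd1 : ∀ v : ℤ, oddBit (v + 1) = !oddBit v := fun v => by rw [oddBit_add]; simp
  refine ⟨insertSystem ρ U W, fun v => dartSome (E v), fun v => dartSome (F v), h.insert ?_ ?_ ?_ ?_ ?_ ?_,
    hE.insert ?_ ?_, some i, some k, fun v => ?_⟩
  · intro v
    simp only [U, W, oddBit_add_of_dvd v h2, jump_periodic h hS, jump_periodic h hS']
    constructor <;> trivial
  · intro v
    simp only [U, W]
    split_ifs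
    · exact hne v
    · exact (hne v).symm
  · intro v
    simp only [U, oddBit_add_of_dvd v (hgx _)]
    split_ifs
    · rw [hρ2, (hS'.corner h).AB]
    · rw [hρ1, (hS.corner h).AB]
  · intro v
    simp only [W, oddBit_add_of_dvd v (hgx _)]
    split_ifs
    · rw [hρ1, (hS.corner h).AB]
    · rw [hρ2, (hS'.corner h).AB]
  · intro v
    simp only [U, W, hodd1]
    cases hv : oddBit v
    · obtain ⟨h3, h4, h5⟩ := hflip v hv
      simp only [Bool.not_false, if_true, Bool.false_eq_true, if_false]
      rw [hρ1, (jump_flip h3 h4 h5).1]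
    · obtain ⟨h3, h4, h5⟩ := hflip' v hv
      simp only [Bool.not_true, if_true, Bool.false_eq_true, if_false]
      rw [hρ2, (jump_flip h3 h4 h5).1]
  · intro v
    simp only [U, W, hodd1]
    cases hv : oddBit v
    · obtain ⟨h3, h4, h5⟩ := hflip v hv
      simp only [Bool.not_false, if_true, Bool.false_eq_true, if_false]
      rw [hρ1, (jump_flip h3 h4 h5).2]
    · obtain ⟨h3, h4, h5⟩ := hflip' v hv
      simp only [Bool.not_true, if_true, Bool.false_eq_true, if_false]
      rw [hρ2, (jump_flip h3 h4 h5).2]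
  · intro v
    simp only [U]
    split_ifs
    · rw [hρ2]; exact (hFne v).2
    · rw [hρ1]; exact (hFne v).1
  · intro v
    simp only [W]
    split_ifs
    · rw [hρ1]; exact (hFne v).1
    · rw [hρ2]; exact (hFne v).2
  · exact ⟨congrArg some (hEi v), congrArg some (by rw [hF]; exact hY' v)⟩

end Insert

/-! ### Stacking systems along the generator 1 -/

section Layer

variable {ι : Type*} [DecidableEq ι] {N G t : ℤ} {g h : ι → ℤ}
  {ρ σ : ℤ → ι × Bool → ι × Bool}

theorem cornerBit_piecewise {X Y X' Y' : ℤ → ι × Bool} (c : ℤ → Bool) (v : ℤ) :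
    cornerBit (fun v => if c v then ρ v else σ v) (fun v => if c v then X v else X' v)
      (fun v => if c v then Y v else Y' v) v =
    if c v then cornerBit ρ X Y v else cornerBit σ X' Y' v := by
  cases hv : c v <;> simp [cornerBit, hv]

/-- Stacking `G` systems along a new generator, a first copy of `ρ` followed by copies of `σ` and of
its reversal. -/
theorem HasQuad.layer {P Q X Y E F : ℤ → ι × Bool} (hG : 0 < G) (hG2 : 2 ∣ G)
    (hh : ∀ i, N ∣ t * h i - g i) (hρ : IsQuad N g ρ) (hσ : IsQuad N g σ)
    (hP : IsSquares N g ρ P Q) (hP' : IsSquares N g σ P Q)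
    (hPb : ∀ v, cornerBit ρ P Q v = !cornerBit σ P Q v)
    (hX : IsSquares N g ρ X Y) (hX' : IsSquares N g σ (fun v => X (v - t)) (fun v => Y (v - t)))
    (hXb : ∀ v, cornerBit σ (fun v => X (v - t)) (fun v => Y (v - t)) (v + t) = !cornerBit ρ X Y v)
    (hE : IsSquares N g ρ E F) (hE' : IsSquares N g σ E F) {i j k : ι} (hjk : j ≠ k)
    (hXi : ∀ v, (X v).1 = i) (hYj : ∀ v, (Y v).1 = j) (hPi : ∀ v, (P v).1 = i)
    (hQk : ∀ v, (Q v).1 = k) (hEi : ∀ v, (E v).1 = i) (hF : ∀ v, F v = jumpNeg (Q v)) :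
    HasQuad (G * N) (fun o : Option ι => o.elim 1 (fun i => G * h i)) := by
  -- `t` turns a jump `G * h i` into `g i` modulo `N`. Passing the top layer raises `v / G` and
  -- moves the base point by `t`. The copies of `σ` are advanced by `t` beforehand, so the shift is
  -- felt only between the copy of `ρ` and the layer above it.
  let π : ℤ → ℤ := fun v => t * (v / G)
  let c : ℤ → Bool := fun v => decide (G ∣ v)
  -- Tubes join mirror images, so consecutive copies of `σ` have opposite orientation.
  let ε : ℤ → Bool := fun v => !oddBit v
  have hGx : ∀ x, jumpStep (fun i => G * h i) x = G * jumpStep h x := by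
    rintro ⟨i, _ | _⟩ <;> simp [jumpStep]
  have hstep : ∀ x, N ∣ t * jumpStep h x - jumpStep g x := by
    rintro ⟨i, _ | _⟩
    · exact hh i
    · change N ∣ t * (-h i) - -g i
      rw [show t * (-h i) - -g i = -(t * h i - g i) by ring]
      exact (hh i).neg_right
  have hπG : ∀ v x, π (v + G * x) = π v + t * x := by
    intro v x
    simp only [π]
    rw [Int.add_mul_ediv_left _ _ hG.ne']; ring
  have hπN : ∀ s v, N ∣ (π (v + G * N) + s) - (π v + s) := by
    intro s v
    rw [hπG]
    exact ⟨t, by ring⟩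
  have hπx : ∀ s v x, N ∣ (π (v + jumpStep (fun i => G * h i) x) + s) - (π v + s + jumpStep g x) := by
    intro s v x
    rw [hGx, hπG]
    convert hstep x using 1
    ring
  have hcG : ∀ v x, c (v + G * x) = c v := fun v x => by
    simp only [c]; congr 1; exact propext (Int.dvd_add_left (Dvd.intro _ rfl))
  have hoG : ∀ v x, oddBit (v + G * x) = oddBit v := fun v x => oddBit_add_of_dvd v (hG2.mul_right _)
  have hcN : ∀ v, c (v + G * N) = c v := fun v => hcG v N
  have hcx : ∀ v x, c (v + jumpStep (fun i => G * h i) x) = c v := fun v x => by rw [hGx, hcG]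
  have hεN : ∀ v, ε (v + G * N) = ε v := fun v => by simp only [ε, hoG]
  have hεx : ∀ v x, ε (v + jumpStep (fun i => G * h i) x) = ε v := fun v x => by
    simp only [ε, hGx, hoG]
  have q1 : IsQuad (G * N) (fun i => G * h i) (twistSystem ρ (fun v => π v + 0) fun _ => false) :=
    hρ.twist (hπN 0) (fun _ => rfl) (hπx 0) (fun _ _ => rfl)
  have q2 : IsQuad (G * N) (fun i => G * h i) (twistSystem σ (fun v => π v + t) ε) :=
    hσ.twist (hπN t) hεN (hπx t) hεx
  have hS1 := hX.twist hρ (π := fun v => π v + 0) (ε := fun _ => false) (hπN 0) (hπx 0)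
  have hS2 := hX'.twist hσ (π := fun v => π v + t) (ε := ε) (hπN t) (hπx t)
  have hT1 := hP.twist hρ (π := fun v => π v + 0) (ε := fun _ => false) (hπN 0) (hπx 0)
  have hT2 := hP'.twist hσ (π := fun v => π v + t) (ε := ε) (hπN t) (hπx t)
  have hO1 := hE.twist hρ (π := fun v => π v + 0) (ε := fun _ => false) (hπN 0) (hπx 0)
  have hO2 := hE'.twist hσ (π := fun v => π v + t) (ε := ε) (hπN t) (hπx t)
  have hc2 : ∀ v, c v = true → oddBit v = false := by
    intro v hv
    simp only [c, decide_eq_true_eq] at hv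
    exact oddBit_of_dvd (hG2.trans hv)
  have hodd1 : ∀ v : ℤ, oddBit (v + 1) = !oddBit v := fun v => by rw [oddBit_add]; simp
  have hπ1 : ∀ v, c (v + 1) = false → π (v + 1) = π v := by
    intro v hv
    simp only [c, decide_eq_false_iff_not] at hv
    simp only [π]
    rw [ediv_add_one_of_not_dvd hG hv]
  have hπ2 : ∀ v, c (v + 1) = true → π (v + 1) = π v + t := by
    intro v hv
    simp only [c, decide_eq_true_eq] at hv
    simp only [π]
    rw [ediv_add_one_of_dvd hG hv]; ring
  refine HasQuad.insert_one (q1.piecewise q2 hcN hcx) (hG2.mul_right _) (fun i => hG2.mul_right _)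
    (hS1.piecewise hS2 hcN hcx) (hT1.piecewise hT2 hcN hcx) (hO1.piecewise hO2 hcN hcx)
    (i := i) (j := j) (k := k) hjk ?_ ?_ ?_ ?_ ?_ ?_ ?_ ?_
  · intro v; split_ifs <;> exact hXi _
  · intro v; split_ifs <;> exact hYj _
  · intro v; split_ifs <;> exact hPi _
  · intro v; split_ifs <;> exact hQk _
  · intro v; split_ifs <;> exact hEi _
  · intro v; split_ifs <;> exact hF _
  · intro v hv
    have hcv : c (v + 1) = false := by
      by_contra hc
      rw [Bool.not_eq_false] at hc
      have := hc2 _ hc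
      rw [hodd1, hv] at this
      exact absurd this (by simp)
    rw [cornerBit_piecewise, cornerBit_piecewise, cornerBit_twist hσ hX', cornerBit_twist hρ hX,
      cornerBit_twist hσ hX']
    simp only [hcv, hπ1 v hcv, ε, hodd1, hv, add_sub_cancel_right, Bool.false_eq_true, if_false,
      add_zero, ite_self, Bool.not_false, Bool.not_true, Bool.xor_false, Bool.xor_true, true_and]
    split_ifs
    · exact hXb _
    · rw [Bool.not_not]
  · intro v hv
    have hcv : c v = false := by
      by_contra hc
      rw [Bool.not_eq_false] at hc
      rw [hc2 _ hc] at hv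
      exact absurd hv (by simp)
    rw [cornerBit_piecewise, cornerBit_piecewise, cornerBit_twist hσ hP', cornerBit_twist hρ hP,
      cornerBit_twist hσ hP']
    cases hc1 : c (v + 1)
    · simp [hcv, hπ1 v hc1, ε, hodd1, hv]
    · simp [hcv, hπ2 v hc1, ε, hv, hPb]

end Layer

/-! ### Signs for two superposed systems differing by an odd shift -/

section Ladder

variable {M p a N t : ℤ} {s : ℤ → Bool}

/-- The outer sign function of the first of two superposed systems with three generators. -/
def ladderSign (M t : ℤ) (s : ℤ → Bool) (w : ℤ) : Bool :=
  if w % M < (-t) % M then s (w - w % M - 1) else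
    if digitBit M (w - w % M + (-t) % M + t) = digitBit M (w - w % M + (-t) % M) then
      !s (w - w % M + (-t) % M + t - 1) else s (w - w % M + (-t) % M + t)

/-- The outer sign function of the second of two superposed systems, at the odd vertices. -/
def crossSignOdd (M t : ℤ) (s : ℤ → Bool) (x : ℤ) : Bool :=
  if digitBit M x = digitBit M (x - t) then ladderSign M t s (x - t) else !s (x - t)

/-- The outer sign function of the second of two superposed systems with three generators. -/
def crossSign (M t : ℤ) (s : ℤ → Bool) (x : ℤ) : Bool :=
  if M ∣ x then !s (x - 1) else if oddBit x then crossSignOdd M t s x else crossSignOdd M t s (x - 1)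

theorem digitBit_block (hM : 0 < M) (w : ℤ) {r : ℤ} (h0 : 0 ≤ r) (hr : r < M) :
    digitBit M (w - w % M + r) = digitBit M w := by
  have h1 := Int.emod_add_mul_ediv w M
  rw [show w - w % M + r = r + M * (w / M) by linarith, digitBit, Int.add_mul_ediv_left _ _ hM.ne',
    Int.ediv_eq_zero_of_lt h0 hr, zero_add, digitBit]

theorem ladderSign_add_of_dvd (w : ℤ) {x : ℤ} (hx : M ∣ x) : ladderSign M t s (w + x) =
    if w % M < (-t) % M then s (w - w % M - 1 + x) else
    if digitBit M (w - w % M + (-t) % M + t + x) = digitBit M (w - w % M + (-t) % M + x) then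
      !s (w - w % M + (-t) % M + t - 1 + x) else s (w - w % M + (-t) % M + t + x) := by
  have h1 : (w + x) % M = w % M := by
    obtain ⟨c, rfl⟩ := hx
    rw [Int.add_mul_emod_self_left]
  rw [ladderSign, h1, show w + x - w % M - 1 = w - w % M - 1 + x by ring,
    show w + x - w % M + (-t) % M = w - w % M + (-t) % M + x by ring,
    show w - w % M + (-t) % M + x + t = w - w % M + (-t) % M + t + x by ring,
    show w - w % M + (-t) % M + t + x - 1 = w - w % M + (-t) % M + t - 1 + x by ring]

namespace HexData

variable {lam : ℤ → Bool} (h : HexData M p a N s lam) (ht : t % 2 = 1)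
include h

theorem M_dvd_N : M ∣ N := (Dvd.intro_left _ rfl).trans h.dvd_N

omit h in
theorem dvd_top (w : ℤ) : M ∣ w - w % M + (-t) % M + t := by
  have h1 := Int.emod_add_mul_ediv w M
  have h2 := Int.emod_add_mul_ediv (-t) M
  exact ⟨w / M - (-t) / M, by linarith⟩

/-- Within a block the value changes only at the residue of `-t`, that is, where `w + t` enters a
new block. -/
theorem ladderSign_add_one {w : ℤ} (h1 : ¬ M ∣ w + 1) (h2 : ¬ M ∣ w + 1 + t) :
    ladderSign M t s (w + 1) = ladderSign M t s w := by
  have h3 := ediv_add_one_of_not_dvd h.pos h1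
  have h4 := Int.emod_add_mul_ediv w M
  have h5 := Int.emod_add_mul_ediv (w + 1) M
  rw [h3] at h5
  have h6 : (w + 1) % M = w % M + 1 := by linarith
  have h7 : w % M + 1 ≠ (-t) % M := by
    intro h7
    apply h2
    have := dvd_top (M := M) (t := t) w
    rwa [← h7, show w - w % M + (w % M + 1) + t = w + 1 + t by ring] at this
  have h8 : (w + 1) % M < (-t) % M ↔ w % M < (-t) % M := by omega
  rw [ladderSign, ladderSign, show w + 1 - (w + 1) % M = w - w % M by linarith]
  simp only [h8]

omit h in
theorem ladderSign_of_top {w : ℤ} (hw : M ∣ w + t) : ladderSign M t s w =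
    if digitBit M (w + t) = digitBit M w then !s (w + t - 1) else s (w + t) := by
  have h1 : (-t) % M = w % M :=
    Int.modEq_iff_dvd.2 (by rwa [show w - -t = w + t by ring])
  rw [ladderSign, h1, if_neg (lt_irrefl _), sub_add_cancel]

theorem ladderSign_add_a (w : ℤ) : ladderSign M t s (w + a) = !ladderSign M t s w := by
  rw [ladderSign_add_of_dvd w h.M_dvd_a, ladderSign]
  simp only [h.s_a, digitBit_add_of_dvd h.pos _ h.dvd_a]
  split_ifs <;> rfl

theorem ladderSign_add_N (w : ℤ) : ladderSign M t s (w + N) = ladderSign M t s w := by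
  rw [ladderSign_add_of_dvd w h.M_dvd_N, ladderSign]
  simp only [h.s_N, digitBit_add_of_dvd h.pos _ h.dvd_N]

theorem digitBit_sub_one_of_dvd {x : ℤ} (hx : M ∣ x) : digitBit M (x - 1) = !digitBit M x := by
  have := digitBit_add_one_of_dvd h.pos (v := x - 1) (by rwa [sub_add_cancel])
  rw [sub_add_cancel] at this
  rw [this]; simp

theorem digitBit_sub_one_of_not_dvd {x : ℤ} (hx : ¬ M ∣ x) : digitBit M (x - 1) = digitBit M x := by
  have := digitBit_add_one_of_not_dvd h.pos (v := x - 1) (by rwa [sub_add_cancel])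
  rwa [sub_add_cancel, eq_comm] at this

/-- Every branch reads `s` at a vertex of digit `false`, where `p` is an inner step preserving `s`;
this decides between the two formulas at the top. -/
theorem ladderSign_add_p {w : ℤ} (hw : digitBit M w = true) :
    ladderSign M t s (w + p) = ladderSign M t s w := by
  have h0 := Int.emod_nonneg (-t) h.pos.ne'
  have h1 := Int.emod_lt_of_pos (-t) h.pos
  have h2 : digitBit M (w - w % M - 1) = false := by
    have h3 := Int.emod_add_mul_ediv w M
    rw [h.digitBit_sub_one_of_dvd ⟨w / M, by linarith⟩]
    have := digitBit_block h.pos w le_rfl h.pos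
    rw [add_zero] at this
    rw [this, hw]; rfl
  have h3 := digitBit_block h.pos w h0 h1
  rw [hw] at h3
  rw [ladderSign_add_of_dvd w h.M_dvd_p, ladderSign, h.s_p _ h2, h.digitBit_add_p, h.digitBit_add_p]
  simp only [Bool.not_eq_eq_eq_not, Bool.not_not]
  split_ifs with h4 h5
  · rfl
  · rw [h.s_p]
    rw [h.digitBit_sub_one_of_dvd (dvd_top w), h5, h3]; rfl
  · rw [h.s_p]
    rw [h3] at h5
    simpa using h5

include ht

theorem not_dvd_t : ¬ M ∣ t := h.not_dvd_of_odd ht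

theorem ladderSign_of_dvd {w : ℤ} (hw : M ∣ w) : ladderSign M t s w = s (w - 1) := by
  have h0 := Int.emod_nonneg (-t) h.pos.ne'
  have h1 : (-t) % M ≠ 0 := fun h1 => h.not_dvd_t ht (by simpa using Int.dvd_of_emod_eq_zero h1)
  rw [ladderSign, Int.emod_eq_zero_of_dvd hw, if_pos (by omega), sub_zero]

/-- As `t` is odd and `M` even, the switch at the residue of `-t` lies on a step from an even to an
odd vertex. Such a step is inner and puts no condition on the outer sign. -/
theorem ladder : HexData M p a N s (ladderSign M t s) where
  pos := h.pos
  even := h.even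
  dvd_p := h.dvd_p
  dvd_a := h.dvd_a
  dvd_N := h.dvd_N
  s_N := h.s_N
  s_one := h.s_one
  s_p := h.s_p
  s_a := h.s_a
  lam_N := h.ladderSign_add_N
  lam_one v hv hd := h.ladderSign_add_one hd (h.not_dvd_of_odd (by omega))
  lam_fault v hv := h.ladderSign_of_dvd ht hv
  lam_p v hv := h.ladderSign_add_p hv
  lam_a := h.ladderSign_add_a

omit ht

theorem crossSignOdd_add_p {x : ℤ} (hx : digitBit M x = true) :
    crossSignOdd M t s (x + p) = crossSignOdd M t s x := by
  rw [crossSignOdd, crossSignOdd, show x + p - t = x - t + p by ring, h.digitBit_add_p,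
    h.digitBit_add_p]
  simp only [Bool.not_eq_eq_eq_not, Bool.not_not]
  split_ifs with h1
  · rw [h.ladderSign_add_p (by rw [← h1, hx])]
  · rw [h.s_p]
    rw [hx] at h1
    simpa using Ne.symm h1

theorem crossSignOdd_add_a (x : ℤ) : crossSignOdd M t s (x + a) = !crossSignOdd M t s x := by
  rw [crossSignOdd, crossSignOdd, show x + a - t = x - t + a by ring,
    digitBit_add_of_dvd h.pos _ h.dvd_a, digitBit_add_of_dvd h.pos _ h.dvd_a, h.ladderSign_add_a, h.s_a]
  split_ifs <;> rfl

theorem crossSignOdd_add_N (x : ℤ) : crossSignOdd M t s (x + N) = crossSignOdd M t s x := by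
  rw [crossSignOdd, crossSignOdd, show x + N - t = x - t + N by ring,
    digitBit_add_of_dvd h.pos _ h.dvd_N, digitBit_add_of_dvd h.pos _ h.dvd_N, h.ladderSign_add_N, h.s_N]

/-- Negating `s` mirrors the inner squares. The outer sign copies `ladderSign` where the digits at
`x - t` and `x` agree and is `!s (x - t)` where they differ, at odd vertices off block starts; outer
unit edges carry it to even ones, and block starts obey the boundary condition. -/
theorem cross : HexData M p a N (fun v => !s v) (crossSign M t s) where
  pos := h.pos
  even := h.even
  dvd_p := h.dvd_p
  dvd_a := h.dvd_a
  dvd_N := h.dvd_N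
  s_N v := by rw [h.s_N]
  s_one v hv := by rw [h.s_one v hv]
  s_p v hv := by rw [h.s_p v hv]
  s_a v := by rw [h.s_a v]
  lam_N x := by
    simp only [crossSign, Int.dvd_add_left h.M_dvd_N]
    rw [show x + N - 1 = x - 1 + N by ring, h.s_N,
      h.crossSignOdd_add_N, h.crossSignOdd_add_N, oddBit_add_of_dvd x (h.even.trans h.M_dvd_N)]
  lam_one x hx hd := by
    rw [crossSign, crossSign, if_neg hd, if_neg (h.not_dvd_of_odd hx), oddBit_eq_true.2 hx,
      oddBit_eq_false.2 (by omega), add_sub_cancel_right]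
    rfl
  lam_fault x hx := by rw [crossSign, if_pos hx]
  lam_p x hx := by
    simp only [crossSign, Int.dvd_add_left h.M_dvd_p]
    rw [show x + p - 1 = x - 1 + p by ring,
      oddBit_add_of_dvd x h.two_dvd_p, h.crossSignOdd_add_p hx]
    split_ifs with h1 h2
    · rw [h.s_p]
      rw [h.digitBit_sub_one_of_dvd h1, hx]; rfl
    · rfl
    · rw [h.crossSignOdd_add_p]
      rw [h.digitBit_sub_one_of_not_dvd h1, hx]
  lam_a x := by
    simp only [crossSign, Int.dvd_add_left h.M_dvd_a]
    rw [show x + a - 1 = x - 1 + a by ring,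
      oddBit_add_of_dvd x h.two_dvd_a, h.crossSignOdd_add_a, h.crossSignOdd_add_a, h.s_a]
    split_ifs <;> rfl

include ht

/-- When `w + t` starts a block, the second sign is forced by its boundary condition; `ladderSign`
was given its value at the residue of `-t` to agree with it. -/
theorem crossSign_of_eq {w : ℤ} (hw : digitBit M (w + t) = digitBit M w) :
    crossSign M t s (w + t) = ladderSign M t s w := by
  rw [crossSign]
  split_ifs with h1 h2
  · rw [ladderSign_of_top h1, if_pos hw]
  · rw [crossSignOdd, add_sub_cancel_right, if_pos hw]
  · rw [Bool.not_eq_true, oddBit_eq_false] at h2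
    have h3 : ¬ M ∣ w := h.not_dvd_of_odd (by omega)
    rw [crossSignOdd, show w + t - 1 - t = w - 1 by ring, h.digitBit_sub_one_of_not_dvd h1,
      h.digitBit_sub_one_of_not_dvd h3, if_pos hw, ← h.ladderSign_add_one (w := w - 1)]
    · rw [sub_add_cancel]
    all_goals rwa [sub_add_cancel]

theorem crossSign_of_ne {w : ℤ} (hw : digitBit M (w + t) ≠ digitBit M w) (h1 : ¬ M ∣ w + t) :
    crossSign M t s (w + t) = !s w := by
  rw [crossSign, if_neg h1]
  split_ifs with h2
  · rw [crossSignOdd, add_sub_cancel_right, if_neg hw]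
  · rw [Bool.not_eq_true, oddBit_eq_false] at h2
    have h3 : ¬ M ∣ w := h.not_dvd_of_odd (by omega)
    rw [crossSignOdd, show w + t - 1 - t = w - 1 by ring, h.digitBit_sub_one_of_not_dvd h1,
      h.digitBit_sub_one_of_not_dvd h3, if_neg hw, h.s_sub_one (by omega)]

end HexData

end Ladder

/-! ### Squares common to the two superposed systems, and four generators -/

section Strip

variable {M p a N t : ℤ} {s : ℤ → Bool}

/-- Whether a strip is outer for the first system regardless of the second one. -/
def stripTop (M t w : ℤ) : Bool := decide (M ∣ w + t) || lastBit M w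

/-- The jump along the second generator of the strip at `w`. -/
def stripSecond (M t w : ℤ) : Fin 3 × Bool :=
  (1, if stripTop M t w then !digitBit M w else !digitBit M (w + t))

/-- The jump along the first generator of the strip at `w`. -/
def stripFirst (M t : ℤ) (s : ℤ → Bool) (w : ℤ) : Fin 3 × Bool :=
  (0, if digitBit M (w + t) = digitBit M w then ladderSign M t s w else
    if stripTop M t w then s (w + t) else !s w)

/-- An outer jump along `p` has beside it the `a`-jump of sign `Λ`, and both `a`-jumps at a last
vertex. The inner one has the `a`-jump of sign `!S` beside it, except at a last vertex. -/
theorem hexRot_strip : ∀ b0 b1 S L Λ P A, ((P = !b1) ∧ (L = true ∨ A = Λ)) ∨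
    (P = b1 ∧ L = false ∧ A = !S) →
    if A ^^ b0 ^^ P then hexRot b0 b1 S L Λ (1, P) = (0, A)
      else hexRot b0 b1 S L Λ (0, A) = (1, P) := by
  decide +kernel

theorem stripTop_add_of_dvd (w : ℤ) {x : ℤ} (hx : M ∣ x) :
    stripTop M t (w + x) = stripTop M t w := by
  rw [stripTop, stripTop, lastBit_add_of_dvd w hx]
  congr 2
  rw [show w + x + t = w + t + x by ring]
  exact propext (Int.dvd_add_left hx)

/-- The part of being a perfect set of squares which does not involve the rotations. -/
theorem IsSquares.translate {ι : Type*} {g : ι → ℤ} {ρ σ : ℤ → ι × Bool → ι × Bool}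
    {X Y : ℤ → ι × Bool} (hS : IsSquares N g ρ X Y) (t : ℤ)
    (hadj : ∀ v, σ v (X (v - t)) = Y (v - t) ∨ σ v (Y (v - t)) = X (v - t)) :
    IsSquares N g σ (fun v => X (v - t)) (fun v => Y (v - t)) where
  perX v := by rw [show v + N - t = v - t + N by ring, hS.perX]
  perY v := by rw [show v + N - t = v - t + N by ring, hS.perY]
  ne v := hS.ne _
  XX v := by rw [add_sub_right_comm, hS.XX]
  YX v := by rw [add_sub_right_comm, hS.YX]
  XY v := by rw [add_sub_right_comm, hS.XY]
  YY v := by rw [add_sub_right_comm, hS.YY]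
  adj := hadj

/-- If `w` and `w + t` have equal digits, the strip is outer for both systems. Otherwise it is outer
for one and inner for the other; `stripTop` assigns the outer role to the first system where the
second cannot take it by a boundary condition, or where `w` is last. -/
theorem strip_ladder (w : ℤ) : if (stripFirst M t s w).2 ^^ oddBit w ^^ (stripSecond M t w).2
    then hexSystem M s (ladderSign M t s) w (stripSecond M t w) = stripFirst M t s w
    else hexSystem M s (ladderSign M t s) w (stripFirst M t s w) = stripSecond M t w := by
  refine hexRot_strip _ _ _ _ _ _ _ ?_
  simp only [stripFirst, stripSecond]
  by_cases hd : digitBit M (w + t) = digitBit M w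
  · rw [if_pos hd, hd, ite_self]
    exact Or.inl ⟨rfl, Or.inr rfl⟩
  · rw [if_neg hd]
    cases hT : stripTop M t w
    · rw [if_neg (by simp), if_neg (by simp)]
      rw [stripTop, Bool.or_eq_false_iff] at hT
      refine Or.inr ⟨?_, hT.2, rfl⟩
      revert hd
      cases digitBit M (w + t) <;> cases digitBit M w <;> simp
    · rw [if_pos rfl, if_pos rfl]
      refine Or.inl ⟨rfl, ?_⟩
      rw [stripTop, Bool.or_eq_true, decide_eq_true_eq] at hT
      rcases hT with hT | hT
      · exact Or.inr (by rw [HexData.ladderSign_of_top hT, if_neg hd])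
      · exact Or.inl hT

namespace HexData

variable {lam : ℤ → Bool} (h : HexData M p a N s lam) (ht : t % 2 = 1)
include h ht

theorem strip_cross (w : ℤ) : if (stripFirst M t s w).2 ^^ oddBit (w + t) ^^ (stripSecond M t w).2
    then hexSystem M (fun v => !s v) (crossSign M t s) (w + t) (stripSecond M t w) =
      stripFirst M t s w
    else hexSystem M (fun v => !s v) (crossSign M t s) (w + t) (stripFirst M t s w) =
      stripSecond M t w := by
  refine hexRot_strip _ _ _ _ _ _ _ ?_
  simp only [stripFirst, stripSecond]
  by_cases hd : digitBit M (w + t) = digitBit M w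
  · rw [if_pos hd, hd, ite_self]
    exact Or.inl ⟨rfl, Or.inr (h.crossSign_of_eq ht hd).symm⟩
  · rw [if_neg hd]
    cases hT : stripTop M t w
    · rw [if_neg (by simp), if_neg (by simp)]
      rw [stripTop, Bool.or_eq_false_iff, decide_eq_false_iff_not] at hT
      exact Or.inl ⟨rfl, Or.inr (h.crossSign_of_ne ht hd hT.1).symm⟩
    · rw [if_pos rfl, if_pos rfl]
      refine Or.inr ⟨?_, ?_, (Bool.not_not _).symm⟩
      · revert hd
        cases digitBit M (w + t) <;> cases digitBit M w <;> simp
      -- The inner role requires that `w + t` not be last; otherwise `M` would divide `1` or the odd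
      -- number `t`.
      · rw [stripTop, Bool.or_eq_true, decide_eq_true_eq, lastBit, decide_eq_true_eq] at hT
        rw [lastBit, decide_eq_false_iff_not]
        intro hd'
        rcases hT with hT | hT
        · have h1 : M ∣ 1 := (Int.dvd_add_right hT).1 hd'
          exact h.not_dvd_of_odd (by norm_num) h1
        · rw [show w + t + 1 = w + 1 + t by ring] at hd'
          exact h.not_dvd_t ht ((Int.dvd_add_right hT).1 hd')

theorem isSquares_strip : IsSquares N (hexGen p a) (hexSystem M s (ladderSign M t s))
    (stripSecond M t) (stripFirst M t s) where
  perX w := by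
    rw [stripSecond, stripTop_add_of_dvd w h.M_dvd_N, add_right_comm,
      digitBit_add_of_dvd h.pos _ h.dvd_N, digitBit_add_of_dvd h.pos _ h.dvd_N, stripSecond]
  perY w := by
    rw [stripFirst, stripTop_add_of_dvd w h.M_dvd_N, add_right_comm,
      digitBit_add_of_dvd h.pos _ h.dvd_N, digitBit_add_of_dvd h.pos _ h.dvd_N, h.s_N, h.s_N,
      h.ladderSign_add_N, stripFirst]
  ne w := by simp [stripFirst, stripSecond]
  XX w := by
    have h1 : ∀ σ, M ∣ jumpStep (hexGen p a) (1, σ) := by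
      rintro (_ | _)
      exacts [h.M_dvd_p, h.M_dvd_p.neg_right]
    have h2 := fun v σ => h.digitBit_step_second v w σ
    have h3 := fun σ => h.digitBit_step_second 0 w σ
    simp only [add_zero] at h3
    simp only [stripSecond, stripTop_add_of_dvd w (h1 _), h2, h3, jumpNeg]
    split_ifs <;> rfl
  YX w := by
    have h1 : ∀ σ, M ∣ jumpStep (hexGen p a) (1, σ) := by
      rintro (_ | _)
      exacts [h.M_dvd_p, h.M_dvd_p.neg_right]
    have h2 := fun v σ => h.digitBit_step_second v w σ
    have h3 := fun σ => h.digitBit_step_second 0 w σ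
    simp only [add_zero] at h3
    have hs : ∀ v, s (v + jumpStep (hexGen p a) (1, digitBit M v)) = s v := by
      intro v
      cases hv : digitBit M v
      · exact h.s_p v hv
      · exact h.s_sub_p hv
    have hl : ladderSign M t s (w + jumpStep (hexGen p a) (1, !digitBit M w)) =
        ladderSign M t s w := by
      cases hv : digitBit M w
      · exact (h.ladder ht).lam_sub_p hv
      · exact (h.ladder ht).lam_p w hv
    simp only [stripFirst, stripSecond, stripTop_add_of_dvd w (h1 _), h2, h3]
    by_cases hd : digitBit M (w + t) = digitBit M w
    · rw [hd, ite_self, if_pos rfl, if_pos rfl, hl]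
    · rw [if_neg hd, if_neg (fun h' => hd (Bool.not_inj h'))]
      have hd1 : digitBit M (w + t) = !digitBit M w := by
        revert hd
        cases digitBit M (w + t) <;> cases digitBit M w <;> simp
      split_ifs
      · rw [← hd1, add_right_comm, hs]
      · rw [hd1, Bool.not_not, hs]
  XY w := by
    have h1 : ∀ σ, 2 * M ∣ jumpStep (hexGen p a) (0, σ) := by
      rintro (_ | _)
      exacts [h.dvd_a, h.dvd_a.neg_right]
    have key : ∀ σ, stripSecond M t (w + jumpStep (hexGen p a) (0, σ)) = stripSecond M t w := by
      intro σ
      rw [stripSecond, stripTop_add_of_dvd w ((Dvd.intro_left _ rfl).trans (h1 _)), add_right_comm,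
        digitBit_add_of_dvd h.pos _ (h1 _), digitBit_add_of_dvd h.pos _ (h1 _), stripSecond]
    exact key _
  YY w := by
    have h1 : ∀ σ, 2 * M ∣ jumpStep (hexGen p a) (0, σ) := by
      rintro (_ | _)
      exacts [h.dvd_a, h.dvd_a.neg_right]
    have hs : ∀ v σ, s (v + jumpStep (hexGen p a) (0, σ)) = !s v := by
      rintro v (_ | _)
      exacts [h.s_a v, h.s_sub_a v]
    have hl : ∀ v σ, ladderSign M t s (v + jumpStep (hexGen p a) (0, σ)) = !ladderSign M t s v := by
      rintro v (_ | _)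
      exacts [(h.ladder ht).lam_a v, (h.ladder ht).lam_sub_a v]
    have key : ∀ σ, stripFirst M t s (w + jumpStep (hexGen p a) (0, σ)) =
        jumpNeg (stripFirst M t s w) := by
      intro σ
      rw [stripFirst, stripTop_add_of_dvd w ((Dvd.intro_left _ rfl).trans (h1 _)), add_right_comm,
        digitBit_add_of_dvd h.pos _ (h1 _), digitBit_add_of_dvd h.pos _ (h1 _), hs, hs, hl]
      rw [stripFirst, jumpNeg]
      split_ifs <;> rfl
    exact key _
  adj w := by
    have := strip_ladder (M := M) (t := t) (s := s) w
    split_ifs at this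
    · exact Or.inl this
    · exact Or.inr this

theorem isSquares_strip_cross :
    IsSquares N (hexGen p a) (hexSystem M (fun v => !s v) (crossSign M t s))
      (fun v => stripSecond M t (v - t)) (fun v => stripFirst M t s (v - t)) :=
  (h.isSquares_strip ht).translate t fun v => by
    have := h.strip_cross ht (v - t)
    rw [sub_add_cancel] at this
    split_ifs at this
    · exact Or.inl this
    · exact Or.inr this

/-- The orientation is the sum of the parity of the vertex and the signs of the two jumps; the shift
by the odd `t` changes only the parity. -/
theorem cornerBit_strip (w : ℤ) : cornerBit (hexSystem M (fun v => !s v) (crossSign M t s))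
      (fun v => stripSecond M t (v - t)) (fun v => stripFirst M t s (v - t)) (w + t) =
    !cornerBit (hexSystem M s (ladderSign M t s)) (stripSecond M t) (stripFirst M t s) w := by
  have h1 : cornerBit (hexSystem M s (ladderSign M t s)) (stripSecond M t) (stripFirst M t s) w =
      ((stripFirst M t s w).2 ^^ oddBit w ^^ (stripSecond M t w).2) := by
    have := strip_ladder (M := M) (t := t) (s := s) w
    split_ifs at this with hb
    · rw [hb, cornerBit, decide_eq_true_eq]; exact this
    · rw [Bool.not_eq_true] at hb
      rw [hb]
      exact (h.isSquares_strip ht).bit_of_apply (h.ladder ht).isQuad this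
  have h2 : cornerBit (hexSystem M (fun v => !s v) (crossSign M t s))
      (fun v => stripSecond M t (v - t)) (fun v => stripFirst M t s (v - t)) (w + t) =
      ((stripFirst M t s w).2 ^^ oddBit (w + t) ^^ (stripSecond M t w).2) := by
    have := h.strip_cross ht w
    split_ifs at this with hb
    · rw [hb, cornerBit, decide_eq_true_eq, add_sub_cancel_right]; exact this
    · rw [Bool.not_eq_true] at hb
      rw [hb]
      refine (h.isSquares_strip_cross ht).bit_of_apply h.cross.isQuad ?_
      rw [add_sub_cancel_right]; exact this
  rw [h1, h2, oddBit_add, oddBit_eq_true.2 ht]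
  generalize (stripFirst M t s w).2 = x
  generalize (stripSecond M t w).2 = y
  cases x <;> cases y <;> cases oddBit w <;> rfl

end HexData

/-- Layers are joined alternately through strips, with directions `p` and `a`, and through inner
squares, with directions `p` and `1`. The outer squares of the layers remain as the perfect family.
-/
theorem HasQuad.four {K G : ℤ} {g : Fin 3 → ℤ} (hM : 0 < M) (h2 : 2 ∣ M)
    (hp : ∃ u, p = M * u ∧ u % 2 = 1) (hK : 0 < K) (hMK : 2 * M ∣ K)
    (ha : ∃ u, a = K * u ∧ u % 2 = 1) (hG : 0 < G) (hG2 : 2 ∣ G) (ht : t % 2 = 1)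
    (hg : ∀ i, 2 * K ∣ t * g i - hexGen p a i) :
    HasQuad (G * (2 * K)) (fun o : Option (Fin 3) => o.elim 1 (fun i => G * g i)) := by
  have h : HexData M p a (2 * K) _ _ := HexData.of_retract hM h2 hp (χ := digitBit K)
    (by obtain ⟨u, rfl, -⟩ := ha; exact hMK.mul_right _) (hMK.mul_left _)
    (fun v => digitBit_add_of_dvd hK v dvd_rfl)
    (fun v => by
      obtain ⟨u, rfl, hu⟩ := ha
      rw [digitBit_add_mul hK, oddBit_eq_true.2 hu, Bool.xor_true])
  have hL := h.ladder ht
  have hC : HexData M p a (2 * K) _ _ := h.cross (t := t)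
  refine HasQuad.layer (i := 1) (j := 0) (k := 2) hG hG2 hg hL.isQuad hC.isQuad hL.isSquares_inner
    hC.isSquares_inner ?_ (h.isSquares_strip ht) (h.isSquares_strip_cross ht) (h.cornerBit_strip ht)
    hL.isSquares_outer hC.isSquares_outer (by decide) (fun _ => rfl) (fun _ => rfl) (fun _ => rfl)
    (fun _ => rfl) (fun _ => rfl) (fun _ => rfl)
  intro v
  rw [hL.cornerBit_inner, hC.cornerBit_inner]
  simp

end Strip

/-! ### Induction on the number of generators -/

section TwoAdic

theorem emod_two_mul_eq_one {x y : ℤ} (hx : x % 2 = 1) (hy : y % 2 = 1) : (x * y) % 2 = 1 := by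
  rw [Int.mul_emod, hx, hy]; rfl

theorem exists_inverse_two_pow {c : ℤ} (hc : c % 2 = 1) (m : ℕ) :
    ∃ u : ℤ, (2 : ℤ) ^ m ∣ u * c - 1 ∧ u % 2 = 1 := by
  have h : IsCoprime c 2 := ⟨1, -(c / 2), by have := Int.emod_add_mul_ediv c 2; linarith⟩
  -- The extra factor of two forces `u` to be odd even for `m = 0`.
  obtain ⟨u, v, huv⟩ := h.pow_right (n := m + 1)
  refine ⟨u, ⟨-(2 * v), by rw [pow_succ] at huv; linarith⟩, ?_⟩
  rcases Int.emod_two_eq_zero_or_one u with hu | hu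
  · have h1 : (2 : ℤ) ∣ 1 := by
      rw [← huv]
      exact dvd_add ((Int.dvd_of_emod_eq_zero hu).mul_right _) (Dvd.dvd.mul_left (dvd_pow_self 2 (by omega)) _)
    norm_num at h1
  · exact hu

/-- It suffices to treat systems with last generator `1`. -/
theorem HasQuad.of_last_one {k : ℕ}
    (H : ∀ (e : Fin (k + 1) → ℕ) (c : Fin (k + 1) → ℤ), StrictAnti e → (∀ i, c i % 2 = 1) →
      e (Fin.last k) = 0 → c (Fin.last k) = 1 → HasQuad (2 ^ (e 0 + 1)) (fun i => 2 ^ e i * c i))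
    {e : Fin (k + 1) → ℕ} {c : Fin (k + 1) → ℤ} (he : StrictAnti e) (hc : ∀ i, c i % 2 = 1) :
    HasQuad (2 ^ (e 0 + 1)) (fun i => 2 ^ e i * c i) := by
  have hle : ∀ i, e (Fin.last k) ≤ e i := fun i => he.antitone (Fin.le_last i)
  obtain ⟨u, hu, hu2⟩ := exists_inverse_two_pow (hc (Fin.last k)) (e 0 - e (Fin.last k) + 1)
  have h1 := H (fun i => e i - e (Fin.last k)) (fun i => if i = Fin.last k then 1 else u * c i)
    (fun i j hij => by have h1 := he hij; have h2 := hle j; dsimp only; omega)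
    (fun i => by
      split_ifs
      · rfl
      · exact emod_two_mul_eq_one hu2 (hc i))
    (by simp) (by simp)
  have h2 := h1.scale (K := 2 ^ e (Fin.last k)) (by positivity)
  have hN : (2 : ℤ) ^ e (Fin.last k) * 2 ^ (e 0 - e (Fin.last k) + 1) = 2 ^ (e 0 + 1) := by
    rw [← pow_add]; congr 1; have := hle 0; omega
  rw [hN] at h2
  refine h2.of_mul u fun i => ?_
  have hi : (2 : ℤ) ^ e i = 2 ^ e (Fin.last k) * 2 ^ (e i - e (Fin.last k)) := by
    rw [← pow_add]; congr 1; have := hle i; omega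
  split_ifs with h
  · rw [h, ← hN, Nat.sub_self, pow_zero]
    obtain ⟨q, hq⟩ := hu
    exact ⟨q, by linear_combination 2 ^ e (Fin.last k) * hq⟩
  · rw [hi]
    exact ⟨0, by ring⟩

theorem two_mul_two_pow_dvd {i j : ℕ} (h : i < j) : 2 * (2 : ℤ) ^ i ∣ 2 ^ j := by
  rw [← pow_succ']; exact pow_dvd_pow 2 h

theorem two_dvd_two_pow {i : ℕ} (h : 0 < i) : 2 ∣ (2 : ℤ) ^ i := dvd_pow_self 2 h.ne'

/-- Generators with pairwise different 2-adic valuations admit a quadrangular system. -/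
theorem HasQuad.of_strictAnti (k : ℕ) : ∀ (e : Fin (k + 2) → ℕ) (c : Fin (k + 2) → ℤ),
    StrictAnti e → (∀ i, c i % 2 = 1) → HasQuad (2 ^ (e 0 + 1)) (fun i => 2 ^ e i * c i) := by
  induction k using Nat.strong_induction_on with
  | _ k ih =>
  intro e c he hc
  refine HasQuad.of_last_one ?_ he hc
  clear he hc c e
  intro e c he hc he0 hc1
  rw [pow_succ']
  match k with
  | 0 =>
    have h01 := he (show (0 : Fin 2) < 1 by decide)
    have : (fun i : Fin 2 => (2 : ℤ) ^ e i * c i) = ![2 ^ e 0 * c 0, 1] := by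
      funext i
      fin_cases i
      · rfl
      · change 2 ^ e (Fin.last 1) * c (Fin.last 1) = 1
        rw [he0, hc1]; rfl
    rw [this]
    exact HasQuad.two (by positivity) (two_dvd_two_pow (by omega)) ⟨_, rfl, hc 0⟩
  | 1 =>
    have h01 := he (show (0 : Fin 3) < 1 by decide)
    have h12 := he (show (1 : Fin 3) < 2 by decide)
    have : (fun i : Fin 3 => (2 : ℤ) ^ e i * c i) = hexGen (2 ^ e 1 * c 1) (2 ^ e 0 * c 0) := by
      funext i
      fin_cases i
      · rfl
      · rfl
      · change 2 ^ e (Fin.last 2) * c (Fin.last 2) = 1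
        rw [he0, hc1]; rfl
    rw [this]
    exact HasQuad.three (M := 2 ^ e 1) (by positivity) (two_dvd_two_pow (by omega)) ⟨_, rfl, hc 1⟩
      (by positivity) (two_mul_two_pow_dvd h01) ⟨_, rfl, hc 0⟩
  | 2 =>
    have h01 := he (show (0 : Fin 4) < 1 by decide)
    have h12 := he (show (1 : Fin 4) < 2 by decide)
    have h23 := he (show (2 : Fin 4) < 3 by decide)
    -- Multiplication by `t` turns the third generator, without its power of two, into `1`, as the
    -- three-generator system requires.
    obtain ⟨t, ht, ht2⟩ := exists_inverse_two_pow (hc 2) (e 0 - e 2 + 1)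
    have key := HasQuad.four (M := 2 ^ (e 1 - e 2)) (K := 2 ^ (e 0 - e 2)) (G := 2 ^ e 2) (t := t)
      (p := t * (2 ^ (e 1 - e 2) * c 1)) (a := t * (2 ^ (e 0 - e 2) * c 0))
      (g := ![2 ^ (e 0 - e 2) * c 0, 2 ^ (e 1 - e 2) * c 1, c 2]) (by positivity)
      (two_dvd_two_pow (by omega)) ⟨t * c 1, by ring, emod_two_mul_eq_one ht2 (hc 1)⟩ (by positivity)
      (two_mul_two_pow_dvd (by omega)) ⟨t * c 0, by ring, emod_two_mul_eq_one ht2 (hc 0)⟩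
      (by positivity) (two_dvd_two_pow (by omega)) ht2 (by
        intro i
        fin_cases i
        · simp [hexGen]
        · simp [hexGen]
        · rw [← pow_succ']; exact ht)
    rw [mul_left_comm, ← pow_add, show e 2 + (e 0 - e 2) = e 0 by omega] at key
    refine HasQuad.reindex (finSuccEquivLast (n := 3)).symm ?_
    convert key using 2 with o
    rcases o with _ | i
    · change 2 ^ e (Fin.last 3) * c (Fin.last 3) = 1
      rw [he0, hc1]; rfl
    · fin_cases i
      · change (2 : ℤ) ^ e 0 * c 0 = 2 ^ e 2 * (2 ^ (e 0 - e 2) * c 0)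
        rw [← mul_assoc, ← pow_add, show e 2 + (e 0 - e 2) = e 0 by omega]
      · change (2 : ℤ) ^ e 1 * c 1 = 2 ^ e 2 * (2 ^ (e 1 - e 2) * c 1)
        rw [← mul_assoc, ← pow_add, show e 2 + (e 1 - e 2) = e 1 by omega]
      · rfl
  | m + 3 =>
    -- The triple consists of the first, the penultimate and the last generator. The valuations of
    -- the `m + 2` generators between lie strictly above that of the penultimate one, so they
    -- preserve its digit and the parity.
    let i0 : Fin (m + 5) := ⟨m + 3, by omega⟩
    let f : Fin 3 ⊕ Fin (m + 2) → Fin (m + 5) :=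
      Sum.elim ![0, i0, Fin.last (m + 4)] (fun j => ⟨j + 1, by omega⟩)
    have hf : Function.Bijective f := by
      rw [Fintype.bijective_iff_injective_and_card]
      refine ⟨?_, by simp; omega⟩
      rintro (i | i) (j | j) hij
      · have := congrArg Fin.val hij
        fin_cases i <;> fin_cases j <;> simp [f, i0] at this ⊢
      · have := congrArg Fin.val hij
        fin_cases i <;> simp [f, i0] at this <;> omega
      · have := congrArg Fin.val hij
        fin_cases j <;> simp [f, i0] at this <;> omega
      · have := congrArg Fin.val hij
        simp [f] at this
        rw [Fin.ext this]
    have h0 : e i0 < e 0 := he (Fin.lt_def.2 (by simp [i0]))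
    have h1 : e (Fin.last (m + 4)) < e i0 := he (Fin.lt_def.2 (by simp [i0]))
    have hQ := ih m (by omega) (fun j => e ⟨j + 1, by omega⟩) (fun j => c ⟨j + 1, by omega⟩)
      (fun i j hij => he (Fin.lt_def.2 (by simpa using hij))) (fun j => hc _)
    have key := HasQuad.merge (M := 2 ^ e i0) (K := 2 ^ e 0) (by positivity)
      (two_dvd_two_pow (by omega)) ⟨c i0, rfl, hc _⟩ (by positivity) (two_mul_two_pow_dvd h0)
      ⟨c 0, rfl, hc _⟩ (pow_dvd_pow 2 (he (Fin.lt_def.2 (by simp)))) (fun j => Dvd.dvd.mul_right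
        (two_mul_two_pow_dvd (he (Fin.lt_def.2 (by simp [i0])))) _) hQ
    refine HasQuad.reindex (Equiv.ofBijective f hf) ?_
    convert key using 2 with o
    rcases o with i | j
    · fin_cases i
      · rfl
      · rfl
      · change 2 ^ e (Fin.last (m + 4)) * c (Fin.last (m + 4)) = 1
        rw [he0, hc1]; rfl
    · rfl

end TwoAdic

/-! ### Permutations with cycles of constant length -/

section CycleCard

variable {D : Type*}

theorem card_sameCycle {σ : Perm D} {a : D} {m : ℕ} (hm : 0 < m) (h : (σ ^ m) a = a)
    (h' : ∀ i, 0 < i → i < m → (σ ^ i) a ≠ a) : Nat.card {x // σ.SameCycle a x} = m := by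
  have hbij : Function.Bijective
      (fun i : Fin m => (⟨(σ ^ i.1) a, ⟨i.1, by rw [zpow_natCast]⟩⟩ : {x // σ.SameCycle a x})) := by
    constructor
    · have key : ∀ i j : Fin m, i < j → (σ ^ i.1) a ≠ (σ ^ j.1) a := by
        intro i j hij heq
        have hij' : i.1 < j.1 := hij
        apply h' (j.1 - i.1) (by omega) (by omega)
        apply (σ ^ i.1).injective
        rw [← Perm.mul_apply, ← pow_add, Nat.add_sub_cancel' hij'.le, heq]
      intro i j hij
      have hij := Subtype.ext_iff.1 hij
      rcases lt_trichotomy i j with h1 | h1 | h1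
      · exact absurd hij (key i j h1)
      · exact h1
      · exact absurd hij.symm (key j i h1)
    · rintro ⟨x, z, rfl⟩
      have h0 := Int.emod_nonneg z (Int.natCast_ne_zero.2 hm.ne')
      have h1 := Int.emod_lt_of_pos z (Int.natCast_pos.2 hm)
      refine ⟨⟨(z % m).toNat, by omega⟩, Subtype.ext ?_⟩
      change (σ ^ (z % m).toNat) a = (σ ^ z) a
      conv_rhs => rw [← Int.emod_add_mul_ediv z m]
      rw [zpow_add, Perm.mul_apply, zpow_mul, zpow_natCast,
        Perm.zpow_apply_eq_self_of_apply_eq_self h, ← zpow_natCast, Int.toNat_of_nonneg h0]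
  rw [← Nat.card_congr (Equiv.ofBijective _ hbij), Nat.card_eq_fintype_card, Fintype.card_fin]

theorem mul_cycleCount_eq [Finite D] (σ : Perm D) (m : ℕ)
    (h : ∀ a, Nat.card {x // σ.SameCycle a x} = m) : m * cycleCount σ = Nat.card D := by
  have : Fintype D := Fintype.ofFinite D
  have : Fintype (Quotient (Perm.SameCycle.setoid σ)) := Fintype.ofFinite _
  rw [Nat.card_congr (Equiv.sigmaFiberEquiv (Quotient.mk (Perm.SameCycle.setoid σ))).symm,
    Nat.card_sigma, cycleCount, Nat.card_eq_fintype_card, mul_comm]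
  rw [Finset.sum_congr rfl (g := fun _ => m)]
  · simp
  · intro q _
    induction q using Quotient.inductionOn with
    | _ a =>
    rw [← h a]
    apply Nat.card_congr
    refine Equiv.subtypeEquivRight fun x => ?_
    rw [Quotient.eq]
    exact Perm.sameCycle_comm

end CycleCard

/-! ### The surface of a rotation system on a Cayley graph -/

section CayleySurface

variable {A ι : Type} (R : A → Perm (ι × Bool))

/-- The rotation of a Cayley graph given by local rotations. -/
def cayleyRot : Perm (A × (ι × Bool)) := Equiv.prodShear (Equiv.refl A) R

theorem cayleyRot_apply (v : A) (y : ι × Bool) : cayleyRot R (v, y) = (v, R v y) := rfl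

theorem cayleyRot_pow (n : ℕ) (v : A) (y : ι × Bool) :
    (cayleyRot R ^ n) (v, y) = (v, (R v ^ n) y) := by
  induction n with
  | zero => rfl
  | succ n ih => rw [pow_succ', Perm.mul_apply, ih, cayleyRot_apply, pow_succ', Perm.mul_apply]

theorem cayleyRot_sameCycle_fst {x y : A × (ι × Bool)} (h : (cayleyRot R).SameCycle x y) :
    x.1 = y.1 := by
  have key : ∀ n : ℕ, ∀ x : A × (ι × Bool), ((cayleyRot R ^ n) x).1 = x.1 := fun n x => by
    rw [show x = (x.1, x.2) from rfl, cayleyRot_pow]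
  obtain ⟨z, rfl⟩ := h
  obtain ⟨n, rfl | rfl⟩ := z.eq_nat_or_neg
  · rw [zpow_natCast, key]
  · have := key n ((cayleyRot R ^ n)⁻¹ x)
    rw [← Perm.mul_apply, mul_inv_cancel, Perm.one_apply] at this
    rw [zpow_neg, zpow_natCast, this]

variable (htrans : ∀ v x y, ∃ n : ℕ, (R v ^ n) x = y)

include htrans in
theorem cayleyRot_sameCycle_iff {x y : A × (ι × Bool)} :
    (cayleyRot R).SameCycle x y ↔ x.1 = y.1 := by
  refine ⟨cayleyRot_sameCycle_fst R, ?_⟩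
  rcases x with ⟨v, x⟩
  rcases y with ⟨w, y⟩
  rintro (rfl : v = w)
  obtain ⟨n, hn⟩ := htrans v x y
  exact ⟨n, by rw [zpow_natCast, cayleyRot_pow, hn]⟩

variable [AddCommGroup A] (f : ι × Bool → A) (hf : ∀ y, f (jumpNeg y) = -f y)

include hf in
theorem cayleyRev_involutive :
    Function.Involutive (fun d : A × (ι × Bool) => (d.1 + f d.2, jumpNeg d.2)) := by
  rintro ⟨v, y⟩
  simp [hf]

/-- The reversal of the darts of a Cayley graph. -/
def cayleyRev : Perm (A × (ι × Bool)) := (cayleyRev_involutive f hf).toPerm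

theorem cayleyRev_apply (v : A) (y : ι × Bool) :
    cayleyRev f hf (v, y) = (v + f y, jumpNeg y) := rfl

variable (hsq : ∀ v y, R (v + f (R v y)) (jumpNeg (R v y)) = y)

include hsq in
theorem cayley_face (v : A) (x y : ι × Bool) (hxy : R v y = x) :
    (cayleyRot R * cayleyRev f hf) (v, x) = (v + f x, y) ∧ R (v + f x) (jumpNeg x) = y := by
  have := hsq v y
  rw [hxy] at this
  exact ⟨by rw [Perm.mul_apply, cayleyRev_apply, cayleyRot_apply, this], this⟩

-- Two steps along a face reverse the jump and four return to the start. A period of one or three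
-- would make the second step a return as well.
include hsq in
theorem cayley_card_face (d : A × (ι × Bool)) :
    Nat.card {x // (cayleyRot R * cayleyRev f hf).SameCycle d x} = 4 := by
  obtain ⟨v, x⟩ := d
  obtain ⟨y, hy⟩ := (R v).surjective x
  set φ := cayleyRot R * cayleyRev f hf with hφ
  obtain ⟨h1, r1⟩ := cayley_face R f hf hsq v x y hy
  obtain ⟨h2, r2⟩ := cayley_face R f hf hsq _ _ _ r1
  obtain ⟨h3, r3⟩ := cayley_face R f hf hsq _ _ _ r2
  obtain ⟨h4, -⟩ := cayley_face R f hf hsq _ _ _ r3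
  rw [← hφ] at h1 h2 h3 h4
  have e2 : (φ ^ 2) (v, x) = (v + f x + f y, jumpNeg x) := by
    rw [sq, Perm.mul_apply, h1, h2]
  have e4 : (φ ^ 4) (v, x) = (v, x) := by
    rw [show 4 = 2 + 2 from rfl, pow_add, Perm.mul_apply, e2, sq, Perm.mul_apply, h3, h4,
      jumpNeg_jumpNeg, hf, hf]
    congr 1
    abel
  have n2 : (φ ^ 2) (v, x) ≠ (v, x) := by
    rw [e2]
    exact fun h => jumpNeg_ne x (congrArg Prod.snd h)
  refine card_sameCycle (by norm_num) e4 fun i h0 hi => ?_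
  interval_cases i
  · intro h
    apply n2
    rw [sq, Perm.mul_apply]
    rw [pow_one] at h
    rw [h, h]
  · exact n2
  · intro h
    apply n2
    have : (φ ^ 6) (v, x) = (v, x) := by
      rw [show 6 = 3 + 3 from rfl, pow_add, Perm.mul_apply, h, h]
    rw [show 6 = 2 + 4 from rfl, pow_add, Perm.mul_apply, e4] at this
    exact this

theorem cayley_card_edge (d : A × (ι × Bool)) :
    Nat.card {x // (cayleyRev f hf).SameCycle d x} = 2 := by
  refine card_sameCycle (by norm_num) ?_ fun i h0 hi => ?_
  · rw [sq, Perm.mul_apply]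
    exact cayleyRev_involutive f hf d
  · interval_cases i
    rw [pow_one]
    exact fun h => jumpNeg_ne d.2 (congrArg Prod.snd h)

variable [Finite A] [Finite ι] [Nonempty ι]
  (hgen : ∀ v w, Relation.ReflTransGen (fun u u' => ∃ y, u' = u + f y) v w)

/-- The surface of a rotation system on a connected Cayley graph. -/
def cayleySurface : CellSurface where
  Dart := A × (ι × Bool)
  finite_dart := inferInstance
  nonempty_dart := inferInstance
  rot := cayleyRot R
  rev := cayleyRev f hf
  rev_rev := cayleyRev_involutive f hf
  rev_ne d h := jumpNeg_ne d.2 (congrArg Prod.snd h)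
  connected := by
    set H := Subgroup.closure ({cayleyRot R, cayleyRev f hf} : Set (Perm (A × (ι × Bool))))
    have hrot : cayleyRot R ∈ H := Subgroup.subset_closure (by simp)
    have hrev : cayleyRev f hf ∈ H := Subgroup.subset_closure (by simp)
    have local_trans : ∀ v x y, ∃ p ∈ H, p (v, x) = (v, y) := by
      intro v x y
      obtain ⟨n, hn⟩ := htrans v x y
      exact ⟨_, H.pow_mem hrot n, by rw [cayleyRot_pow, hn]⟩
    rintro ⟨v, x⟩ ⟨w, y⟩
    have key : ∃ p ∈ H, ∃ z, p (v, x) = (w, z) := by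
      induction hgen v w with
      | refl => exact ⟨1, H.one_mem, x, rfl⟩
      | tail _ h ih =>
        obtain ⟨u, rfl⟩ := h
        obtain ⟨p, hp, z, hz⟩ := ih
        obtain ⟨q, hq, hqz⟩ := local_trans _ z u
        exact ⟨cayleyRev f hf * q * p, H.mul_mem (H.mul_mem hrev hq) hp, jumpNeg u, by
          rw [Perm.mul_apply, hz, Perm.mul_apply, hqz, cayleyRev_apply]⟩
    obtain ⟨p, hp, z, hz⟩ := key
    obtain ⟨q, hq, hqz⟩ := local_trans _ z y
    exact ⟨q * p, H.mul_mem hq hp, by rw [Perm.mul_apply, hz, hqz]⟩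

-- With `n` vertices and `k` generators there are `nk` edges and, all faces being quadrilaterals,
-- `nk / 2` faces; doubling avoids the division.
include hsq in
theorem cayleySurface_eulerChar : 2 * (cayleySurface R htrans f hf hgen).eulerChar =
    Nat.card A * (2 - Nat.card ι) := by
  have hD : Nat.card (A × (ι × Bool)) = Nat.card A * (2 * Nat.card ι) := by
    rw [Nat.card_prod, Nat.card_prod, Nat.card_eq_fintype_card (α := Bool), Fintype.card_bool, mul_comm 2]
  have hV : cycleCount (cayleyRot R) = Nat.card A := by
    have := mul_cycleCount_eq (cayleyRot R) (2 * Nat.card ι) (fun d => by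
      have e : {x // (cayleyRot R).SameCycle d x} ≃ ι × Bool :=
        { toFun := fun x => x.1.2
          invFun := fun y => ⟨(d.1, y), (cayleyRot_sameCycle_iff R htrans).2 rfl⟩
          left_inv := by
            rintro ⟨⟨v, y⟩, h⟩
            have h' : d.1 = v := (cayleyRot_sameCycle_iff R htrans).1 h
            exact Subtype.ext (Prod.ext h' rfl)
          right_inv := fun y => rfl }
      rw [Nat.card_congr e, Nat.card_prod, Nat.card_eq_fintype_card (α := Bool), Fintype.card_bool,
        mul_comm])
    rw [hD, mul_comm (Nat.card A)] at this
    exact Nat.eq_of_mul_eq_mul_left (by have := Nat.card_pos (α := ι); omega) this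
  have hE := mul_cycleCount_eq (cayleyRev f hf) 2 (cayley_card_edge f hf)
  have hF := mul_cycleCount_eq (cayleyRot R * cayleyRev f hf) 4 (cayley_card_face R f hf hsq)
  rw [hD] at hE hF
  have hchar : (cayleySurface R htrans f hf hgen).eulerChar = (cycleCount (cayleyRot R) : ℤ) -
    cycleCount (cayleyRev f hf) + cycleCount (cayleyRot R * cayleyRev f hf) := rfl
  rw [hchar, hV]
  zify at hE hF
  linarith

end CayleySurface

/-! ### Circulant graphs with distinct 2-adic valuations -/

section Circulant

/-- Jumps of pairwise different 2-adic valuations, all smaller than that of the order. -/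
structure TwoAdicJumps (n : ℕ) {k : ℕ} (a e : Fin k → ℕ) (c : Fin k → ℤ) : Prop where
  pos : ∀ i, 0 < a i
  two_mul_lt : ∀ i, 2 * a i < n
  anti : StrictAnti e
  odd : ∀ i, c i % 2 = 1
  eq : ∀ i, (a i : ℤ) = 2 ^ e i * c i
  dvd : ∀ i, (2 : ℤ) ^ (e i + 1) ∣ n

/-- The displacement of a signed jump in a circulant graph. -/
def circulantStep (n : ℕ) {k : ℕ} (a : Fin k → ℕ) (y : Fin k × Bool) : ZMod n :=
  ((jumpStep (fun i => (a i : ℤ)) y : ℤ) : ZMod n)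

namespace TwoAdicJumps

variable {n k : ℕ} {a e : Fin k → ℕ} {c : Fin k → ℤ} (h : TwoAdicJumps n a e c)
include h

theorem jumpStep_eq (y : Fin k × Bool) :
    ∃ q, jumpStep (fun i => (a i : ℤ)) y = 2 ^ e y.1 * q ∧ q % 2 = 1 := by
  rcases y with ⟨i, _ | _⟩
  · exact ⟨c i, h.eq i, h.odd i⟩
  · refine ⟨-c i, ?_, by have := h.odd i; omega⟩
    change -(a i : ℤ) = _
    rw [h.eq i]; ring

theorem pow_dvd_jumpStep {m : ℕ} {y : Fin k × Bool} (hm : m ≤ e y.1) :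
    (2 : ℤ) ^ m ∣ jumpStep (fun i => (a i : ℤ)) y := by
  obtain ⟨q, hq, -⟩ := h.jumpStep_eq y
  rw [hq]
  exact (pow_dvd_pow 2 hm).mul_right q

omit h in
theorem not_pow_dvd_mul {m : ℕ} {q : ℤ} (hq : q % 2 = 1) : ¬ (2 : ℤ) ^ (m + 1) ∣ 2 ^ m * q := by
  rw [pow_succ, mul_dvd_mul_iff_left (by positivity)]
  omega

theorem not_pow_dvd_jumpStep (y : Fin k × Bool) :
    ¬ (2 : ℤ) ^ (e y.1 + 1) ∣ jumpStep (fun i => (a i : ℤ)) y := by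
  obtain ⟨q, hq, hq2⟩ := h.jumpStep_eq y
  rw [hq]
  exact not_pow_dvd_mul hq2

theorem not_dvd_sub_of_lt {x y : Fin k × Bool} (hxy : x.1 < y.1) :
    ¬ (n : ℤ) ∣ jumpStep (fun i => (a i : ℤ)) x - jumpStep (fun i => (a i : ℤ)) y := by
  intro hd
  exact h.not_pow_dvd_jumpStep y ((dvd_sub_right (h.pow_dvd_jumpStep (h.anti hxy))).1
    ((h.dvd y.1).trans hd))

/-- Different generators are told apart by their valuations, and the two signs of one generator by
`0 < 2 * a i < n`. -/
theorem circulantStep_injective : Function.Injective (circulantStep n a) := by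
  intro x y hxy
  have hd := (ZMod.intCast_eq_intCast_iff_dvd_sub _ _ n).1 hxy
  have hd' := (ZMod.intCast_eq_intCast_iff_dvd_sub _ _ n).1 hxy.symm
  rcases lt_trichotomy x.1 y.1 with h1 | h1 | h1
  · exact absurd hd' (h.not_dvd_sub_of_lt h1)
  · rcases x with ⟨i, σ⟩
    rcases y with ⟨j, τ⟩
    obtain rfl : i = j := h1
    have h2 := h.two_mul_lt i
    have h3 := h.pos i
    have key : ¬ (n : ℤ) ∣ 2 * a i := fun hd => by
      have := Int.le_of_dvd (by omega) hd
      omega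
    cases σ <;> cases τ
    · rfl
    · exact absurd (by convert hd' using 1; simp [jumpStep]; ring) key
    · exact absurd (by convert hd using 1; simp [jumpStep]; ring) key
    · rfl
  · exact absurd hd (h.not_dvd_sub_of_lt h1)

omit h in
theorem circulantStep_jumpNeg (y : Fin k × Bool) :
    circulantStep n a (jumpNeg y) = -circulantStep n a y := by
  simp [circulantStep]

theorem circulantStep_ne_zero (y : Fin k × Bool) : circulantStep n a y ≠ 0 := by
  intro h0
  apply jumpNeg_ne y
  apply h.circulantStep_injective
  rw [circulantStep_jumpNeg, h0, neg_zero]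

theorem adj_iff {u v : ZMod n} : (circulant n a).Adj u v ↔ ∃ y, v = u + circulantStep n a y := by
  rw [circulant, SimpleGraph.circulantGraph, SimpleGraph.fromRel_adj]
  constructor
  · rintro ⟨-, ⟨i, hi⟩ | ⟨i, hi⟩⟩ <;> change (a i : ZMod n) = _ at hi
    · exact ⟨(i, true), by simp only [circulantStep, jumpStep, if_true]; push_cast; rw [hi]; ring⟩
    · exact ⟨(i, false), by
        simp only [circulantStep, jumpStep, Bool.false_eq_true, if_false]; push_cast; rw [hi]; ring⟩
  · rintro ⟨⟨i, σ⟩, rfl⟩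
    refine ⟨fun h0 => h.circulantStep_ne_zero (i, σ) (left_eq_add.1 h0), ?_⟩
    cases σ
    · right
      exact ⟨i, by simp [circulantStep, jumpStep]⟩
    · left
      exact ⟨i, by simp [circulantStep, jumpStep]⟩

theorem isRegularOfDegree [NeZero n] [DecidableRel (circulant n a).Adj] :
    (circulant n a).IsRegularOfDegree (2 * k) := by
  intro v
  rw [← SimpleGraph.card_neighborSet_eq_degree]
  have e : Fin k × Bool ≃ (circulant n a).neighborSet v := Equiv.ofBijective
    (fun y => ⟨v + circulantStep n a y, h.adj_iff.2 ⟨y, rfl⟩⟩) (by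
      constructor
      · intro x y hxy
        exact h.circulantStep_injective (add_left_cancel (Subtype.ext_iff.1 hxy))
      · rintro ⟨w, hw⟩
        obtain ⟨y, rfl⟩ := h.adj_iff.1 hw
        exact ⟨y, rfl⟩)
  rw [← Fintype.card_congr e]
  simp [mul_comm]

theorem not_dvd_of_lt_of_lt {x y z : Fin k × Bool} (hxz : x.1 < z.1) (hyz : y.1 < z.1) :
    ¬ (n : ℤ) ∣ jumpStep (fun i => (a i : ℤ)) x + jumpStep (fun i => (a i : ℤ)) y +
      jumpStep (fun i => (a i : ℤ)) z := by
  intro hd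
  exact h.not_pow_dvd_jumpStep z ((dvd_add_right (dvd_add (h.pow_dvd_jumpStep (h.anti hxz))
    (h.pow_dvd_jumpStep (h.anti hyz)))).1 ((h.dvd z.1).trans hd))

/-- A sum of three odd multiples of a power of two is again an odd multiple. -/
theorem not_dvd_of_eq_of_eq {x y z : Fin k × Bool} (hxz : x.1 = z.1) (hyz : y.1 = z.1) :
    ¬ (n : ℤ) ∣ jumpStep (fun i => (a i : ℤ)) x + jumpStep (fun i => (a i : ℤ)) y +
      jumpStep (fun i => (a i : ℤ)) z := by
  intro hd
  obtain ⟨q1, h1, o1⟩ := h.jumpStep_eq x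
  obtain ⟨q2, h2, o2⟩ := h.jumpStep_eq y
  obtain ⟨q3, h3, o3⟩ := h.jumpStep_eq z
  rw [hxz] at h1
  rw [hyz] at h2
  rw [h1, h2, h3, ← mul_add, ← mul_add] at hd
  exact not_pow_dvd_mul (by omega) ((h.dvd z.1).trans hd)

variable (hdouble : ∀ i j : Fin k, j.val = i.val + 1 →
  ¬ (n : ℤ) ∣ a i - 2 * a j ∧ ¬ (n : ℤ) ∣ a i + 2 * a j)
include hdouble

/-- Two opposite jumps cancel and leave a nonzero one. Two equal jumps leave the relation excluded
by `hdouble`, or one between generators whose indices are not consecutive. -/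
theorem not_dvd_of_lt_of_eq {x y z : Fin k × Bool} (hxz : x.1 < z.1) (hyz : y.1 = z.1) :
    ¬ (n : ℤ) ∣ jumpStep (fun i => (a i : ℤ)) x + jumpStep (fun i => (a i : ℤ)) y +
      jumpStep (fun i => (a i : ℤ)) z := by
  intro hd
  by_cases hσ : y.2 = z.2
  · obtain rfl : y = z := Prod.ext hyz hσ
    rw [add_assoc, ← two_mul] at hd
    by_cases hj : y.1.val = x.1.val + 1
    · obtain ⟨h1, h2⟩ := hdouble _ _ hj
      rcases x with ⟨i, _ | _⟩ <;> rcases y with ⟨j, _ | _⟩ <;>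
        simp only [jumpStep, Bool.false_eq_true, if_false, if_true] at hd <;>
        obtain ⟨q, hq⟩ := hd
      · exact h2 ⟨q, hq⟩
      · exact h1 ⟨q, by linear_combination hq⟩
      · exact h1 ⟨-q, by linear_combination -hq⟩
      · exact h2 ⟨-q, by linear_combination -hq⟩
    · have hlt : x.1.val + 1 < y.1.val := by
        have : x.1.val < y.1.val := hxz
        omega
      -- A generator in between forces the valuations of `x` and `y` to differ by at least two, so
      -- doubling `y` cannot reach that of `x`.
      let m : Fin k := ⟨x.1.val + 1, by omega⟩
      have e1 : e m < e x.1 := h.anti (Fin.lt_def.2 (by simp [m]))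
      have e2 : e y.1 < e m := h.anti (Fin.lt_def.2 (by simpa [m] using hlt))
      have d1 : (2 : ℤ) ^ (e y.1 + 2) ∣ n := (pow_dvd_pow 2 (by omega)).trans (h.dvd x.1)
      have d2 := h.pow_dvd_jumpStep (m := e y.1 + 2) (y := x) (by omega)
      have d3 := (dvd_add_right d2).1 (d1.trans hd)
      rw [show e y.1 + 2 = (e y.1 + 1) + 1 from rfl, pow_succ',
        mul_dvd_mul_iff_left (by norm_num)] at d3
      exact h.not_pow_dvd_jumpStep y d3
  · have : y = jumpNeg z := by
      refine Prod.ext hyz ?_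
      revert hσ
      change y.2 ≠ z.2 → y.2 = !z.2
      cases y.2 <;> cases z.2 <;> simp
    rw [this, jumpStep_jumpNeg, neg_add_cancel_right] at hd
    exact h.not_pow_dvd_jumpStep x ((h.dvd x.1).trans hd)

theorem not_dvd_add_add (x y z : Fin k × Bool) :
    ¬ (n : ℤ) ∣ jumpStep (fun i => (a i : ℤ)) x + jumpStep (fun i => (a i : ℤ)) y +
      jumpStep (fun i => (a i : ℤ)) z := by
  rcases lt_trichotomy x.1 y.1 with h1 | h1 | h1 <;> rcases lt_trichotomy y.1 z.1 with h2 | h2 | h2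
  · exact h.not_dvd_of_lt_of_lt (h1.trans h2) h2
  · exact h.not_dvd_of_lt_of_eq hdouble (h2 ▸ h1) h2
  · rw [add_right_comm]
    exact h.not_dvd_of_lt_of_lt h1 h2
  · exact h.not_dvd_of_lt_of_lt (h1 ▸ h2) h2
  · exact h.not_dvd_of_eq_of_eq (h1.trans h2) h2
  · rw [add_comm, ← add_assoc]
    exact h.not_dvd_of_lt_of_eq hdouble h2 h1
  · rcases lt_trichotomy x.1 z.1 with h3 | h3 | h3
    · exact h.not_dvd_of_lt_of_lt h3 h2
    · rw [add_comm (jumpStep _ x)]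
      exact h.not_dvd_of_lt_of_eq hdouble h2 h3
    · rw [add_comm, ← add_assoc, add_right_comm]
      exact h.not_dvd_of_lt_of_lt h3 h1
  · rw [add_comm, ← add_assoc, add_right_comm]
    exact h.not_dvd_of_lt_of_lt (h2 ▸ h1) h1
  · rw [add_comm, ← add_assoc, add_right_comm]
    exact h.not_dvd_of_lt_of_lt (h2.trans h1) h1

theorem triangle_free (u v w : ZMod n) (huv : (circulant n a).Adj u v)
    (hvw : (circulant n a).Adj v w) : ¬ (circulant n a).Adj w u := by
  intro hwu
  obtain ⟨x, rfl⟩ := h.adj_iff.1 huv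
  obtain ⟨y, rfl⟩ := h.adj_iff.1 hvw
  obtain ⟨z, hz⟩ := h.adj_iff.1 hwu
  apply h.not_dvd_add_add hdouble x y z
  rw [← ZMod.intCast_zmod_eq_zero_iff_dvd]
  have : circulantStep n a x + circulantStep n a y + circulantStep n a z = 0 := by
    rw [add_assoc, add_assoc, left_eq_add, ← add_assoc] at hz
    exact hz
  rw [← this]
  simp [circulantStep]

end TwoAdicJumps

end Circulant

/-! ### Combining the two bounds -/

section Genus

/-- The system depends on vertices modulo `N` only, and `N` divides `n`, so it may be read at
representatives in `ℤ`. -/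
theorem exists_zmod_rotation {n : ℕ} [NeZero n] {k : ℕ} {N : ℤ} {a : Fin k → ℕ} (hN : N ∣ n)
    (h : HasQuad N (fun i => (a i : ℤ))) : ∃ R : ZMod n → Perm (Fin k × Bool),
      (∀ v x y, ∃ m : ℕ, (R v ^ m) x = y) ∧
      ∀ v y, R (v + circulantStep n a (R v y)) (jumpNeg (R v y)) = y := by
  obtain ⟨ρ, -, -, hρ, -⟩ := h
  refine ⟨fun v => Equiv.ofBijective (ρ (v.val : ℤ)) ⟨hρ.injective _, hρ.surjective _⟩,
    fun v x y => ?_, fun v y => ?_⟩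
  · obtain ⟨m, hm⟩ := hρ.trans (v.val : ℤ) x y
    refine ⟨m, ?_⟩
    rw [← hm, Perm.coe_pow]
    rfl
  · change ρ ((v + circulantStep n a (ρ (v.val : ℤ) y)).val : ℤ) (jumpNeg (ρ (v.val : ℤ) y)) = y
    rw [hρ.eq_of_dvd (w := (v.val : ℤ) + jumpStep (fun i => (a i : ℤ)) (ρ (v.val : ℤ) y)),
      hρ.square]
    refine hN.trans ?_
    rw [← ZMod.intCast_zmod_eq_zero_iff_dvd]
    push_cast
    rw [ZMod.natCast_zmod_val, ZMod.natCast_zmod_val, circulantStep, sub_self]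

variable {n k : ℕ} {a e : Fin k → ℕ} {c : Fin k → ℤ}

theorem TwoAdicJumps.embedsInGenus [NeZero n] (h : TwoAdicJumps n a e c) (hk : 0 < k)
    (hconn : (circulant n a).Connected) {N : ℤ} (hN : N ∣ n)
    (hQ : HasQuad N (fun i => (a i : ℤ))) {g : ℕ} (hg : (n : ℤ) * (2 - k) = 4 - 4 * g) :
    EmbedsInGenus (circulant n a) g := by
  obtain ⟨R, htrans, hsq⟩ := exists_zmod_rotation hN hQ
  have : Nonempty (Fin k) := ⟨⟨0, hk⟩⟩
  have hgen : ∀ v w, Relation.ReflTransGen (fun u u' => ∃ y, u' = u + circulantStep n a y) v w := by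
    intro v w
    have := (SimpleGraph.reachable_iff_reflTransGen v w).1 (hconn.preconnected v w)
    exact Relation.ReflTransGen.mono (fun u u' hu => h.adj_iff.1 hu) _ _ this
  let S := cayleySurface R htrans (circulantStep n a) TwoAdicJumps.circulantStep_jumpNeg hgen
  have hS : S.IsOfGenus g := by
    have hchar := cayleySurface_eulerChar R htrans (circulantStep n a)
      TwoAdicJumps.circulantStep_jumpNeg hsq hgen
    rw [Nat.card_zmod, Nat.card_eq_fintype_card, Fintype.card_fin, hg] at hchar
    change S.eulerChar = _
    linarith
  choose j hj using fun d : (circulant n a).Dart => h.adj_iff.1 d.adj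
  refine ⟨S, hS, ⟨{
    onVertex := fun v => S.source (v, (⟨0, hk⟩, false))
    onVertex_injective := fun v w hvw => cayleyRot_sameCycle_fst R (Quotient.exact hvw)
    onDart := fun d => (d.fst, j d)
    onDart_injective := ?_
    onDart_symm := ?_
    source_onDart := fun d => Quotient.sound ((cayleyRot_sameCycle_iff R htrans).2 rfl) }⟩⟩
  · intro d d' hd
    have h1 := congrArg Prod.fst hd
    have h2 := congrArg Prod.snd hd
    refine SimpleGraph.Dart.ext _ _ (Prod.ext h1 ?_)
    have e1 := hj d
    have e2 := hj d'
    dsimp only at h1 h2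
    rw [h1, h2] at e1
    exact e1.trans e2.symm
  · intro d
    have e1 := hj d
    have e2 := hj d.symm
    refine Prod.ext e1 ?_
    apply h.circulantStep_injective
    change circulantStep n a (j d.symm) = circulantStep n a (jumpNeg (j d))
    rw [TwoAdicJumps.circulantStep_jumpNeg]
    change d.fst = d.snd + circulantStep n a (j d.symm) at e2
    change d.snd = d.fst + circulantStep n a (j d) at e1
    rw [e1, add_assoc, left_eq_add] at e2
    exact eq_neg_of_add_eq_zero_right e2

theorem TwoAdicJumps.hasGenus [NeZero n] (h : TwoAdicJumps n a e c) (hk : 0 < k)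
    (hconn : (circulant n a).Connected) {N : ℤ} (hN : N ∣ n)
    (hQ : HasQuad N (fun i => (a i : ℤ)))
    (hdouble : ∀ i j : Fin k, j.val = i.val + 1 →
      ¬ (n : ℤ) ∣ a i - 2 * a j ∧ ¬ (n : ℤ) ∣ a i + 2 * a j)
    {g : ℕ} (hg : (n : ℤ) * (2 - k) = 4 - 4 * g) : HasGenus (circulant n a) g := by
  classical
  refine ⟨h.embedsInGenus hk hconn hN hQ hg, fun g' hg' => ?_⟩
  have := hg'.le_of_regular (by omega) h.isRegularOfDegree (h.triangle_free hdouble)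
  rw [ZMod.card] at this
  have h2 : 2 * (k * n) + 8 ≤ 8 * g' + 4 * n := by rw [← mul_assoc]; exact this
  zify at h2 ⊢
  nlinarith

end Genus

theorem proposition4p4 (k n r l : ℕ) (a s b : Fin k → ℕ) (hk : 3 ≤ k)
    -- the jumps of a circulant graph, none of them equal to `n / 2`
    (ha : ∀ i, 0 < a i ∧ a i ≤ n / 2) (ha' : ∀ i, n ≠ 2 * a i)
    (hconn : (circulant n a).Connected)
    (hn : n = 2 ^ r * l) (hl : Odd l)
    -- `a_i = 2 ^ (r_i) * l_i` with `l_i` odd and `0 < r_i < r`, for `i < k`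
    (hfac : ∀ i : Fin k, i.val + 1 < k →
      a i = 2 ^ s i * b i ∧ Odd (b i) ∧ 0 < s i ∧ s i < r)
    -- `r_{i+1} < r_i` for `i + 1 < k`
    (hdec : ∀ i j : Fin k, j.val = i.val + 1 → j.val + 1 < k → s j < s i)
    -- `a_k` is odd
    (hlast : ∀ i : Fin k, i.val + 1 = k → Odd (a i))
    -- `a_i ≠ ± 2 a_{i+1}` modulo `n`
    (hdouble : ∀ i j : Fin k, j.val = i.val + 1 →
      (a i : ZMod n) ≠ 2 * (a j : ZMod n) ∧ (a i : ZMod n) ≠ -(2 * (a j : ZMod n))) :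
    ∃ g : ℕ, HasGenus (circulant n a) g ∧
      (g : ℚ) = ((n : ℚ) * k - 2 * n + 4) / 4 := by
  obtain ⟨m, rfl⟩ : ∃ m, k = m + 3 := ⟨k - 3, by omega⟩
  have hn0 : n ≠ 0 := by
    rw [hn]
    have := hl.pos
    positivity
  have : NeZero n := ⟨hn0⟩
  -- The last jump is odd: its valuation is `0` and its odd part is the jump itself.
  let e : Fin (m + 3) → ℕ := fun i => if i.val + 1 < m + 3 then s i else 0
  let c : Fin (m + 3) → ℤ := fun i => if i.val + 1 < m + 3 then b i else a i
  have hanti : StrictAnti e := by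
    rw [Fin.strictAnti_iff_succ_lt]
    intro i
    simp only [e, Fin.val_succ, Fin.val_castSucc]
    have hi := i.2
    rw [if_pos (show i.val + 1 < m + 3 by omega)]
    split_ifs with h1
    · exact hdec _ _ (by simp) (by simpa using h1)
    · exact (hfac i.castSucc (by simp)).2.2.1
  have her : ∀ i, e i + 1 ≤ r := by
    have h0 : e 0 < r := by
      simp only [e]
      rw [if_pos (by simp)]
      exact (hfac 0 (by simp)).2.2.2
    intro i
    have := hanti.antitone (Fin.zero_le i)
    omega
  have h : TwoAdicJumps n a e c :=
    { pos := fun i => (ha i).1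
      two_mul_lt := fun i => by have := (ha i).2; have := ha' i; omega
      anti := hanti
      odd := fun i => by
        simp only [c]
        split_ifs with h1
        · obtain ⟨q, hq⟩ := (hfac i h1).2.1
          omega
        · obtain ⟨q, hq⟩ := hlast i (by omega)
          omega
      eq := fun i => by
        simp only [c, e]
        split_ifs with h1
        · rw [(hfac i h1).1]; push_cast; rfl
        · simp
      dvd := fun i => by
        rw [hn]; push_cast
        exact (pow_dvd_pow 2 (her i)).mul_right _ }
  have hQ : HasQuad (2 ^ (e 0 + 1)) (fun i => (a i : ℤ)) := by
    have := HasQuad.of_strictAnti (m + 1) e c hanti h.odd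
    simpa only [← h.eq] using this
  -- At least three strictly decreasing valuations below `r` exist, so `8 ∣ n` and the claimed genus
  -- is an integer.
  have h8 : 3 ≤ r := by
    have h1 : e 1 < e 0 := hanti (by simp)
    have h2 : 0 < e 1 := by
      have : e (Fin.last _) < e 1 := hanti (by simp [Fin.lt_def])
      omega
    have := her 0
    omega
  obtain ⟨q, hq⟩ : 8 ∣ n := by
    rw [hn]
    exact ((show 8 = 2 ^ 3 by norm_num) ▸ pow_dvd_pow 2 h8 : 8 ∣ 2 ^ r).mul_right l
  -- The formula evaluated at `n = 8 * q` and `k = m + 3`.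
  refine ⟨(2 * m + 2) * q + 1, h.hasGenus (by omega) hconn (h.dvd 0) hQ ?_ ?_, ?_⟩
  · intro i j hij
    obtain ⟨h1, h2⟩ := hdouble i j hij
    constructor
    · intro hd
      rw [← ZMod.intCast_zmod_eq_zero_iff_dvd] at hd
      push_cast at hd
      exact h1 (sub_eq_zero.1 hd)
    · intro hd
      rw [← ZMod.intCast_zmod_eq_zero_iff_dvd] at hd
      push_cast at hd
      exact h2 (eq_neg_of_add_eq_zero_left hd)
  · rw [hq]; push_cast; ring
  · rw [hq]; push_cast; ring
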